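/- Let $(X_\pm,\sigma_\pm)$ be holomorphic Poisson manifolds and let $X_+\xleftarrow{\pi_+}(Z,\Omega)\xrightarrow{\pi_-}X_-$ be a holomorphic symplectic Morita equivalence: $(Z,\Omega)$ is a holomorphic symplectic manifold, $\pi_\pm$ are holomorphic surjective submersions with connected and simply connected fibres, $\pi_+$ is Poisson and $\pi_-$ anti-Poisson, $\ker d\pi_+$ and $\ker d\pi_-$ are the symplectic orthogonals of each other, and $\pi_\pm$ are complete (for the underlying real structures, the pullback of any complete Hamiltonian vector field is complete). For an open set $U\subseteq X_-$, a *brane bisection over $U$* is a smooth section $b:U\to Z$ of $\pi_-$ such that $\pi_+\circ b$ is a diffeomorphism of $U$ onto an open subset of $X_+$ and $b(U)$ is Lagrangian for the real symplectic form $\operatorname{Im}\Omega$. A *holomorphic Lagrangian bisection over $U$* is a holomorphic section $b:U\to Z$ of $\pi_-$ such that $\pi_+\circ b$ is a biholomorphism of $U$ onto an open subset of $X_+$ and $b(U)$ is Lagrangian for $\Omega$. Let $\mathcal L$ be a brane bisection over an open set $U\subseteq X_-$ (for instance a global one), and let $z\in\mathcal L(U)$. Then: 1. There is a holomorphic Lagrangian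 bisection $\Lambda$ over some open set $U'\subseteq X_-$ with $z\in\Lambda(U')$. 2. For every holomorphic Lagrangian bisection $\Lambda$ over an open set $U'\subseteq X_-$ with $z\in\Lambda(U')$ there are an open neighbourhood $W\subseteq U\cap U'$ of $\pi_-(z)$ and a family of maps $b_t:W\to Z$, $t\in[0,1]$, smooth in $(t,x)\in[0,1]\times W$, such that every $b_t$ is a brane bisection over $W$ with $b_t(\pi_-(z))=z$, and $b_0=\Lambda|_W$, $b_1=\mathcal L|_W$. -/

import Mathlib

open scoped Manifold ContDiff

noncomputable section

/-- The expression of a 2-form (of type (2,0)) in the preferred chart at `z₀`: its pullback by the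
inverse of the chart. -/
def formInChart {E Z : Type*} [NormedAddCommGroup E] [NormedSpace ℂ E]
    [TopologicalSpace Z] [ChartedSpace E Z]
    (form : ∀ z : Z, TangentSpace 𝓘(ℂ, E) z [⋀^Fin 2]→L[ℂ] ℂ) (z₀ : Z) :
    E → E [⋀^Fin 2]→L[ℂ] ℂ :=
  fun y => (form ((extChartAt 𝓘(ℂ, E) z₀).symm y)).compContinuousLinearMap
    (mfderiv 𝓘(ℂ, E) 𝓘(ℂ, E) (extChartAt 𝓘(ℂ, E) z₀).symm y)

/-- A holomorphic symplectic form on a complex manifold: a holomorphic, closed, nondegenerate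
(2,0)-form. -/
structure HolSymplecticForm (E Z : Type*) [NormedAddCommGroup E] [NormedSpace ℂ E]
    [TopologicalSpace Z] [ChartedSpace E Z] where
  /-- The alternating `ℂ`-bilinear form on each tangent space. -/
  form : ∀ z : Z, TangentSpace 𝓘(ℂ, E) z [⋀^Fin 2]→L[ℂ] ℂ
  holomorphic : ∀ z₀ : Z,
    ContDiffOn ℂ ω (formInChart form z₀) (extChartAt 𝓘(ℂ, E) z₀).target
  closed : ∀ z₀ : Z, ∀ y ∈ (extChartAt 𝓘(ℂ, E) z₀).target, extDeriv (formInChart form z₀) y = 0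
  nondegenerate : ∀ (z : Z) (u : TangentSpace 𝓘(ℂ, E) z), (∀ v, form z ![u, v] = 0) → u = 0

/-- The bracket `{f, g} = dg (σ df)` of two functions, for a field `σ` of linear maps from
(holomorphic) cotangent spaces to tangent spaces. -/
def poissonBracket {E X : Type*} [NormedAddCommGroup E] [NormedSpace ℂ E]
    [TopologicalSpace X] [ChartedSpace E X]
    (sharp : ∀ x : X, (TangentSpace 𝓘(ℂ, E) x →L[ℂ] ℂ) →ₗ[ℂ] TangentSpace 𝓘(ℂ, E) x)
    (f g : X → ℂ) : X → ℂ :=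
  fun x => mfderiv 𝓘(ℂ, E) 𝓘(ℂ, ℂ) g x (sharp x (mfderiv 𝓘(ℂ, E) 𝓘(ℂ, ℂ) f x))

/-- A holomorphic Poisson structure on a complex manifold: a bivector field, written as a
skew-symmetric field of maps from cotangent to tangent spaces, which is holomorphic and whose
bracket on local holomorphic functions satisfies the Jacobi identity. -/
structure HolPoisson (E X : Type*) [NormedAddCommGroup E] [NormedSpace ℂ E]
    [TopologicalSpace X] [ChartedSpace E X] where
  /-- The contraction of covectors with the bivector field. -/
  sharp : ∀ x : X, (TangentSpace 𝓘(ℂ, E) x →L[ℂ] ℂ) →ₗ[ℂ] TangentSpace 𝓘(ℂ, E) x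
  skew : ∀ (x : X) (α β : TangentSpace 𝓘(ℂ, E) x →L[ℂ] ℂ), β (sharp x α) = -α (sharp x β)
  holomorphic : ∀ (U : Set X) (f g : X → ℂ), IsOpen U →
    ContMDiffOn 𝓘(ℂ, E) 𝓘(ℂ, ℂ) ω f U → ContMDiffOn 𝓘(ℂ, E) 𝓘(ℂ, ℂ) ω g U →
    ContMDiffOn 𝓘(ℂ, E) 𝓘(ℂ, ℂ) ω (poissonBracket sharp f g) U
  jacobi : ∀ (U : Set X) (f g h : X → ℂ), IsOpen U →
    ContMDiffOn 𝓘(ℂ, E) 𝓘(ℂ, ℂ) ω f U → ContMDiffOn 𝓘(ℂ, E) 𝓘(ℂ, ℂ) ω g U →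
    ContMDiffOn 𝓘(ℂ, E) 𝓘(ℂ, ℂ) ω h U → ∀ x ∈ U,
    poissonBracket sharp f (poissonBracket sharp g h) x
      + poissonBracket sharp g (poissonBracket sharp h f) x
      + poissonBracket sharp h (poissonBracket sharp f g) x = 0

/-- A real vector field is complete: through each point there is an integral curve defined for all
times. -/
def IsCompleteVectorField {E X : Type*} [NormedAddCommGroup E] [NormedSpace ℝ E]
    [TopologicalSpace X] [ChartedSpace E X] (Y : ∀ x : X, TangentSpace 𝓘(ℝ, E) x) : Prop :=
  ∀ x : X, ∃ γ : ℝ → X, γ 0 = x ∧ IsMIntegralCurve γ Y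

/-- `Y` is the Hamiltonian vector field of the real function `h` for the real Poisson structure
underlying a holomorphic one (its imaginary part, up to a constant factor): `Y = σ α`, where `α` is
the complex-linear covector with imaginary part `dh`. -/
def HolPoisson.IsHamiltonian {E X : Type*} [NormedAddCommGroup E] [NormedSpace ℂ E]
    [TopologicalSpace X] [ChartedSpace E X] (σ : HolPoisson E X) (h : X → ℝ)
    (Y : ∀ x : X, TangentSpace 𝓘(ℝ, E) x) : Prop :=
  ∀ x : X, ∃ α : TangentSpace 𝓘(ℂ, E) x →L[ℂ] ℂ,
    (∀ v, (α v).im = mfderiv 𝓘(ℝ, E) 𝓘(ℝ, ℝ) h x v) ∧ Y x = σ.sharp x α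

/-- `V` is the Hamiltonian vector field of the real function `H` for the real symplectic form
`Im Ω`. -/
def HolSymplecticForm.IsHamiltonian {E Z : Type*} [NormedAddCommGroup E] [NormedSpace ℂ E]
    [TopologicalSpace Z] [ChartedSpace E Z] (Ω : HolSymplecticForm E Z) (H : Z → ℝ)
    (V : ∀ z : Z, TangentSpace 𝓘(ℝ, E) z) : Prop :=
  ∀ (z : Z) (w : TangentSpace 𝓘(ℝ, E) z),
    (Ω.form z ![V z, w]).im = mfderiv 𝓘(ℝ, E) 𝓘(ℝ, ℝ) H z w

/-- A map from a holomorphic symplectic manifold is Poisson up to the factor `ε` (Poisson for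
`ε = 1`, anti-Poisson for `ε = -1`): the Hamiltonian vector of a pulled back covector projects to
`ε` times the Hamiltonian vector of the covector. -/
def IsPoissonUpTo {EZ Z E X : Type*} [NormedAddCommGroup EZ] [NormedSpace ℂ EZ]
    [TopologicalSpace Z] [ChartedSpace EZ Z] [NormedAddCommGroup E] [NormedSpace ℂ E]
    [TopologicalSpace X] [ChartedSpace E X]
    (Ω : HolSymplecticForm EZ Z) (σ : HolPoisson E X) (p : Z → X) (ε : ℂ) : Prop :=
  ∀ (z : Z) (α : TangentSpace 𝓘(ℂ, E) (p z) →L[ℂ] ℂ) (u : TangentSpace 𝓘(ℂ, EZ) z),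
    (∀ w, Ω.form z ![u, w] = α (mfderiv 𝓘(ℂ, EZ) 𝓘(ℂ, E) p z w)) →
    mfderiv 𝓘(ℂ, EZ) 𝓘(ℂ, E) p z u = ε • σ.sharp (p z) α

/-- A map is complete: the pullback of any complete Hamiltonian vector field is complete (for the
underlying real symplectic and Poisson structures). -/
def IsCompleteMap {EZ Z E X : Type*} [NormedAddCommGroup EZ] [NormedSpace ℂ EZ]
    [TopologicalSpace Z] [ChartedSpace EZ Z] [NormedAddCommGroup E] [NormedSpace ℂ E]
    [TopologicalSpace X] [ChartedSpace E X]
    (Ω : HolSymplecticForm EZ Z) (σ : HolPoisson E X) (p : Z → X) : Prop :=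
  ∀ (h : X → ℝ) (Y : ∀ x : X, TangentSpace 𝓘(ℝ, E) x) (V : ∀ z : Z, TangentSpace 𝓘(ℝ, EZ) z),
    ContMDiff 𝓘(ℝ, E) 𝓘(ℝ, ℝ) ∞ h → σ.IsHamiltonian h Y → IsCompleteVectorField Y →
    Ω.IsHamiltonian (h ∘ p) V → IsCompleteVectorField V

/-- A holomorphic surjective submersion with connected and simply connected fibres. -/
structure IsMoritaSubmersion {EZ Z E X : Type*} [NormedAddCommGroup EZ] [NormedSpace ℂ EZ]
    [TopologicalSpace Z] [ChartedSpace EZ Z] [NormedAddCommGroup E] [NormedSpace ℂ E]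
    [TopologicalSpace X] [ChartedSpace E X] (p : Z → X) : Prop where
  holomorphic : ContMDiff 𝓘(ℂ, EZ) 𝓘(ℂ, E) ω p
  surjective : Function.Surjective p
  submersion : ∀ z : Z, Function.Surjective (mfderiv 𝓘(ℂ, EZ) 𝓘(ℂ, E) p z)
  fibre : ∀ x : X, SimplyConnectedSpace (p ⁻¹' {x})

/-- A holomorphic symplectic Morita equivalence `X₊ ← (Z, Ω) → X₋` between holomorphic Poisson
manifolds. -/
structure HolMoritaEquiv {Ep Xp Em Xm : Type*}
    [NormedAddCommGroup Ep] [NormedSpace ℂ Ep] [TopologicalSpace Xp] [ChartedSpace Ep Xp]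
    [NormedAddCommGroup Em] [NormedSpace ℂ Em] [TopologicalSpace Xm] [ChartedSpace Em Xm]
    (σp : HolPoisson Ep Xp) (σm : HolPoisson Em Xm) (EZ Z : Type*)
    [NormedAddCommGroup EZ] [NormedSpace ℂ EZ] [TopologicalSpace Z] [ChartedSpace EZ Z] where
  /-- The holomorphic symplectic form. -/
  Ω : HolSymplecticForm EZ Z
  /-- The projection to the first Poisson manifold. -/
  πp : Z → Xp
  /-- The projection to the second Poisson manifold. -/
  πm : Z → Xm
  submersion_p : IsMoritaSubmersion (EZ := EZ) (E := Ep) πp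
  submersion_m : IsMoritaSubmersion (EZ := EZ) (E := Em) πm
  poisson_p : IsPoissonUpTo Ω σp πp 1
  poisson_m : IsPoissonUpTo Ω σm πm (-1)
  orthogonal : ∀ (z : Z) (u : TangentSpace 𝓘(ℂ, EZ) z),
    mfderiv 𝓘(ℂ, EZ) 𝓘(ℂ, Ep) πp z u = 0 ↔
      ∀ v : TangentSpace 𝓘(ℂ, EZ) z, mfderiv 𝓘(ℂ, EZ) 𝓘(ℂ, Em) πm z v = 0 → Ω.form z ![u, v] = 0
  complete_p : IsCompleteMap Ω σp πp
  complete_m : IsCompleteMap Ω σm πm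

namespace HolMoritaEquiv

variable {Ep Xp Em Xm EZ Z : Type*}
  [NormedAddCommGroup Ep] [NormedSpace ℂ Ep] [TopologicalSpace Xp] [ChartedSpace Ep Xp]
  [NormedAddCommGroup Em] [NormedSpace ℂ Em] [TopologicalSpace Xm] [ChartedSpace Em Xm]
  [NormedAddCommGroup EZ] [NormedSpace ℂ EZ] [TopologicalSpace Z] [ChartedSpace EZ Z]
  {σp : HolPoisson Ep Xp} {σm : HolPoisson Em Xm}

/-- The map `b`, restricted to the open set `U` of `X₋`, is a (local) brane bisection, viewed as a
section of `π₋`: it is smooth over `ℝ`, `π₊ ∘ b` is a diffeomorphism from `U` onto an open subset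
of `X₊`, and the submanifold `b(U)` is Lagrangian for `Im Ω` (each tangent space is equal to its own
orthogonal). A global brane bisection is the case where `U` and the open subset of `X₊` are the
whole spaces. -/
structure IsBraneBisectionOn (M : HolMoritaEquiv σp σm EZ Z) (U : Set Xm) (b : Xm → Z) :
    Prop where
  isOpen : IsOpen U
  smooth : ContMDiffOn 𝓘(ℝ, Em) 𝓘(ℝ, EZ) ∞ b U
  section_m : ∀ x ∈ U, M.πm (b x) = x
  isOpen_image : IsOpen ((M.πp ∘ b) '' U)
  section_p : ∃ g : Xp → Xm, ContMDiffOn 𝓘(ℝ, Ep) 𝓘(ℝ, Em) ∞ g ((M.πp ∘ b) '' U) ∧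
    ∀ x ∈ U, g (M.πp (b x)) = x
  lagrangian : ∀ x ∈ U, ∀ v : TangentSpace 𝓘(ℝ, EZ) (b x),
    (∀ u : TangentSpace 𝓘(ℝ, Em) x,
      (M.Ω.form (b x) ![mfderiv 𝓘(ℝ, Em) 𝓘(ℝ, EZ) b x u, v]).im = 0) ↔
    v ∈ Set.range (mfderiv 𝓘(ℝ, Em) 𝓘(ℝ, EZ) b x)

/-- The map `b`, restricted to the open set `U` of `X₋`, is a (local) holomorphic Lagrangian
bisection: it is a holomorphic section of `π₋`, `π₊ ∘ b` is a biholomorphism from `U` onto an open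
subset of `X₊`, and the complex submanifold `b(U)` is Lagrangian for `Ω`. -/
structure IsHolLagrangianBisectionOn (M : HolMoritaEquiv σp σm EZ Z) (U : Set Xm) (b : Xm → Z) :
    Prop where
  isOpen : IsOpen U
  holomorphic : ContMDiffOn 𝓘(ℂ, Em) 𝓘(ℂ, EZ) ω b U
  section_m : ∀ x ∈ U, M.πm (b x) = x
  isOpen_image : IsOpen ((M.πp ∘ b) '' U)
  section_p : ∃ g : Xp → Xm, ContMDiffOn 𝓘(ℂ, Ep) 𝓘(ℂ, Em) ω g ((M.πp ∘ b) '' U) ∧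
    ∀ x ∈ U, g (M.πp (b x)) = x
  lagrangian : ∀ x ∈ U, ∀ v : TangentSpace 𝓘(ℂ, EZ) (b x),
    (∀ u : TangentSpace 𝓘(ℂ, Em) x,
      M.Ω.form (b x) ![mfderiv 𝓘(ℂ, Em) 𝓘(ℂ, EZ) b x u, v] = 0) ↔
    v ∈ Set.range (mfderiv 𝓘(ℂ, Em) 𝓘(ℂ, EZ) b x)

end HolMoritaEquiv

end

/-! The statement is local at `z`, and the plan is to turn it into symplectic linear algebra. A
brane has tangent spaces equal to their own orthogonals for `Im Ω`, which forces `dim Z = 2 dim X₋`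
(`IsBraneBisectionOn.two_mul_finrank`). Since the kernels of the two projections are orthogonals of
each other, `dim X₊ = dim X₋` as well, and both kernels are half-dimensional. The holomorphic
Darboux theorem makes `Ω` a constant form `η` near `z = 0`. A bisection through `z` is then a germ
of Lagrangian submanifold at `0`, transverse to `K₁ = ker dπ₊` and `K₂ = ker dπ₋`. Conversely, the
inverse function theorem makes a bisection of any Lagrangian germ transverse to both.

For existence, a complex linear Lagrangian transverse to `K₁` and `K₂` is itself such a germ
(`exists_isTransverseLagrangian`).

For the isotopy, one first moves the tangent space of the first germ onto that of the second.
Transvections `x ↦ x + c η(v, x) v` with `v ∈ K₁` preserve `K₁`, and fix `K₂` pointwise because `K₁`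
and `K₂` are orthogonal. Paths of products of them move one transverse Lagrangian onto another
(`exists_isSymplecticPath_map_le`), so both transversality conditions hold along the way. The germs
are now tangent at `0`. Written as graphs over their common tangent space with values in a
Lagrangian complement, they are joined by linear interpolation, which stays isotropic and keeps the
tangent space at `0` (`exists_isotropic_family`). An inverse function theorem uniform over the
compact time interval rewrites the family as sections over one fixed neighbourhood
(`exists_section_family`).

Darboux's theorem is proved by Moser's method. The flow of the Moser field is a fixed point in the
Banach space `C([0,1], E)`, found by the inverse function theorem there. This gives a complex `C¹`
dependence on the initial point, which Cauchy's formula, one variable at a time, improves to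
analyticity (`contDiffAt_omega_of_one`). -/

open scoped Manifold ContDiff

noncomputable section

open Set Filter Topology Metric

/-! ### Superposition operators on spaces of continuous maps -/

section Superposition

variable {𝕜 K G F : Type*} [RCLike 𝕜] [TopologicalSpace K] [CompactSpace K]
  [NormedAddCommGroup G] [NormedSpace 𝕜 G] [NormedAddCommGroup F] [NormedSpace 𝕜 F]

open Classical in
/-- The superposition operator `γ ↦ H ∘ γ` on continuous maps from a compact space (with the value
`0` where `H ∘ γ` is not continuous). -/
def superpos {K G F : Type*} [TopologicalSpace K] [TopologicalSpace G] [TopologicalSpace F] [Zero F]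
    (H : G → F) (γ : C(K, G)) : C(K, F) :=
  if h : Continuous (H ∘ γ) then ⟨H ∘ γ, h⟩ else 0

lemma superpos_apply {K G F : Type*} [TopologicalSpace K] [TopologicalSpace G] [TopologicalSpace F]
    [Zero F] {H : G → F} {γ : C(K, G)} (h : ∀ k, ContinuousAt H (γ k)) (k : K) :
    superpos H γ k = H (γ k) := by
  have hc : Continuous (H ∘ γ) :=
    continuous_iff_continuousAt.2 fun k => (h k).comp γ.continuous.continuousAt
  simp [superpos, hc]

/-- Tube lemma: evaluation is jointly continuous and `K` is compact. -/
lemma eventually_forall_of_forall_eventually_apply (γ₀ : C(K, G)) {P : G → Prop}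
    (h : ∀ k, ∀ᶠ y in 𝓝 (γ₀ k), P y) : ∀ᶠ γ : C(K, G) in 𝓝 γ₀, ∀ k, P (γ k) := by
  have key := isCompact_univ.eventually_forall_of_forall_eventually (K := (univ : Set K))
    (x₀ := γ₀) (P := fun γ k => P (γ k)) fun k _ => by
      have hc : ContinuousAt (fun z : C(K, G) × K => z.1 z.2) (γ₀, k) :=
        (ContinuousEval.continuous_eval (F := C(K, G))).continuousAt
      exact hc.eventually (h k)
  filter_upwards [key] with γ hγ k using hγ k (mem_univ k)

/-- Compactness of `K` makes `δ` independent of `k`, although `G` need not be locally compact. -/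
lemma exists_ball_forall_dist_lt {H : G → F} (γ₀ : C(K, G)) (h : ∀ k, ContinuousAt H (γ₀ k))
    {ε : ℝ} (hε : 0 < ε) :
    ∃ δ > 0, ∀ k, ∀ y ∈ ball (γ₀ k) δ, ‖H y - H (γ₀ k)‖ < ε := by
  have key := isCompact_univ.eventually_forall_of_forall_eventually (K := (univ : Set K))
    (x₀ := (0 : G)) (P := fun η k => ‖H (γ₀ k + η) - H (γ₀ k)‖ < ε) fun k _ => by
      have h1 : ContinuousAt (fun z : G × K => H (γ₀ z.2 + z.1)) (0, k) := by
        refine ContinuousAt.comp (g := H) (by simpa using h k) ?_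
        exact ((γ₀.continuous.comp continuous_snd).add continuous_fst).continuousAt
      have h2 : ContinuousAt (fun z : G × K => H (γ₀ z.2)) (0, k) :=
        ContinuousAt.comp (g := H) (h k) (γ₀.continuous.comp continuous_snd).continuousAt
      have h3 := (h1.sub h2).norm
      refine h3.eventually (gt_mem_nhds ?_)
      simpa using hε
  obtain ⟨δ, hδ, hb⟩ := Metric.eventually_nhds_iff.1 key
  refine ⟨δ, hδ, fun k y hy => ?_⟩
  have := hb (y := y - γ₀ k) (by simpa [dist_eq_norm] using hy) k (mem_univ k)
  simpa using this

lemma continuousAt_superpos {H : G → F} {γ₀ : C(K, G)} (h : ∀ k, ∀ᶠ y in 𝓝 (γ₀ k), ContinuousAt H y) :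
    ContinuousAt (superpos H : C(K, G) → C(K, F)) γ₀ := by
  rw [Metric.continuousAt_iff']
  intro ε hε
  have h0 : ∀ k, ContinuousAt H (γ₀ k) := fun k => (h k).self_of_nhds
  obtain ⟨δ, hδ, hb⟩ := exists_ball_forall_dist_lt γ₀ h0 (half_pos hε)
  filter_upwards [eventually_forall_of_forall_eventually_apply γ₀ h, ball_mem_nhds γ₀ hδ]
    with γ hγ hd
  rw [dist_eq_norm]
  refine lt_of_le_of_lt ((ContinuousMap.norm_le _ (half_pos hε).le).2 fun k => ?_) (half_lt_self hε)
  rw [ContinuousMap.sub_apply, superpos_apply hγ, superpos_apply h0]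
  exact (hb k _ (lt_of_le_of_lt (ContinuousMap.dist_apply_le_dist k) hd)).le

/-- A continuous family of continuous linear maps acts on continuous functions. -/
def pointwiseCLM : C(K, G →L[𝕜] F) →L[𝕜] C(K, G) →L[𝕜] C(K, F) :=
  LinearMap.mkContinuous₂
    (LinearMap.mk₂ 𝕜 (fun (A : C(K, G →L[𝕜] F)) (η : C(K, G)) =>
        (⟨fun k => A k (η k), A.continuous.clm_apply η.continuous⟩ : C(K, F)))
      (fun _ _ _ => by ext; simp) (fun _ _ _ => by ext; simp)
      (fun _ _ _ => by ext; simp) (fun _ _ _ => by ext; simp)) 1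
    (fun A η => by
      rw [one_mul]
      refine (ContinuousMap.norm_le _ (by positivity)).2 fun k => ?_
      exact ((A k).le_opNorm _).trans (mul_le_mul (A.norm_coe_le_norm k) (η.norm_coe_le_norm k)
        (norm_nonneg _) (norm_nonneg A)))

@[simp] lemma pointwiseCLM_apply (A : C(K, G →L[𝕜] F)) (η : C(K, G)) (k : K) :
    pointwiseCLM A η k = A k (η k) := rfl

/-- The derivative acts pointwise. The remainder is small in sup norm because the mean value
inequality applies on balls whose radius does not depend on `k`. -/
lemma hasFDerivAt_superpos {H : G → F} {γ₀ : C(K, G)} (h : ∀ k, ContDiffAt 𝕜 1 H (γ₀ k)) :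
    HasFDerivAt (superpos H : C(K, G) → C(K, F))
      (pointwiseCLM (superpos (fderiv 𝕜 H) γ₀)) γ₀ := by
  rw [hasFDerivAt_iff_isLittleO_nhds_zero, Asymptotics.isLittleO_iff]
  intro ε hε
  -- Balls must be convex over `ℝ` for the mean value inequality.
  let _ : NormedSpace ℝ G := NormedSpace.restrictScalars ℝ 𝕜 G
  have hev : ∀ k, ∀ᶠ y in 𝓝 (γ₀ k), ContDiffAt 𝕜 1 H y := fun k => (h k).eventually (by simp)
  have hD : ∀ k, ContinuousAt (fderiv 𝕜 H) (γ₀ k) := fun k =>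
    ((h k).fderiv_right (m := 0) (by simp)).continuousAt
  obtain ⟨δ, hδ, hb⟩ := exists_ball_forall_dist_lt γ₀ hD hε
  have hev' := eventually_forall_of_forall_eventually_apply γ₀ hev
  -- differentiability on a uniform tube
  have key := isCompact_univ.eventually_forall_of_forall_eventually (K := (univ : Set K))
    (x₀ := (0 : G)) (P := fun η k => ContDiffAt 𝕜 1 H (γ₀ k + η)) fun k _ => by
      have hc : ContinuousAt (fun z : G × K => γ₀ z.2 + z.1) (0, k) :=
        ((γ₀.continuous.comp continuous_snd).add continuous_fst).continuousAt
      exact hc.eventually (by simpa using hev k)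
  obtain ⟨δ', hδ', hb'⟩ := Metric.eventually_nhds_iff.1 key
  filter_upwards [ball_mem_nhds (0 : C(K, G)) (lt_min hδ hδ')] with η hη
  have hη0 : ‖η‖ < min δ δ' := by simpa using hη
  refine (ContinuousMap.norm_le _ (by positivity)).2 fun k => ?_
  have hηk : ‖η k‖ < min δ δ' := (η.norm_coe_le_norm k).trans_lt hη0
  have hd : ∀ y ∈ ball (γ₀ k) (min δ δ'), ContDiffAt 𝕜 1 H y := fun y hy => by
    have := hb' (y := y - γ₀ k) (by
      have := lt_of_lt_of_le (mem_ball.1 hy) (min_le_right _ _)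
      simpa [dist_eq_norm] using this) k (mem_univ k)
    simpa using this
  have hall : ∀ j, ContinuousAt H ((γ₀ + η) j) := fun j => by
    have := hb' (y := η j) (by
      have := ((η.norm_coe_le_norm j).trans_lt hη0).trans_le (min_le_right _ _)
      simpa using this) j (mem_univ j)
    simpa using this.continuousAt
  have hmv := Convex.norm_image_sub_le_of_norm_hasFDerivWithin_le' (𝕜 := 𝕜) (f := H)
    (f' := fderiv 𝕜 H) (φ := fderiv 𝕜 H (γ₀ k)) (s := ball (γ₀ k) (min δ δ')) (C := ε)
    (x := γ₀ k) (y := γ₀ k + η k)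
    (fun y hy => ((hd y hy).differentiableAt (by simp)).hasFDerivAt.hasFDerivWithinAt)
    (fun y hy => (hb k y (lt_of_lt_of_le (mem_ball.1 hy) (min_le_left _ _))).le)
    (convex_ball _ _) (mem_ball_self (lt_min hδ hδ')) (by simpa using hηk)
  have e1 : (superpos H (γ₀ + η) : C(K, F)) k = H (γ₀ k + η k) := superpos_apply hall k
  have e2 : (superpos H γ₀ : C(K, F)) k = H (γ₀ k) :=
    superpos_apply (fun j => (h j).continuousAt) k
  have e3 : (superpos (fderiv 𝕜 H) γ₀ : C(K, G →L[𝕜] F)) k = fderiv 𝕜 H (γ₀ k) :=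
    superpos_apply hD k
  rw [ContinuousMap.sub_apply, ContinuousMap.sub_apply, pointwiseCLM_apply, e1, e2, e3]
  rw [add_sub_cancel_left] at hmv
  exact hmv.trans (by gcongr; exact η.norm_coe_le_norm k)

/-- The superposition operator of a `C¹` map is `C¹`. -/
lemma contDiffAt_superpos {H : G → F} {γ₀ : C(K, G)} (h : ∀ k, ContDiffAt 𝕜 1 H (γ₀ k)) :
    ContDiffAt 𝕜 1 (superpos H : C(K, G) → C(K, F)) γ₀ := by
  rw [contDiffAt_one_iff]
  have hev : ∀ k, ∀ᶠ y in 𝓝 (γ₀ k), ContDiffAt 𝕜 1 H y := fun k => (h k).eventually (by simp)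
  refine ⟨fun γ => pointwiseCLM (superpos (fderiv 𝕜 H) γ), {γ | ∀ k, ContDiffAt 𝕜 1 H (γ k)},
    eventually_forall_of_forall_eventually_apply γ₀ hev, fun γ hγ => ?_,
    fun γ hγ => hasFDerivAt_superpos hγ⟩
  refine ContinuousAt.continuousWithinAt ?_
  refine (pointwiseCLM (𝕜 := 𝕜)).continuous.continuousAt.comp (continuousAt_superpos fun k => ?_)
  filter_upwards [(hγ k).eventually (by simp)] with y hy
  exact (hy.fderiv_right (m := 0) (by simp)).continuousAt

end Superposition

/-! ### Constant maps -/

section ConstEval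

variable {K E : Type*} [TopologicalSpace K] [CompactSpace K]
  [NormedAddCommGroup E] [NormedSpace ℂ E]

/-- The inclusion of the constant maps, as a continuous linear map. -/
def constMapCLM (K E : Type*) [TopologicalSpace K] [CompactSpace K]
    [NormedAddCommGroup E] [NormedSpace ℂ E] : E →L[ℂ] C(K, E) :=
  LinearMap.mkContinuous
    { toFun := ContinuousMap.const K
      map_add' := fun _ _ => rfl
      map_smul' := fun _ _ => rfl } 1 fun x => by
    rw [one_mul]
    exact (ContinuousMap.norm_le _ (norm_nonneg x)).2 fun _ => le_rfl

@[simp] lemma constMapCLM_apply (x : E) (k : K) : constMapCLM K E x k = x := rfl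

end ConstEval

/-! ### The primitive as an operator on `C([0,1], E)` -/

section Primitive

open unitInterval MeasureTheory

variable {E : Type*} [NormedAddCommGroup E]

/-- Extension of a function on the unit interval by constants. -/
def unitExtend (w : C(I, E)) : ℝ → E := fun s => w (projIcc 0 1 zero_le_one s)

lemma continuous_unitExtend (w : C(I, E)) : Continuous (unitExtend w) :=
  w.continuous.comp continuous_projIcc

lemma unitExtend_of_mem (w : C(I, E)) {s : ℝ} (hs : s ∈ Icc (0 : ℝ) 1) :
    unitExtend w s = w ⟨s, hs⟩ := by
  rw [unitExtend, projIcc_of_mem zero_le_one hs]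

variable [NormedSpace ℂ E]

lemma norm_integral_unitExtend_le (w : C(I, E)) (t : I) :
    ‖∫ s in (0 : ℝ)..t, unitExtend w s‖ ≤ ‖w‖ := by
  have h := intervalIntegral.norm_integral_le_of_norm_le_const (a := (0 : ℝ)) (b := t) (C := ‖w‖)
    (f := unitExtend w) fun s _ => w.norm_coe_le_norm _
  rw [sub_zero, abs_of_nonneg t.2.1] at h
  exact h.trans (mul_le_of_le_one_right (norm_nonneg w) t.2.2)

/-- The primitive vanishing at `0`, as an operator on continuous functions on `[0, 1]`. -/
def primitiveCLM (E : Type*) [NormedAddCommGroup E] [NormedSpace ℂ E] : C(I, E) →L[ℂ] C(I, E) :=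
  LinearMap.mkContinuous
    { toFun := fun w => ⟨fun t => ∫ s in (0 : ℝ)..t, unitExtend w s,
        (intervalIntegral.continuous_primitive
          (fun _ _ => (continuous_unitExtend w).intervalIntegrable _ _) 0).comp
          continuous_subtype_val⟩
      map_add' := fun w w' => by
        ext t
        exact intervalIntegral.integral_add ((continuous_unitExtend w).intervalIntegrable _ _)
          ((continuous_unitExtend w').intervalIntegrable _ _)
      map_smul' := fun c w => by
        ext t
        exact intervalIntegral.integral_smul c _ } 1 fun w => by
    rw [one_mul]
    exact (ContinuousMap.norm_le _ (norm_nonneg w)).2 fun t => norm_integral_unitExtend_le w t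

lemma primitiveCLM_apply (w : C(I, E)) (t : I) :
    primitiveCLM E w t = ∫ s in (0 : ℝ)..t, unitExtend w s := rfl

lemma primitiveCLM_one (w : C(I, E)) {f : ℝ → E} (h : ∀ s : I, w s = f s) :
    primitiveCLM E w 1 = ∫ s in (0 : ℝ)..1, f s := by
  rw [primitiveCLM_apply]
  refine intervalIntegral.integral_congr fun s hs => ?_
  rw [Set.uIcc_of_le (by simp)] at hs
  simp only [Icc.coe_one] at hs
  simp [unitExtend_of_mem w hs, h]

end Primitive

/-! ### Complex `C¹` maps in finite dimension are analytic -/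

section Osgood

open unitInterval

/-- Adds one variable. Cauchy's formula in `z` writes `f (z, y)` as a continuous bilinear pairing of
the kernel, analytic in `z`, with the restriction of `f` to a circle times `{y}`. The latter is
analytic in `y` by `hE`, as a map into `C(I, F)`; this is why `hE` concerns that target. -/
lemma contDiffAt_omega_of_one_prod {E F : Type*} [NormedAddCommGroup E] [NormedSpace ℂ E]
    [NormedAddCommGroup F] [NormedSpace ℂ F] [CompleteSpace F]
    (hE : ∀ (g : E → C(I, F)) (y : E), ContDiffAt ℂ 1 g y → ContDiffAt ℂ ω g y)
    {f : ℂ × E → F} {p : ℂ × E} (hf : ContDiffAt ℂ 1 f p) : ContDiffAt ℂ ω f p := by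
  obtain ⟨a, b⟩ := p
  have hev : ∀ᶠ q in 𝓝 (a, b), ContDiffAt ℂ 1 f q := hf.eventually (by simp)
  obtain ⟨r, hr, hball⟩ := Metric.eventually_nhds_iff.1 hev
  set R := r / 2 with hR
  have hRpos : 0 < R := half_pos hr
  have hfR : ∀ z ∈ closedBall a R, ∀ y ∈ closedBall b R, ContDiffAt ℂ 1 f (z, y) :=
    fun z hz y hy => hball (by
      rw [Prod.dist_eq]
      exact (max_le (mem_closedBall.1 hz) (mem_closedBall.1 hy)).trans_lt (by linarith))
  -- the circle
  let c : C(I, ℂ) := ⟨fun s => circleMap a R (2 * Real.pi * s),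
    (continuous_circleMap a R).comp (by fun_prop)⟩
  have hc : ∀ s, c s ∈ sphere a R := fun s => circleMap_mem_sphere a hRpos.le _
  -- The Cauchy kernel as a `C(I, ℂ)`-valued function of one complex variable, for which
  -- differentiability already gives analyticity.
  let ker : ℂ → C(I, ℂ) := fun z => superpos (fun x : ℂ => x⁻¹) (c - constMapCLM I ℂ z)
  have hcz : ∀ z ∈ ball a R, ∀ s, (c - constMapCLM I ℂ z) s ≠ 0 := fun z hz s => by
    rw [ContinuousMap.sub_apply, constMapCLM_apply, sub_ne_zero]
    rintro rfl
    exact absurd (mem_sphere.1 (hc s)) (mem_ball.1 hz).ne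
  have hker1 : ∀ z ∈ ball a R, DifferentiableAt ℂ ker z := fun z hz => by
    have h1 : ContDiffAt ℂ 1 (superpos (fun x : ℂ => x⁻¹) : C(I, ℂ) → C(I, ℂ))
        (c - constMapCLM I ℂ z) :=
      contDiffAt_superpos fun s => contDiffAt_inv ℂ (hcz z hz s)
    have h2 : DifferentiableAt ℂ (fun z => c - constMapCLM I ℂ z) z :=
      (differentiableAt_const c).sub (constMapCLM I ℂ).differentiableAt
    exact (h1.differentiableAt (by simp)).comp z h2
  have hker : ContDiffAt ℂ ω ker a :=
    (DifferentiableOn.analyticAt (s := ball a R) (fun z hz => (hker1 z hz).differentiableWithinAt)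
      (ball_mem_nhds a hRpos)).contDiffAt
  let ι : E → C(I, ℂ × E) := fun y =>
    (ContinuousLinearMap.inl ℂ ℂ E).compLeftContinuous ℂ I c +
      (ContinuousLinearMap.inr ℂ ℂ E).compLeftContinuous ℂ I (constMapCLM I E y)
  have hι : ∀ y s, ι y s = (c s, y) := fun y s => by simp [ι]
  have hιd : ContDiff ℂ 1 ι :=
    contDiff_const.add (((ContinuousLinearMap.inr ℂ ℂ E).compLeftContinuous ℂ I).contDiff.comp
      (constMapCLM I E).contDiff)
  have hιf : ∀ y ∈ closedBall b R, ∀ s, ContDiffAt ℂ 1 f (ι y s) := fun y hy s => by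
    rw [hι]
    exact hfR _ (sphere_subset_closedBall (hc s)) _ hy
  let g : E → C(I, F) := fun y => superpos f (ι y)
  have hg : ContDiffAt ℂ ω g b := hE g b
    ((contDiffAt_superpos (hιf b (mem_closedBall_self hRpos.le))).comp b hιd.contDiffAt)
  let T : C(I, ℂ) →L[ℂ] C(I, F) →L[ℂ] C(I, F) :=
    (pointwiseCLM (𝕜 := ℂ) (K := I) (G := F) (F := F)).comp
      ((ContinuousLinearMap.lsmul ℂ ℂ : ℂ →L[ℂ] F →L[ℂ] F).compLeftContinuous ℂ I)
  let S : C(I, F) →L[ℂ] F := (ContinuousMap.evalCLM ℂ (1 : I)).comp (primitiveCLM F)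
  let m : C(I, ℂ) := c - ContinuousMap.const I a
  -- With `ζ = c s` one has `dζ = 2πi (ζ - a) ds`. The factor `m = c - a` accounts for `ζ - a`, and
  -- `2πi` cancels the constant in Cauchy's formula.
  have hrep : ∀ z ∈ ball a R, ∀ y ∈ ball b R, f (z, y) = S (T m (T (ker z) (g y))) := by
    intro z hz y hy
    have hd : DifferentiableOn ℂ (fun ζ => f (ζ, y)) (closedBall a R) := fun ζ hζ =>
      (((hfR ζ hζ y (ball_subset_closedBall hy)).differentiableAt (by simp)).comp ζ
        (differentiableAt_id.prodMk (differentiableAt_const y))).differentiableWithinAt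
    have h1 := hd.circleIntegral_sub_inv_smul hz
    have h2 : S (T m (T (ker z) (g y))) = ∫ s in (0 : ℝ)..1,
        (fun θ : ℝ => (circleMap a R θ - a) • ((circleMap a R θ - z)⁻¹ • f (circleMap a R θ, y)))
          (2 * Real.pi * s) := by
      refine primitiveCLM_one _ fun s => ?_
      have e1 : ker z s = (c s - z)⁻¹ :=
        superpos_apply (H := fun x : ℂ => x⁻¹) (fun s => continuousAt_inv₀ (hcz z hz s)) s
      have e2 : g y s = f (c s, y) := by
        rw [← hι y s]
        exact superpos_apply (fun s => (hιf y (ball_subset_closedBall hy) s).continuousAt) s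
      have e3 : (T m (T (ker z) (g y))) s = (c s - a) • (ker z s • g y s) := rfl
      rw [e3, e1, e2]
      rfl
    have h3 := intervalIntegral.smul_integral_comp_mul_left (a := 0) (b := 1)
      (fun θ : ℝ => (circleMap a R θ - a) • ((circleMap a R θ - z)⁻¹ • f (circleMap a R θ, y)))
      (2 * Real.pi)
    rw [← h2] at h3
    have h4 : (∮ ζ in C(a, R), (ζ - z)⁻¹ • f (ζ, y)) = Complex.I • ∫ θ in (0 : ℝ)..2 * Real.pi,
        (circleMap a R θ - a) • ((circleMap a R θ - z)⁻¹ • f (circleMap a R θ, y)) := by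
      rw [circleIntegral, ← intervalIntegral.integral_smul]
      refine intervalIntegral.integral_congr fun θ _ => ?_
      simp only [deriv_circleMap, smul_smul, circleMap_sub_center]
      ring_nf
    rw [mul_zero, mul_one] at h3
    rw [h4, ← h3, RCLike.real_smul_eq_coe_smul (K := ℂ), smul_smul] at h1
    have hne : (2 * Real.pi * Complex.I : ℂ) ≠ 0 := Complex.two_pi_I_ne_zero
    have h5 : (Complex.I * ((2 * Real.pi : ℝ) : ℂ)) = 2 * Real.pi * Complex.I := by
      push_cast; ring
    refine (smul_right_injective F hne ?_).symm
    rw [← h5]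
    rw [← h5] at h1
    exact h1
  have hprod : ball a R ×ˢ ball b R ∈ 𝓝 (a, b) :=
    prod_mem_nhds (ball_mem_nhds a hRpos) (ball_mem_nhds b hRpos)
  have hmain : ContDiffAt ℂ ω (fun q : ℂ × E => S (T m (T (ker q.1) (g q.2)))) (a, b) := by
    have hT : ContDiffAt ℂ ω (fun u => T u) (ker a) :=
      (by fun_prop)
    have hk : ContDiffAt ℂ ω (fun q : ℂ × E => T (ker q.1)) (a, b) :=
      ContDiffAt.comp (a, b) (g := fun u => T u) hT
        (ContDiffAt.comp (a, b) (g := ker) hker contDiffAt_fst)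
    have hg' : ContDiffAt ℂ ω (fun q : ℂ × E => g q.2) (a, b) :=
      ContDiffAt.comp (a, b) (g := g) hg contDiffAt_snd
    exact (S.comp (T m)).contDiff.contDiffAt.comp (a, b) (hk.clm_apply hg')
  refine hmain.congr_of_eventuallyEq ?_
  filter_upwards [hprod] with q hq using hrep q.1 hq.1 q.2 hq.2

lemma contDiffAt_omega_of_one_pi (n : ℕ) {F : Type*} [NormedAddCommGroup F] [NormedSpace ℂ F]
    [CompleteSpace F] (f : (Fin n → ℂ) → F) (x : Fin n → ℂ) (hf : ContDiffAt ℂ 1 f x) :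
    ContDiffAt ℂ ω f x := by
  -- The target varies because the inductive step replaces `F` by `C(I, F)`.
  induction n generalizing F with
  | zero =>
    have h : f = fun _ => f x := funext fun y => by rw [Subsingleton.elim y x]
    rw [h]
    exact contDiffAt_const
  | succ n ih =>
    let e : (ℂ × (Fin n → ℂ)) ≃L[ℂ] (Fin (n + 1) → ℂ) := Fin.consEquivL ℂ fun _ => ℂ
    have h1 : ContDiffAt ℂ 1 (f ∘ e) (e.symm x) := by
      refine ContDiffAt.comp _ ?_ e.contDiff.contDiffAt
      simpa using hf
    have h2 : ContDiffAt ℂ ω (f ∘ e) (e.symm x) :=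
      contDiffAt_omega_of_one_prod (fun g y hg => ih g y hg) h1
    have h3 := h2.comp x e.symm.contDiff.contDiffAt
    simpa [Function.comp_def] using h3

/-- A complex `C¹` function on a finite-dimensional space is analytic. -/
theorem contDiffAt_omega_of_one {E F : Type*} [NormedAddCommGroup E] [NormedSpace ℂ E]
    [FiniteDimensional ℂ E] [NormedAddCommGroup F] [NormedSpace ℂ F] [CompleteSpace F]
    {f : E → F} {x : E} (hf : ContDiffAt ℂ 1 f x) : ContDiffAt ℂ ω f x := by
  let e : (Fin (Module.finrank ℂ E) → ℂ) ≃L[ℂ] E :=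
    ContinuousLinearEquiv.ofFinrankEq (by simp)
  have h1 : ContDiffAt ℂ 1 (f ∘ e) (e.symm x) := by
    refine ContDiffAt.comp _ ?_ e.contDiff.contDiffAt
    simpa using hf
  have h3 := (contDiffAt_omega_of_one_pi _ _ _ h1).comp x e.symm.contDiff.contDiffAt
  simpa [Function.comp_def] using h3

end Osgood

/-! ### The Poincaré lemma for 2-forms -/

section PoincareLemma

open unitInterval

variable {E : Type*} [NormedAddCommGroup E] [NormedSpace ℂ E]

/-- The map sending `γ` to its graph `s ↦ (s, γ s)`. -/
def graphMap (γ : C(I, E)) : C(I, ℂ × E) :=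
  (⟨fun s => (((s : ℝ) : ℂ), 0), by fun_prop⟩ : C(I, ℂ × E)) +
    (ContinuousLinearMap.inr ℂ ℂ E).compLeftContinuous ℂ I γ

@[simp] lemma graphMap_apply (γ : C(I, E)) (s : I) : graphMap γ s = (((s : ℝ) : ℂ), γ s) := by
  simp [graphMap]

lemma hasFDerivAt_graphMap (γ : C(I, E)) :
    HasFDerivAt (graphMap : C(I, E) → C(I, ℂ × E))
      ((ContinuousLinearMap.inr ℂ ℂ E).compLeftContinuous ℂ I) γ :=
  ((ContinuousLinearMap.inr ℂ ℂ E).compLeftContinuous ℂ I).hasFDerivAt.const_add _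

lemma contDiff_graphMap : ContDiff ℂ 1 (graphMap : C(I, E) → C(I, ℂ × E)) :=
  contDiff_const.add ((ContinuousLinearMap.inr ℂ ℂ E).compLeftContinuous ℂ I).contDiff

/-- The Poincaré lemma for 2-forms, near the centre of a ball. -/
lemma exists_primitive_twoForm {C : E → E →L[ℂ] E →L[ℂ] ℂ} (hC : ContDiffAt ℂ 1 C 0)
    (halt : ∀ y u v, C y u v = -C y v u)
    (hclosed : ∀ᶠ y in 𝓝 (0 : E), ∀ u v w,
      fderiv ℂ C y u v w + fderiv ℂ C y v w u + fderiv ℂ C y w u v = 0) (hC0 : C 0 = 0) :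
    ∃ θ : E → E →L[ℂ] ℂ, ContDiffAt ℂ 1 θ 0 ∧ θ 0 = 0 ∧ fderiv ℂ θ 0 = 0 ∧
      ∀ᶠ y in 𝓝 (0 : E), ∀ u w, fderiv ℂ θ y u w - fderiv ℂ θ y w u = C y u w := by
  obtain ⟨r, hr, hball⟩ := Metric.eventually_nhds_iff_ball.1
    ((hC.eventually (by simp)).and hclosed)
  -- Integrand of the radial homotopy `θ_y = ∫₀¹ s C(sy)(y, ·) ds`, as a function of `(s, y)`.
  let H : ℂ × E → E →L[ℂ] ℂ := fun q => q.1 • C (q.1 • q.2) q.2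
  have hmem : ∀ y ∈ ball (0 : E) r, ∀ s : ℝ, s ∈ Icc (0 : ℝ) 1 → (s : ℂ) • y ∈ ball (0 : E) r := by
    intro y hy s hs
    rw [mem_ball_zero_iff] at hy ⊢
    rw [norm_smul, Complex.norm_real, Real.norm_of_nonneg hs.1]
    exact (mul_le_of_le_one_left (norm_nonneg y) hs.2).trans_lt hy
  have hHd : ∀ (τ : ℂ) (y : E), τ • y ∈ ball (0 : E) r → ContDiffAt ℂ 1 H (τ, y) := by
    intro τ y hy
    have h1 : ContDiffAt ℂ 1 (fun q : ℂ × E => C (q.1 • q.2)) (τ, y) :=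
      ContDiffAt.comp (τ, y) (g := C) (hball _ hy).1 (contDiffAt_fst.smul contDiffAt_snd)
    exact contDiffAt_fst.smul (h1.clm_apply contDiffAt_snd)
  have hHf : ∀ (τ : ℂ) (y : E), τ • y ∈ ball (0 : E) r → ∀ u w,
      fderiv ℂ H (τ, y) (0, u) w = τ * (τ * fderiv ℂ C (τ • y) u y w + C (τ • y) u w) := by
    intro τ y hy u w
    have h0 : HasFDerivAt C (fderiv ℂ C (τ • y)) (τ • y) :=
      ((hball _ hy).1.differentiableAt (by simp)).hasFDerivAt
    have h1 : HasFDerivAt (fun y' : E => τ • y') (τ • ContinuousLinearMap.id ℂ E) y :=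
      (hasFDerivAt_id y).const_smul τ
    have h01 : HasFDerivAt (fun y' : E => C (τ • y')) _ y :=
      HasFDerivAt.comp (g := C) (f := fun y' : E => τ • y') y h0 h1
    have h2 := (h01.clm_apply (hasFDerivAt_id y)).const_smul τ
    have h3 : HasFDerivAt (fun y' : E => ((τ, y') : ℂ × E)) (ContinuousLinearMap.inr ℂ ℂ E) y :=
      hasFDerivAt_prodMk_right τ y
    have h4 := ((hHd τ y hy).differentiableAt (by simp)).hasFDerivAt.comp y h3
    have h5 := congrArg (fun L => L u w) (h4.unique h2)
    simp at h5
    rw [h5]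
    ring
  let ι : E → C(I, ℂ × E) := fun y => graphMap (constMapCLM I E y)
  have hιd : ContDiff ℂ 1 ι := contDiff_graphMap.comp (constMapCLM I E).contDiff
  have hιf : ∀ y ∈ ball (0 : E) r, ∀ s, ContDiffAt ℂ 1 H (ι y s) := fun y hy s => by
    simp only [ι, graphMap_apply, constMapCLM_apply]
    exact hHd _ _ (hmem y hy s s.2)
  let S : C(I, E →L[ℂ] ℂ) →L[ℂ] (E →L[ℂ] ℂ) :=
    (ContinuousMap.evalCLM ℂ (1 : I)).comp (primitiveCLM (E →L[ℂ] ℂ))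
  let θ : E → E →L[ℂ] ℂ := fun y => S (superpos H (ι y))
  have h0r : (0 : E) ∈ ball (0 : E) r := mem_ball_self hr
  have hθ : ContDiffAt ℂ 1 θ 0 :=
    ContDiffAt.comp (g := S) 0 (by fun_prop)
      ((contDiffAt_superpos (hιf 0 h0r)).comp 0 hιd.contDiffAt)
  -- Differentiation under the integral sign; `W` is the differentiated integrand.
  have hθf : ∀ y ∈ ball (0 : E) r, ∀ u, ∃ W : C(I, E →L[ℂ] ℂ),
      fderiv ℂ θ y u = (∫ s in (0 : ℝ)..1, unitExtend W s) ∧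
      ∀ s (hs : s ∈ Icc (0 : ℝ) 1) w, unitExtend W s w =
        (s : ℂ) * (s * fderiv ℂ C ((s : ℂ) • y) u y w + C ((s : ℂ) • y) u w) := by
    intro y hy u
    have h1 : HasFDerivAt ι (((ContinuousLinearMap.inr ℂ ℂ E).compLeftContinuous ℂ I).comp
        (constMapCLM I E)) y :=
      HasFDerivAt.comp (g := graphMap) (f := constMapCLM I E) y (hasFDerivAt_graphMap _)
        (constMapCLM I E).hasFDerivAt
    have h2 : HasFDerivAt θ _ y :=
      HasFDerivAt.comp (g := S) y S.hasFDerivAt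
        (HasFDerivAt.comp (g := superpos H) y (hasFDerivAt_superpos (hιf y hy)) h1)
    refine ⟨pointwiseCLM (superpos (fderiv ℂ H) (ι y))
      ((ContinuousLinearMap.inr ℂ ℂ E).compLeftContinuous ℂ I (constMapCLM I E u)), ?_, ?_⟩
    · rw [h2.fderiv]
      rfl
    · intro s hs w
      rw [unitExtend_of_mem _ hs, pointwiseCLM_apply, superpos_apply fun s =>
        ((hιf y hy s).fderiv_right (m := 0) (by simp)).continuousAt]
      simp only [ι, graphMap_apply, constMapCLM_apply]
      exact hHf _ _ (hmem y hy s hs) u w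
  refine ⟨θ, hθ, ?_, ?_, ?_⟩
  · have : (superpos H (ι 0) : C(I, E →L[ℂ] ℂ)) = 0 := by
      ext s : 1
      rw [superpos_apply fun s => (hιf 0 h0r s).continuousAt]
      have h0 : ((s : ℝ) : ℂ) • C (((s : ℝ) : ℂ) • (0 : E)) 0 = 0 := by
        rw [map_zero]
        exact smul_zero (A := E →L[ℂ] ℂ) ((s : ℝ) : ℂ)
      simpa only [ι, H, graphMap_apply, constMapCLM_apply] using! h0
    simp [θ, this]
  -- At `y = 0` the integrand reduces to `s C(0)(u, ·)`, which vanishes since `C 0 = 0`.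
  · ext u : 1
    obtain ⟨W, hW, hW'⟩ := hθf 0 h0r u
    rw [hW, zero_apply]
    have : ∫ s in (0 : ℝ)..1, unitExtend W s = ∫ s in (0 : ℝ)..1, (0 : E →L[ℂ] ℂ) := by
      refine intervalIntegral.integral_congr fun s hs => ?_
      rw [uIcc_of_le zero_le_one] at hs
      ext w
      rw [hW' s hs w]
      simp [hC0]
    simpa using this
  · filter_upwards [ball_mem_nhds (0 : E) hr] with y hy u w
    obtain ⟨W₁, hW₁, hW₁'⟩ := hθf y hy u
    obtain ⟨W₂, hW₂, hW₂'⟩ := hθf y hy w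
    let ev : E → (E →L[ℂ] ℂ) →L[ℂ] ℂ := fun w => ContinuousLinearMap.apply ℂ ℂ w
    have e1 : fderiv ℂ θ y u w = ∫ s in (0 : ℝ)..1, unitExtend W₁ s w := by
      rw [hW₁]
      exact ((ev w).intervalIntegral_comp_comm
        ((continuous_unitExtend W₁).intervalIntegrable _ _)).symm
    have e2 : fderiv ℂ θ y w u = ∫ s in (0 : ℝ)..1, unitExtend W₂ s u := by
      rw [hW₂]
      exact ((ev u).intervalIntegral_comp_comm
        ((continuous_unitExtend W₂).intervalIntegrable _ _)).symm
    have c1 : Continuous fun s => unitExtend W₁ s w :=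
      (ev w).continuous.comp (continuous_unitExtend W₁)
    have c2 : Continuous fun s => unitExtend W₂ s u :=
      (ev u).continuous.comp (continuous_unitExtend W₂)
    rw [e1, e2, ← intervalIntegral.integral_sub (c1.intervalIntegrable _ _)
      (c2.intervalIntegrable _ _)]
    -- Closedness turns the antisymmetrised integrand into `d/ds (s² C(sy)(u, w))`, whose integral
    -- is `C(y)(u, w)`.
    have hder : ∀ s ∈ uIcc (0 : ℝ) 1, HasDerivAt (fun s : ℝ => (s : ℂ) ^ 2 * C ((s : ℂ) • y) u w)
        (unitExtend W₁ s w - unitExtend W₂ s u) s := by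
      intro s hs
      rw [uIcc_of_le zero_le_one] at hs
      have hsy := hmem y hy s hs
      have hCd : HasFDerivAt C (fderiv ℂ C ((s : ℂ) • y)) ((s : ℂ) • y) :=
        ((hball _ hsy).1.differentiableAt (by simp)).hasFDerivAt
      have k1 : HasDerivAt (fun z : ℂ => z • y) y (s : ℂ) := by
        simpa using (hasDerivAt_id (s : ℂ)).smul_const y
      have k2 : HasDerivAt (fun z : ℂ => C (z • y)) (fderiv ℂ C ((s : ℂ) • y) y) (s : ℂ) :=
        HasFDerivAt.comp_hasDerivAt (l := C) (f := fun z : ℂ => z • y) (s : ℂ) hCd k1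
      have k3 : HasDerivAt (fun z : ℂ => C (z • y) u w) (fderiv ℂ C ((s : ℂ) • y) y u w) (s : ℂ) := by
        have := (k2.clm_apply (hasDerivAt_const _ u)).clm_apply (hasDerivAt_const _ w)
        simpa using this
      have k4 := ((hasDerivAt_pow 2 (s : ℂ)).mul k3).comp_ofReal
      refine k4.congr_deriv ?_
      rw [hW₁' s hs w, hW₂' s hs u]
      have hcl := (hball _ hsy).2 u y w
      have ha : ∀ a b c, fderiv ℂ C ((s : ℂ) • y) a b c = -fderiv ℂ C ((s : ℂ) • y) a c b := by
        intro a b c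
        have m1 := (hCd.clm_apply (hasFDerivAt_const b _)).clm_apply (hasFDerivAt_const c _)
        have m2 := (hCd.clm_apply (hasFDerivAt_const c _)).clm_apply (hasFDerivAt_const b _)
        have m3 : (fun y' => C y' b c) = fun y' => -C y' c b := funext fun y' => halt y' b c
        rw [m3] at m1
        simpa using congrArg (fun L => L a) (m1.unique m2.neg)
      rw [halt _ w u]
      have q1 := ha y w u
      have q2 := ha w u y
      push_cast
      linear_combination (s : ℂ) ^ 2 * (-hcl + q1) + (s : ℂ) ^ 2 * q2
    rw [intervalIntegral.integral_eq_sub_of_hasDerivAt hder ((c1.sub c2).intervalIntegrable _ _)]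
    simp

end PoincareLemma

/-! ### The Moser vector field and its flow -/

section Moser

open unitInterval

variable {E : Type*} [NormedAddCommGroup E] [NormedSpace ℂ E]

/-- The flow on the time interval `[0, 1]`, near a common zero at which it has vanishing
derivative, of a time-dependent vector field, together with its variational equation. -/
lemma exists_flow_near_zero [CompleteSpace E] {H : ℂ × E → E}
    (hH : ∀ τ : ℂ, ContDiffAt ℂ 1 H (τ, 0)) (hH0 : ∀ τ : ℂ, H (τ, 0) = 0)
    (hHd : ∀ (τ : ℂ) (u : E), fderiv ℂ H (τ, 0) (0, u) = 0) :
    ∃ Γ : E → C(I, E), ContDiffAt ℂ 1 Γ 0 ∧ Γ 0 = 0 ∧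
      ∀ᶠ x in 𝓝 (0 : E),
        Γ x = constMapCLM I E x + primitiveCLM E (superpos H (graphMap (Γ x))) ∧
        ∀ u, fderiv ℂ Γ x u = constMapCLM I E u + primitiveCLM E
          (pointwiseCLM (superpos (fderiv ℂ H) (graphMap (Γ x)))
            ((ContinuousLinearMap.inr ℂ ℂ E).compLeftContinuous ℂ I (fderiv ℂ Γ x u))) := by
  let J := primitiveCLM E
  let inr := (ContinuousLinearMap.inr ℂ ℂ E).compLeftContinuous ℂ I
  -- The integral equation `γ(t) = x + ∫₀ᵗ H(s, γ(s)) ds` reads `Ψ γ = const x`, so the flow is a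
  -- local inverse of `Ψ` restricted to constants.
  let Ψ : C(I, E) → C(I, E) := fun γ => γ - J (superpos H (graphMap γ))
  let D : C(I, E) → C(I, E) →L[ℂ] C(I, E) := fun γ =>
    ContinuousLinearMap.id ℂ _ -
      J.comp ((pointwiseCLM (superpos (fderiv ℂ H) (graphMap γ))).comp inr)
  have hΨd : ∀ γ : C(I, E), (∀ s, ContDiffAt ℂ 1 H (graphMap γ s)) → HasFDerivAt Ψ (D γ) γ := by
    intro γ hγ
    have h1 : HasFDerivAt (fun γ => J (superpos H (graphMap γ))) _ γ :=
      HasFDerivAt.comp (g := J) γ J.hasFDerivAt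
        (HasFDerivAt.comp (g := superpos H) γ (hasFDerivAt_superpos hγ) (hasFDerivAt_graphMap γ))
    exact (hasFDerivAt_id γ).sub h1
  have h0 : ∀ s, ContDiffAt ℂ 1 H (graphMap (0 : C(I, E)) s) := fun s => by
    rw [graphMap_apply]
    exact hH _
  have hΨc : ContDiffAt ℂ 1 Ψ 0 := by
    have h1 : ContDiffAt ℂ 1 (fun γ => superpos H (graphMap γ) : C(I, E) → C(I, E)) 0 :=
      (contDiffAt_superpos h0).comp 0 contDiff_graphMap.contDiffAt
    have h2 : ContDiffAt ℂ 1 (fun γ => J (superpos H (graphMap γ))) 0 :=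
      ContDiffAt.comp (g := J) 0 (by fun_prop) h1
    exact contDiffAt_id.sub h2
  -- The spatial derivative of `H` vanishes along the zero section. Hence `Ψ` is invertible near `0`
  -- over the whole interval, with no restriction to short time.
  have hD0 : D 0 = ContinuousLinearMap.id ℂ _ := by
    have h1 : (pointwiseCLM (superpos (fderiv ℂ H) (graphMap (0 : C(I, E))))).comp inr =
        (0 : C(I, E) →L[ℂ] C(I, E)) := by
      ext η s
      have h2 : (superpos (fderiv ℂ H) (graphMap (0 : C(I, E))) : C(I, ℂ × E →L[ℂ] E)) s
          = fderiv ℂ H (graphMap (0 : C(I, E)) s) := superpos_apply (fun s =>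
        ((h0 s).fderiv_right (m := 0) (by simp)).continuousAt) s
      have h3 : inr η s = (0, η s) := rfl
      rw [ContinuousLinearMap.comp_apply, pointwiseCLM_apply, h2, h3, graphMap_apply]
      exact hHd _ _
    simp [D, h1]
  have hΨ0 : Ψ 0 = 0 := by
    have h1 : (superpos H (graphMap (0 : C(I, E))) : C(I, E)) = 0 := by
      ext s
      rw [superpos_apply fun s => (h0 s).continuousAt, graphMap_apply]
      exact hH0 _
    simp [Ψ, h1]
  have hd0 : HasFDerivAt Ψ
      ((ContinuousLinearEquiv.refl ℂ C(I, E) : C(I, E) ≃L[ℂ] C(I, E)) : C(I, E) →L[ℂ] C(I, E))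
      0 := by
    have := hΨd 0 h0
    rwa [hD0] at this
  have hone : (1 : WithTop ℕ∞) ≠ 0 := one_ne_zero
  let e := hΨc.toOpenPartialHomeomorph Ψ hd0 hone
  have he0 : e.symm 0 = 0 := by
    have := hΨc.localInverse_apply_image hd0 hone
    rwa [hΨ0] at this
  have hec : ContDiffAt ℂ 1 e.symm 0 := by
    have := hΨc.to_localInverse hd0 hone
    rwa [hΨ0] at this
  let Γ : E → C(I, E) := fun x => e.symm (constMapCLM I E x)
  have hc0 : constMapCLM I E 0 = 0 := map_zero _
  have hΓ : ContDiffAt ℂ 1 Γ 0 := by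
    refine ContDiffAt.comp (g := e.symm) 0 ?_ (constMapCLM I E).contDiff.contDiffAt
    rwa [hc0]
  have hΓ0 : Γ 0 = 0 := by simp only [Γ, hc0, he0]
  have hinv : ∀ᶠ x in 𝓝 (0 : E), Ψ (Γ x) = constMapCLM I E x := by
    have h1 : e.target ∈ 𝓝 (constMapCLM I E 0) := by
      rw [hc0]
      refine e.open_target.mem_nhds ?_
      have := hΨc.image_mem_toOpenPartialHomeomorph_target hd0 hone
      rwa [hΨ0] at this
    filter_upwards [(constMapCLM I E).continuous.continuousAt h1] with x hx
    exact e.right_inv hx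
  have hgood : ∀ᶠ x in 𝓝 (0 : E), ∀ s, ContDiffAt ℂ 1 H (graphMap (Γ x) s) := by
    have h1 : ContinuousAt (fun x => graphMap (Γ x)) 0 :=
      ContinuousAt.comp (g := graphMap (E := E)) (contDiff_graphMap (E := E)).continuous.continuousAt
        hΓ.continuousAt
    refine h1.eventually (eventually_forall_of_forall_eventually_apply _ fun s => ?_)
    simp only [hΓ0]
    exact (h0 s).eventually (by simp)
  refine ⟨Γ, hΓ, hΓ0, ?_⟩
  filter_upwards [hinv.eventually_nhds, hgood, hΓ.eventually (by simp)] with x hx hg hd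
  refine ⟨?_, fun u => ?_⟩
  · rw [← hx.self_of_nhds]
    simp [Ψ, J]
  -- The variational equation is the derivative of `Ψ (Γ x) = const x`.
  · have h1 : HasFDerivAt (fun x => Ψ (Γ x)) _ x :=
      HasFDerivAt.comp (g := Ψ) x (hΨd _ hg) (hd.differentiableAt (by simp)).hasFDerivAt
    have h2 : HasFDerivAt (fun x => Ψ (Γ x)) (constMapCLM I E) x :=
      (constMapCLM I E).hasFDerivAt.congr_of_eventuallyEq hx
    have h3 := congrArg (fun L => L u) (h2.unique h1)
    simp only [ContinuousLinearMap.comp_apply, D, sub_apply,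
      ContinuousLinearMap.id_apply] at h3
    rw [h3]
    simp [J, inr]

/-- The linear homotopy from the constant map `B 0` to `B`. -/
def formHomotopy {G : Type*} [NormedAddCommGroup G] [NormedSpace ℂ G] (B : E → G) (q : ℂ × E) : G :=
  B 0 + q.1 • (B q.2 - B 0)

lemma contDiffAt_formHomotopy {G : Type*} [NormedAddCommGroup G] [NormedSpace ℂ G] {B : E → G}
    {q : ℂ × E} (hB : ContDiffAt ℂ 1 B q.2) : ContDiffAt ℂ 1 (formHomotopy B) q :=
  contDiffAt_const.add (contDiffAt_fst.smul
    ((ContDiffAt.comp (g := B) q hB contDiffAt_snd).sub contDiffAt_const))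

lemma exists_hasFDerivAt_formHomotopy {G : Type*} [NormedAddCommGroup G] [NormedSpace ℂ G]
    {B : E → G} {q : ℂ × E} (hB : DifferentiableAt ℂ B q.2) :
    ∃ M : ℂ × E →L[ℂ] G, HasFDerivAt (formHomotopy B) M q ∧
      ∀ δ, M δ = q.1 • fderiv ℂ B q.2 δ.2 + δ.1 • (B q.2 - B 0) :=
  ⟨_, (hasFDerivAt_fst.smul ((HasFDerivAt.comp (g := B) q hB.hasFDerivAt
    hasFDerivAt_snd).sub_const _)).const_add _, fun δ => by simp⟩

lemma hasFDerivAt_formHomotopy_right {G : Type*} [NormedAddCommGroup G] [NormedSpace ℂ G] {B : E → G}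
    {q : ℂ × E} (hB : DifferentiableAt ℂ B q.2) :
    HasFDerivAt (fun y => formHomotopy B (q.1, y)) (q.1 • fderiv ℂ B q.2) q.2 :=
  ((hB.hasFDerivAt.sub_const _).const_smul q.1).const_add _

/-- The field solves `B_τ(H, ·) = -θ`, where `dθ = B - B 0` and `B_τ = B 0 + τ (B - B 0)`. At the
origin `B_τ` is `B 0` for every `τ`, hence invertible near the whole time axis. As `θ` and its
derivative vanish at `0`, so do `H` and its spatial derivative. The last clause antisymmetrises the
derivative of the defining equation: it is what the Lie derivative computation needs. -/
lemma exists_moser_field [FiniteDimensional ℂ E] {B : E → E →L[ℂ] E →L[ℂ] ℂ}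
    (hB : ContDiffAt ℂ 1 B 0) (halt : ∀ y u v, B y u v = -B y v u)
    (hclosed : ∀ᶠ y in 𝓝 (0 : E), ∀ u v w,
      fderiv ℂ B y u v w + fderiv ℂ B y v w u + fderiv ℂ B y w u v = 0)
    (hnd : ∀ u, (∀ v, B 0 u v = 0) → u = 0) :
    ∃ H : ℂ × E → E, (∀ τ : ℂ, ContDiffAt ℂ 1 H (τ, 0)) ∧ (∀ τ : ℂ, H (τ, 0) = 0) ∧
      (∀ (τ : ℂ) (u : E), fderiv ℂ H (τ, 0) (0, u) = 0) ∧
      ∀ τ : ℂ, ∀ᶠ q in 𝓝 (τ, (0 : E)), ∀ u w,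
        (q.1 * fderiv ℂ B q.2 u (H q) w + formHomotopy B q (fderiv ℂ H q (0, u)) w)
          - (q.1 * fderiv ℂ B q.2 w (H q) u + formHomotopy B q (fderiv ℂ H q (0, w)) u)
          = -(B q.2 u w - B 0 u w) := by
  have hfd : fderiv ℂ (fun y => B y - B 0) = fderiv ℂ B := 
    funext fun y => fderiv_sub_const (𝕜 := ℂ) (F := E →L[ℂ] E →L[ℂ] ℂ) (f := B) (x := y) (B 0)
  obtain ⟨θ, hθ, hθ0, hθd, hdθ⟩ := exists_primitive_twoForm (C := fun y => B y - B 0)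
    (hB.sub contDiffAt_const) (fun y u v => by
      simp only [sub_apply]; rw [halt y u v, halt 0 u v]; ring)
    (by rw [hfd]; exact hclosed) (by ext; simp)
  let e : E ≃L[ℂ] (E →L[ℂ] ℂ) := by
    have hinj : Function.Injective (B 0 : E →ₗ[ℂ] (E →L[ℂ] ℂ)) := by
      rw [injective_iff_map_eq_zero]
      exact fun u hu => hnd u fun v => by
        have := congrArg (fun L : E →L[ℂ] ℂ => L v) hu
        simpa using this
    have hrank : Module.finrank ℂ E = Module.finrank ℂ (E →L[ℂ] ℂ) := by
      rw [← (LinearMap.toContinuousLinearMap : (E →ₗ[ℂ] ℂ) ≃ₗ[ℂ] (E →L[ℂ] ℂ)).finrank_eq]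
      exact Subspace.dual_finrank_eq.symm
    exact (LinearEquiv.ofInjectiveOfFinrankEq _ hinj hrank).toContinuousLinearEquiv
  have he : (e : E →L[ℂ] (E →L[ℂ] ℂ)) = B 0 := by ext; rfl
  have hb0 : ∀ τ : ℂ, formHomotopy B (τ, 0) = e := fun τ => by
    ext
    simp [formHomotopy, he]
  have hbd : ∀ q : ℂ × E, ContDiffAt ℂ 1 B q.2 → ContDiffAt ℂ 1 (formHomotopy B) q := 
    fun q hq => contDiffAt_formHomotopy hq
  let H : ℂ × E → E := fun q => -((formHomotopy B q).inverse (θ q.2))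
  have hinv : ∀ τ : ℂ, ContDiffAt ℂ 1 (fun q => (formHomotopy B q).inverse) (τ, (0 : E)) := by
    intro τ
    refine ContDiffAt.comp (g := ContinuousLinearMap.inverse) (τ, 0) ?_ (hbd (τ, 0) hB)
    rw [hb0]
    exact contDiffAt_map_inverse e
  have hθ2 : ∀ τ : ℂ, ContDiffAt ℂ 1 (fun q : ℂ × E => θ q.2) (τ, 0) := fun τ =>
    ContDiffAt.comp (g := θ) (τ, (0 : E)) hθ contDiffAt_snd
  have hH : ∀ τ : ℂ, ContDiffAt ℂ 1 H (τ, 0) := fun τ => ((hinv τ).clm_apply (hθ2 τ)).neg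
  have hHe : ∀ τ : ℂ, ∀ᶠ q in 𝓝 (τ, (0 : E)), formHomotopy B q (H q) = -θ q.2 := by
    intro τ
    have h1 : ∀ᶠ L in 𝓝 (formHomotopy B (τ, (0 : E))), L ∈ range ((↑) : (E ≃L[ℂ] (E →L[ℂ] ℂ)) → _) := by
      rw [hb0]
      exact e.nhds
    filter_upwards [(hbd (τ, 0) hB).continuousAt.eventually h1] with q hq
    obtain ⟨e', he'⟩ := hq
    simp only [H]
    rw [← he']
    simp
  refine ⟨H, hH, fun τ => by simp [H, hθ0], fun τ u => ?_, fun τ => ?_⟩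
  · have h1 : HasFDerivAt (𝕜 := ℂ) (fun q : ℂ × E => θ q.2) (0 : ℂ × E →L[ℂ] E →L[ℂ] ℂ) (τ, 0) := by
      have h2 : HasFDerivAt (𝕜 := ℂ) θ 0 (0 : E) := by
        rw [← hθd]
        exact (hθ.differentiableAt (by simp)).hasFDerivAt
      have h3 : HasFDerivAt (fun q : ℂ × E => θ q.2) _ (τ, (0 : E)) :=
        HasFDerivAt.comp (g := θ) (τ, (0 : E)) h2 hasFDerivAt_snd
      simpa using h3
    have h4 := ((((hinv τ).differentiableAt (by simp)).hasFDerivAt).clm_apply h1).neg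
    have h5 : HasFDerivAt H _ (τ, 0) := h4
    rw [h5.fderiv]
    simp [hθ0]
  · have hBs : ∀ᶠ q in 𝓝 (τ, (0 : E)), ContDiffAt ℂ 1 B q.2 :=
      continuousAt_snd.eventually (hB.eventually (by simp))
    have hθs : ∀ᶠ q in 𝓝 (τ, (0 : E)), ContDiffAt ℂ 1 θ q.2 :=
      continuousAt_snd.eventually (hθ.eventually (by simp))
    have hdθs : ∀ᶠ q in 𝓝 (τ, (0 : E)), ∀ u w,
        fderiv ℂ θ q.2 u w - fderiv ℂ θ q.2 w u = (B q.2 - B 0) u w :=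
      Tendsto.eventually (continuousAt_snd : ContinuousAt _ (τ, (0 : E))) hdθ
    filter_upwards [hBs, hθs, hdθs, (hHe τ).eventually_nhds, (hH τ).eventually (by simp)]
      with q hBq hθq hdq hHq hHc u w
    -- The equation `B_τ(H) = -θ` differentiated in the direction `u` with `τ` fixed.
    have key : ∀ u w, q.1 * fderiv ℂ B q.2 u (H q) w + formHomotopy B q (fderiv ℂ H q (0, u)) w
        = -fderiv ℂ θ q.2 u w := by
      intro u w
      have k0 : HasFDerivAt (fun y : E => ((q.1, y) : ℂ × E)) (ContinuousLinearMap.inr ℂ ℂ E) q.2 :=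
        hasFDerivAt_prodMk_right q.1 q.2
      have k1 : HasFDerivAt (fun y => H (q.1, y)) _ q.2 :=
        HasFDerivAt.comp (g := H) q.2 (hHc.differentiableAt (by simp)).hasFDerivAt k0
      have k2 :=
        hasFDerivAt_formHomotopy_right (hBq.differentiableAt (by simp))
      have k3 := k2.clm_apply k1
      have k4 : HasFDerivAt (fun y => -θ y) (-fderiv ℂ θ q.2) q.2 :=
        (hθq.differentiableAt (by simp)).hasFDerivAt.neg
      have k5 : (fun y => formHomotopy B (q.1, y) (H (q.1, y))) =ᶠ[𝓝 q.2] fun y => -θ y := by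
        have hc : ContinuousAt (fun y : E => ((q.1, y) : ℂ × E)) q.2 := by fun_prop
        exact hc.eventually hHq
      have k6 := congrArg (fun L => L u w) ((k4.congr_of_eventuallyEq k5).unique k3)
      simp only [neg_apply, add_apply, smul_apply, smul_eq_mul, ContinuousLinearMap.comp_apply,
        ContinuousLinearMap.flip_apply, ContinuousLinearMap.inr_apply] at k6
      rw [k6]
      ring
    rw [key u w, key w u]
    have := hdq u w
    simp only [sub_apply] at this
    linear_combination -this

end Moser

/-! ### Darboux's theorem at the origin of a vector space -/

section Darboux

open unitInterval

variable {E : Type*} [NormedAddCommGroup E] [NormedSpace ℂ E]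

lemma formHomotopy_antisymm {B : E → E →L[ℂ] E →L[ℂ] ℂ} (halt : ∀ y u v, B y u v = -B y v u)
    (q : ℂ × E) (u v : E) : formHomotopy B q u v = -formHomotopy B q v u := by
  simp only [formHomotopy, add_apply, smul_apply, sub_apply, smul_eq_mul]
  rw [halt 0 u v, halt q.2 u v]
  ring

lemma fderiv_form_antisymm {B : E → E →L[ℂ] E →L[ℂ] ℂ} (halt : ∀ y u v, B y u v = -B y v u)
    {y : E} (hB : DifferentiableAt ℂ B y) (a u v : E) :
    fderiv ℂ B y a u v = -fderiv ℂ B y a v u := by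
  have m1 := (hB.hasFDerivAt.clm_apply (hasFDerivAt_const u _)).clm_apply (hasFDerivAt_const v _)
  have m2 := (hB.hasFDerivAt.clm_apply (hasFDerivAt_const v _)).clm_apply (hasFDerivAt_const u _)
  have m3 : (fun y' => B y' u v) = fun y' => -B y' v u := funext fun y' => halt y' u v
  rw [m3] at m1
  simpa using congrArg (fun L => L a) (m1.unique m2.neg)

lemma exists_hasFDerivAt_clm_apply {P F₁ F₂ : Type*} [NormedAddCommGroup P] [NormedSpace ℂ P]
    [NormedAddCommGroup F₁] [NormedSpace ℂ F₁] [NormedAddCommGroup F₂] [NormedSpace ℂ F₂]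
    {L : P → F₁ →L[ℂ] F₂} {L' : P →L[ℂ] F₁ →L[ℂ] F₂} {p : P × F₁} (hL : HasFDerivAt L L' p.1) :
    ∃ M : P × F₁ →L[ℂ] F₂, HasFDerivAt (fun p : P × F₁ => L p.1 p.2) M p ∧
      ∀ δ, M δ = L' δ.1 p.2 + L p.1 δ.2 := by
  refine ⟨_, (HasFDerivAt.comp (g := L) p hL hasFDerivAt_fst).clm_apply hasFDerivAt_snd, ?_⟩
  intro δ
  simp [add_comm]

lemma hasDerivAt_formHomotopy_curve {B : E → E →L[ℂ] E →L[ℂ] ℂ} {c a b : ℝ → E} {c' a' b' : E}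
    {t : ℝ} (hB : DifferentiableAt ℂ B (c t)) (hc : HasDerivAt c c' t) (ha : HasDerivAt a a' t)
    (hb : HasDerivAt b b' t) :
    HasDerivAt (fun t : ℝ => formHomotopy B ((t : ℂ), c t) (a t) (b t))
      ((B (c t) - B 0) (a t) (b t) + t * fderiv ℂ B (c t) c' (a t) (b t)
        + formHomotopy B ((t : ℂ), c t) a' (b t) + formHomotopy B ((t : ℂ), c t) (a t) b') t := by
  obtain ⟨K, hK, hK'⟩ := exists_hasFDerivAt_formHomotopy (B := B) (q := ((t : ℂ), c t)) hB
  obtain ⟨M, hM, hM'⟩ := exists_hasFDerivAt_clm_apply (L := formHomotopy B)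
    (p := (((t : ℂ), c t), a t)) hK
  obtain ⟨N, hN, hN'⟩ := exists_hasFDerivAt_clm_apply (p := ((((t : ℂ), c t), a t), b t)) hM
  have h2 := HasFDerivAt.comp_hasDerivAt t (hN.restrictScalars ℝ)
    ((((Complex.ofRealCLM.hasDerivAt (x := t)).prodMk hc).prodMk ha).prodMk hb)
  refine h2.congr_deriv ?_
  rw [ContinuousLinearMap.coe_restrictScalars', hN', hM', hK']
  simp only [add_apply, smul_apply, smul_eq_mul, Complex.ofRealCLM_apply, Complex.ofReal_one,
    one_mul]
  ring

/-- The curve with initial value `x` and velocity `w`. -/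
def unitCurve (x : E) (w : C(I, E)) (t : ℝ) : E := x + ∫ s in (0 : ℝ)..t, unitExtend w s

lemma hasDerivAt_unitCurve [CompleteSpace E] (x : E) (w : C(I, E)) {t : ℝ}
    (ht : t ∈ Icc (0 : ℝ) 1) : HasDerivAt (unitCurve x w) (w ⟨t, ht⟩) t := by
  have h := intervalIntegral.integral_hasDerivAt_right
    ((continuous_unitExtend w).intervalIntegrable 0 t)
    ((continuous_unitExtend w).stronglyMeasurableAtFilter _ _)
    (continuous_unitExtend w).continuousAt
  rw [unitExtend_of_mem w ht] at h
  exact h.const_add x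

lemma unitCurve_eq {x : E} {w γ : C(I, E)} (h : γ = constMapCLM I E x + primitiveCLM E w) {t : ℝ}
    (ht : t ∈ Icc (0 : ℝ) 1) : unitCurve x w t = γ ⟨t, ht⟩ := by
  rw [h]
  rfl

/-- **Darboux's theorem** for holomorphic symplectic forms. -/
theorem exists_darboux [FiniteDimensional ℂ E] {B : E → E →L[ℂ] E →L[ℂ] ℂ}
    (hB : ContDiffAt ℂ 1 B 0) (halt : ∀ y u v, B y u v = -B y v u)
    (hclosed : ∀ᶠ y in 𝓝 (0 : E), ∀ u v w,
      fderiv ℂ B y u v w + fderiv ℂ B y v w u + fderiv ℂ B y w u v = 0)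
    (hnd : ∀ u, (∀ v, B 0 u v = 0) → u = 0) :
    ∃ φ : E → E, ContDiffAt ℂ ω φ 0 ∧ φ 0 = 0 ∧
      ∀ᶠ x in 𝓝 (0 : E), ∀ u v, B (φ x) (fderiv ℂ φ x u) (fderiv ℂ φ x v) = B 0 u v := by
  have : CompleteSpace E := FiniteDimensional.complete ℂ E
  obtain ⟨H, hH, hH0, hHd, hHM⟩ := exists_moser_field hB halt hclosed hnd
  obtain ⟨Γ, hΓ, hΓ0, hΓe⟩ := exists_flow_near_zero hH hH0 hHd
  let φ : E → E := fun x => Γ x 1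
  let ev : C(I, E) →L[ℂ] E := ContinuousMap.evalCLM ℂ (1 : I)
  -- The time-one flow is complex `C¹` in the initial point, hence analytic.
  refine ⟨φ, contDiffAt_omega_of_one (ContDiffAt.comp (g := ev) 0 ev.contDiff.contDiffAt hΓ),
    by simp [φ, hΓ0], ?_⟩
  have hgood : ∀ᶠ x in 𝓝 (0 : E), ∀ s, ContDiffAt ℂ 1 H (graphMap (Γ x) s) ∧
      DifferentiableAt ℂ B (graphMap (Γ x) s).2 ∧
      (∀ u v w, fderiv ℂ B (graphMap (Γ x) s).2 u v w + fderiv ℂ B (graphMap (Γ x) s).2 v w u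
        + fderiv ℂ B (graphMap (Γ x) s).2 w u v = 0) ∧
      ∀ u w, ((graphMap (Γ x) s).1 * fderiv ℂ B (graphMap (Γ x) s).2 u (H (graphMap (Γ x) s)) w
          + formHomotopy B (graphMap (Γ x) s) (fderiv ℂ H (graphMap (Γ x) s) (0, u)) w)
          - ((graphMap (Γ x) s).1 * fderiv ℂ B (graphMap (Γ x) s).2 w (H (graphMap (Γ x) s)) u
          + formHomotopy B (graphMap (Γ x) s) (fderiv ℂ H (graphMap (Γ x) s) (0, w)) u)
          = -(B (graphMap (Γ x) s).2 u w - B 0 u w) := by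
    have h1 : ContinuousAt (fun x => graphMap (Γ x)) 0 :=
      ContinuousAt.comp (g := graphMap (E := E)) (contDiff_graphMap (E := E)).continuous.continuousAt
        hΓ.continuousAt
    refine h1.eventually (eventually_forall_of_forall_eventually_apply _
      (P := fun q => ContDiffAt ℂ 1 H q ∧ DifferentiableAt ℂ B q.2 ∧
        (∀ u v w, fderiv ℂ B q.2 u v w + fderiv ℂ B q.2 v w u + fderiv ℂ B q.2 w u v = 0) ∧
        ∀ u w, (q.1 * fderiv ℂ B q.2 u (H q) w + formHomotopy B q (fderiv ℂ H q (0, u)) w)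
          - (q.1 * fderiv ℂ B q.2 w (H q) u + formHomotopy B q (fderiv ℂ H q (0, w)) u)
          = -(B q.2 u w - B 0 u w)) fun s => ?_)
    simp only [hΓ0, graphMap_apply]
    have hs : ContinuousAt (Prod.snd : ℂ × E → E) (((s : ℝ) : ℂ), (0 : E)) := continuousAt_snd
    filter_upwards [(hH _).eventually (by simp), hs.eventually (hB.eventually (by simp)),
      hs.eventually hclosed, hHM _] with q q1 q2 q3 q4
    exact ⟨q1, q2.differentiableAt (by simp), q3, q4⟩
  filter_upwards [hΓe, hgood, hΓ.eventually (by simp)] with x hx hg hd u v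
  obtain ⟨hx1, hx2⟩ := hx
  have hφ : ∀ u, fderiv ℂ φ x u = fderiv ℂ Γ x u 1 := fun u => by
    have h1 : HasFDerivAt φ _ x :=
      HasFDerivAt.comp (g := ev) x ev.hasFDerivAt (hd.differentiableAt (by simp)).hasFDerivAt
    rw [h1.fderiv]
    rfl
  have hw : ∀ s, (superpos H (graphMap (Γ x)) : C(I, E)) s = H (graphMap (Γ x) s) :=
    superpos_apply fun s => (hg s).1.continuousAt
  have hw' : ∀ s, (superpos (fderiv ℂ H) (graphMap (Γ x)) : C(I, ℂ × E →L[ℂ] E)) s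
      = fderiv ℂ H (graphMap (Γ x) s) :=
    superpos_apply fun s => ((hg s).1.fderiv_right (m := 0) (by simp)).continuousAt
  let W : E → C(I, E) := fun u => pointwiseCLM (superpos (fderiv ℂ H) (graphMap (Γ x)))
    ((ContinuousLinearMap.inr ℂ ℂ E).compLeftContinuous ℂ I (fderiv ℂ Γ x u))
  have hW : ∀ u s, W u s = fderiv ℂ H (graphMap (Γ x) s) (0, fderiv ℂ Γ x u s) := fun u s => by
    have h3 : (ContinuousLinearMap.inr ℂ ℂ E).compLeftContinuous ℂ I (fderiv ℂ Γ x u) s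
      = (0, fderiv ℂ Γ x u s) := rfl
    simp only [W, pointwiseCLM_apply, hw', h3]
  let c := unitCurve x (superpos H (graphMap (Γ x)))
  let a := unitCurve u (W u)
  let b := unitCurve v (W v)
  -- The pullback of `B_t` by the flow at time `t`, evaluated on `(u, v)`. It equals `B 0 u v` at `t
  -- = 0` and the wanted expression at `t = 1`, so it suffices that it is constant.
  let f : ℝ → ℂ := fun t => formHomotopy B ((t : ℂ), c t) (a t) (b t)
  have hder : ∀ t ∈ Icc (0 : ℝ) 1, HasDerivAt f 0 t := by
    intro t ht
    have hct : c t = Γ x ⟨t, ht⟩ := unitCurve_eq hx1 ht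
    have hat : a t = fderiv ℂ Γ x u ⟨t, ht⟩ := unitCurve_eq (hx2 u) ht
    have hbt : b t = fderiv ℂ Γ x v ⟨t, ht⟩ := unitCurve_eq (hx2 v) ht
    obtain ⟨-, g2, g3, g4⟩ := hg ⟨t, ht⟩
    simp only [graphMap_apply] at g2 g3 g4
    rw [← hct] at g2 g3 g4
    have key := hasDerivAt_formHomotopy_curve g2
      (hasDerivAt_unitCurve x (superpos H (graphMap (Γ x))) ht)
      (hasDerivAt_unitCurve u (W u) ht) (hasDerivAt_unitCurve v (W v) ht)
    refine key.congr_deriv ?_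
    rw [hw, hW, hW, graphMap_apply]
    change (B (c t) - B 0) (a t) (b t) + t * fderiv ℂ B (c t) _ (a t) (b t)
      + formHomotopy B (t, c t) _ (b t) + formHomotopy B (t, c t) (a t) _ = 0
    simp only
    rw [← hct, ← hat, ← hbt, formHomotopy_antisymm halt _ (a t)]
    -- The Moser identity cancels `B - B 0`. Closedness rewrites the derivative of `B` along the
    -- flow through the two derivative terms of that identity.
    have k1 := g4 (a t) (b t)
    have k2 := g3 (H (t, c t)) (a t) (b t)
    have k3 := fderiv_form_antisymm halt g2 (a t) (H (t, c t)) (b t)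
    simp only [sub_apply]
    linear_combination k1 + (t : ℂ) * k2 - (t : ℂ) * k3
  have hconst := constant_of_has_deriv_right_zero (f := f) (a := 0) (b := 1)
    (fun t ht => (hder t ht).continuousAt.continuousWithinAt)
    (fun t ht => (hder t ⟨ht.1, ht.2.le⟩).hasDerivWithinAt) 1 ⟨zero_le_one, le_rfl⟩
  have h1mem : (1 : ℝ) ∈ Icc (0 : ℝ) 1 := ⟨zero_le_one, le_rfl⟩
  have hc1 : c 1 = Γ x ⟨1, h1mem⟩ := unitCurve_eq hx1 h1mem
  have ha1 : a 1 = fderiv ℂ Γ x u ⟨1, h1mem⟩ := unitCurve_eq (hx2 u) h1mem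
  have hb1 : b 1 = fderiv ℂ Γ x v ⟨1, h1mem⟩ := unitCurve_eq (hx2 v) h1mem
  have ha0 : a 0 = u := by simp [a, unitCurve]
  have hb0 : b 0 = v := by simp [b, unitCurve]
  simp only [f, formHomotopy, ha0, hb0, hc1, ha1, hb1] at hconst
  rw [hφ, hφ]
  simpa using hconst

end Darboux

/-! ### Lagrangian complements -/

section SymplecticLinearAlgebra

open Module

variable {𝕜 V : Type*} [Field 𝕜] [AddCommGroup V] [Module 𝕜 V]

/-- A subspace on which `η` vanishes, of half dimension, and transverse to two given subspaces. -/
structure IsTransverseLagrangian (η : LinearMap.BilinForm 𝕜 V) (K₁ K₂ L : Submodule 𝕜 V) : Prop where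
  isotropic : ∀ u ∈ L, ∀ v ∈ L, η u v = 0
  disjoint₁ : Disjoint L K₁
  disjoint₂ : Disjoint L K₂
  finrank_eq : 2 * finrank 𝕜 L = finrank 𝕜 V

variable [FiniteDimensional 𝕜 V]

/-- An isotropic subspace of half dimension equals its orthogonal, by counting dimensions. -/
lemma mem_of_isotropic_of_finrank {η : LinearMap.BilinForm 𝕜 V}
    (hnd : η.Nondegenerate) {L : Submodule 𝕜 V} (hL : ∀ u ∈ L, ∀ v ∈ L, η u v = 0)
    (hdim : 2 * finrank 𝕜 L = finrank 𝕜 V) {v : V} (hv : ∀ u ∈ L, η u v = 0) : v ∈ L := by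
  have hle : L ≤ η.orthogonal L := fun v hv u hu => hL u hu v hv
  have heq : L = η.orthogonal L := Submodule.eq_of_le_of_finrank_eq hle (by
    rw [LinearMap.BilinForm.finrank_orthogonal hnd]
    omega)
  rw [heq]
  exact fun u hu => hv u hu

/-- Suppose `N^⊥ ⊆ N + K₁`. By dimension there is `w ≠ 0` in `N^⊥ ∩ K₂`. It is orthogonal to `N` and
to `K₁`, hence to `N^⊥`, so `w ∈ N^⊥⊥ = N`, contradicting `N ∩ K₂ = 0`. -/
lemma exists_mem_orthogonal_notMem_sup {η : LinearMap.BilinForm 𝕜 V} (halt : η.IsAlt)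
    (hnd : η.Nondegenerate) {K₁ K₂ N : Submodule 𝕜 V} (hK : ∀ u ∈ K₁, ∀ v ∈ K₂, η u v = 0)
    (h2 : 2 * finrank 𝕜 K₂ = finrank 𝕜 V) (hN : Disjoint N K₂)
    (hlt : 2 * finrank 𝕜 N < finrank 𝕜 V) : ∃ u ∈ η.orthogonal N, u ∉ N ⊔ K₁ := by
  by_contra! hcon
  have hN2 : finrank 𝕜 (η.orthogonal N) = finrank 𝕜 V - finrank 𝕜 N :=
    LinearMap.BilinForm.finrank_orthogonal hnd N
  have hsum := Submodule.finrank_sup_add_finrank_inf_eq (η.orthogonal N) K₂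
  have hle := Submodule.finrank_le (η.orthogonal N ⊔ K₂)
  have hpos : 0 < finrank 𝕜 (η.orthogonal N ⊓ K₂ : Submodule 𝕜 V) := by omega
  obtain ⟨⟨w, hw⟩, hw0⟩ := Module.finrank_pos_iff_exists_ne_zero.1 hpos
  have hw0' : w ≠ 0 := fun h => hw0 (by ext; exact h)
  have hwN : w ∈ N := by
    rw [← LinearMap.BilinForm.orthogonal_orthogonal hnd halt.isRefl N]
    intro u hu
    obtain ⟨a, ha, b, hb, rfl⟩ := Submodule.mem_sup.1 (hcon u hu)
    have e1 : η a w = 0 := hw.1 a ha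
    have e2 : η b w = 0 := hK b hb w hw.2
    simp [e1, e2]
  exact hw0' (Submodule.disjoint_def.1 hN w hwN hw.2)

lemma finrank_sup_span_of_notMem {N : Submodule 𝕜 V} {u : V} (hu : u ∉ N) :
    finrank 𝕜 (N ⊔ Submodule.span 𝕜 {u} : Submodule 𝕜 V) = finrank 𝕜 N + 1 := by
  have h0 : u ≠ 0 := fun h => hu (h ▸ N.zero_mem)
  have hdisj : N ⊓ Submodule.span 𝕜 {u} = ⊥ :=
    (Submodule.disjoint_span_singleton' h0).2 hu |>.eq_bot
  have h := Submodule.finrank_sup_add_finrank_inf_eq N (Submodule.span 𝕜 {u})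
  rw [hdisj, finrank_bot, finrank_span_singleton h0] at h
  exact h

lemma disjoint_sup_span_of_notMem {𝕜 V : Type*} [Field 𝕜] [AddCommGroup V] [Module 𝕜 V]
    {N K : Submodule 𝕜 V} {u : V} (hN : Disjoint N K)
    (hu : u ∉ N ⊔ K) : Disjoint (N ⊔ Submodule.span 𝕜 {u}) K := by
  rw [Submodule.disjoint_def]
  intro x hx hxK
  obtain ⟨a, ha, b, hb, rfl⟩ := Submodule.mem_sup.1 hx
  obtain ⟨c, rfl⟩ := Submodule.mem_span_singleton.1 hb
  by_cases hc : c = 0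
  · subst hc
    rw [zero_smul, add_zero] at hxK ⊢
    exact Submodule.disjoint_def.1 hN a ha hxK
  · refine absurd ?_ hu
    have h1 : c • u ∈ N ⊔ K := by
      have : c • u = -a + (a + c • u) := by abel
      rw [this]
      exact Submodule.add_mem_sup (N.neg_mem ha) hxK
    exact (Submodule.smul_mem_iff _ hc).1 h1

/-- Two half-dimensional subspaces orthogonal to each other have a common Lagrangian complement. -/
theorem exists_isTransverseLagrangian {η : LinearMap.BilinForm 𝕜 V} (halt : η.IsAlt)
    (hnd : η.Nondegenerate) {K₁ K₂ : Submodule 𝕜 V} (hK : ∀ u ∈ K₁, ∀ v ∈ K₂, η u v = 0)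
    (h1 : 2 * finrank 𝕜 K₁ = finrank 𝕜 V) (h2 : 2 * finrank 𝕜 K₂ = finrank 𝕜 V) :
    ∃ N, IsTransverseLagrangian η K₁ K₂ N := by
  have hswap : ∀ u v, η u v = 0 → η v u = 0 := fun u v h => halt.isRefl u v h
  have key : ∀ k ≤ finrank 𝕜 K₁, ∃ N : Submodule 𝕜 V, (∀ u ∈ N, ∀ v ∈ N, η u v = 0) ∧
      Disjoint N K₁ ∧ Disjoint N K₂ ∧ finrank 𝕜 N = k := by
    intro k
    induction k with
    | zero =>
      exact fun _ => ⟨⊥, by simp, disjoint_bot_left, disjoint_bot_left, finrank_bot 𝕜 V⟩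
    | succ k ih =>
      intro hk
      obtain ⟨N, hN, hN1, hN2, hNk⟩ := ih (by omega)
      obtain ⟨a, ha, ha1⟩ := exists_mem_orthogonal_notMem_sup halt hnd hK h2 hN2 (by omega)
      obtain ⟨b, hb, hb2⟩ := exists_mem_orthogonal_notMem_sup (K₁ := K₂) (K₂ := K₁) halt hnd
        (fun u hu v hv => hswap _ _ (hK v hv u hu)) h1 hN1 (by omega)
      -- `N^⊥` is not a union of two proper subspaces: one of `a`, `b`, `a + b` avoids both. Adding
      -- it to `N` preserves isotropy and both disjointness conditions.
      obtain ⟨u, hu, hu1, hu2⟩ : ∃ u ∈ η.orthogonal N, u ∉ N ⊔ K₁ ∧ u ∉ N ⊔ K₂ := by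
        by_cases h : a ∈ N ⊔ K₂
        · by_cases h' : b ∈ N ⊔ K₁
          · exact ⟨a + b, Submodule.add_mem _ ha hb,
              fun h3 => ha1 ((Submodule.add_mem_iff_left _ h').1 h3),
              fun h3 => hb2 ((Submodule.add_mem_iff_right _ h).1 h3)⟩
          · exact ⟨b, hb, h', hb2⟩
        · exact ⟨a, ha, ha1, h⟩
      have huN : u ∉ N := fun h => hu1 (Submodule.mem_sup_left h)
      have hNu : ∀ x ∈ N, η x u = 0 := fun x hx => hu x hx
      refine ⟨N ⊔ Submodule.span 𝕜 {u}, ?_, disjoint_sup_span_of_notMem hN1 hu1,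
        disjoint_sup_span_of_notMem hN2 hu2, by rw [finrank_sup_span_of_notMem huN, hNk]⟩
      intro x hx y hy
      obtain ⟨x1, hx1, x2, hx2, rfl⟩ := Submodule.mem_sup.1 hx
      obtain ⟨c, rfl⟩ := Submodule.mem_span_singleton.1 hx2
      obtain ⟨y1, hy1, y2, hy2, rfl⟩ := Submodule.mem_sup.1 hy
      obtain ⟨d, rfl⟩ := Submodule.mem_span_singleton.1 hy2
      simp [hN x1 hx1 y1 hy1, hNu x1 hx1, hswap _ _ (hNu y1 hy1), halt.self_eq_zero u]
  obtain ⟨N, hN, hN1, hN2, hNk⟩ := key _ le_rfl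
  exact ⟨N, hN, hN1, hN2, by omega⟩

end SymplecticLinearAlgebra

/-! ### Joining Lagrangians by symplectic transvections -/

section Transvections

open Module

variable {V : Type*} [NormedAddCommGroup V] [NormedSpace ℝ V]

/-- A smooth path of symplectic automorphisms, starting at the identity, which preserve two given
subspaces. -/
structure IsSymplecticPath (η : LinearMap.BilinForm ℝ V) (K₁ K₂ : Submodule ℝ V)
    (g : ℝ → V →L[ℝ] V) : Prop where
  contDiff : ContDiff ℝ ∞ g
  zero : g 0 = ContinuousLinearMap.id ℝ V
  symplectic : ∀ t x y, η (g t x) (g t y) = η x y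
  mem₁ : ∀ t x, g t x ∈ K₁ ↔ x ∈ K₁
  mem₂ : ∀ t x, g t x ∈ K₂ ↔ x ∈ K₂

variable {η : LinearMap.BilinForm ℝ V} {K₁ K₂ : Submodule ℝ V}

lemma IsSymplecticPath.id : IsSymplecticPath η K₁ K₂ fun _ => ContinuousLinearMap.id ℝ V :=
  ⟨contDiff_const, rfl, fun _ _ _ => rfl, fun _ _ => Iff.rfl, fun _ _ => Iff.rfl⟩

lemma IsSymplecticPath.comp {g h : ℝ → V →L[ℝ] V} (hg : IsSymplecticPath η K₁ K₂ g)
    (hh : IsSymplecticPath η K₁ K₂ h) : IsSymplecticPath η K₁ K₂ fun t => (g t).comp (h t) where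
  contDiff := hg.contDiff.clm_comp hh.contDiff
  zero := by rw [hg.zero, hh.zero]; rfl
  symplectic t x y := (hg.symplectic t _ _).trans (hh.symplectic t x y)
  mem₁ t x := (hg.mem₁ t _).trans (hh.mem₁ t x)
  mem₂ t x := (hg.mem₂ t _).trans (hh.mem₂ t x)

lemma IsSymplecticPath.injective {g : ℝ → V →L[ℝ] V} (hg : IsSymplecticPath η K₁ K₂ g)
    (hnd : η.Nondegenerate) (t : ℝ) : Function.Injective (g t) := by
  rw [injective_iff_map_eq_zero]
  intro x hx
  refine hnd.1 x fun y => ?_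
  rw [← hg.symplectic t, hx, map_zero, LinearMap.zero_apply]

lemma IsSymplecticPath.map {g : ℝ → V →L[ℝ] V} (hg : IsSymplecticPath η K₁ K₂ g)
    (hnd : η.Nondegenerate) (t : ℝ) {L : Submodule ℝ V} (hL : IsTransverseLagrangian η K₁ K₂ L) :
    IsTransverseLagrangian η K₁ K₂ (L.map (g t : V →ₗ[ℝ] V)) where
  isotropic := by
    rintro _ ⟨x, hx, rfl⟩ _ ⟨y, hy, rfl⟩
    exact (hg.symplectic t x y).trans (hL.isotropic x hx y hy)
  disjoint₁ := by
    rw [Submodule.disjoint_def]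
    rintro _ ⟨x, hx, rfl⟩ hK
    rw [Submodule.disjoint_def.1 hL.disjoint₁ x hx ((hg.mem₁ t x).1 hK), map_zero]
  disjoint₂ := by
    rw [Submodule.disjoint_def]
    rintro _ ⟨x, hx, rfl⟩ hK
    rw [Submodule.disjoint_def.1 hL.disjoint₂ x hx ((hg.mem₂ t x).1 hK), map_zero]
  finrank_eq := by
    rw [← (Submodule.equivMapOfInjective (g t : V →ₗ[ℝ] V) (hg.injective hnd t) L).finrank_eq]
    exact hL.finrank_eq

variable [FiniteDimensional ℝ V]

/-- The symplectic transvection `x ↦ x + c η(v, x) v`. -/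
def symplecticTransvection (η : LinearMap.BilinForm ℝ V) (v : V) (c : ℝ) : V →L[ℝ] V :=
  ContinuousLinearMap.id ℝ V + c • (LinearMap.toContinuousLinearMap (η v)).smulRight v

lemma symplecticTransvection_apply (v : V) (c : ℝ) (x : V) :
    symplecticTransvection η v c x = x + (c * η v x) • v := by
  simp [symplecticTransvection, smul_smul]

/-- A vector `v ∈ K₁` is orthogonal to `K₂`, so `K₂` is fixed pointwise; every point moves by a
multiple of `v`, so `K₁` is preserved. -/
lemma isSymplecticPath_transvection (halt : η.IsAlt) (hK : ∀ u ∈ K₁, ∀ v ∈ K₂, η u v = 0) {v : V}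
    (hv : v ∈ K₁) (c : ℝ) :
    IsSymplecticPath η K₁ K₂ fun t => symplecticTransvection η v (t * c) where
  contDiff := contDiff_const.add ((contDiff_id.mul contDiff_const).smul contDiff_const)
  zero := by simp [symplecticTransvection]
  symplectic t x y := by
    simp only [symplecticTransvection_apply, map_add, map_smul, LinearMap.add_apply,
      LinearMap.smul_apply, smul_eq_mul, halt.self_eq_zero v]
    rw [← LinearMap.IsAlt.neg halt v x]
    ring
  mem₁ t x := by
    rw [symplecticTransvection_apply]
    exact Submodule.add_mem_iff_left _ (K₁.smul_mem _ hv)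
  mem₂ t x := by
    rw [symplecticTransvection_apply]
    constructor
    · intro h
      have h1 := hK v hv _ h
      simp only [map_add, map_smul, halt.self_eq_zero v, smul_zero, add_zero] at h1
      simpa [h1] using h
    · intro h
      simpa [hK v hv x h] using h

/-- By dimension `L` and `K₁` are complementary. This matches vectors of two Lagrangians modulo
`K₁`. -/
lemma IsTransverseLagrangian.exists_sub_mem {L : Submodule ℝ V}
    (hL : IsTransverseLagrangian η K₁ K₂ L) (h1 : 2 * finrank ℝ K₁ = finrank ℝ V) (x : V) :
    ∃ y ∈ L, y - x ∈ K₁ := by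
  have htop : L ⊔ K₁ = ⊤ := by
    refine Submodule.eq_top_of_disjoint _ _ ?_ hL.disjoint₁
    have := hL.finrank_eq
    omega
  obtain ⟨y, hy, k, hk, hyk⟩ := Submodule.mem_sup.1 (htop ▸ Submodule.mem_top : x ∈ L ⊔ K₁)
  refine ⟨y, hy, ?_⟩
  rw [← hyk, sub_add_cancel_left]
  exact K₁.neg_mem hk

/-- A single transvection increases the intersection of two Lagrangians. -/
lemma exists_transvection_inf_lt (halt : η.IsAlt)
    (hK : ∀ u ∈ K₁, ∀ v ∈ K₂, η u v = 0) {L₀ L₁ : Submodule ℝ V}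
    (hL₀ : IsTransverseLagrangian η K₁ K₂ L₀) (hL₁ : IsTransverseLagrangian η K₁ K₂ L₁)
    {x x' : V} (hx : x ∈ L₀) (hx' : x' ∈ L₁) (hxx : x' - x ∈ K₁) (hne : η x' x ≠ 0) :
    ∃ g, IsSymplecticPath η K₁ K₂ g ∧
      finrank ℝ (L₀ ⊓ L₁ : Submodule ℝ V) <
        finrank ℝ (L₀.map (g 1 : V →ₗ[ℝ] V) ⊓ L₁ : Submodule ℝ V) := by
  have hvx : η (x' - x) x = η x' x := by simp [halt.self_eq_zero x]
  -- Since `η(x' - x, x) = η(x', x)`, this constant makes the time-one map send `x` to `x'`. It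
  -- fixes `L₀ ∩ L₁`, as `x' - x` is orthogonal to it, so the intersection gains `x'`.
  refine ⟨_, isSymplecticPath_transvection halt hK hxx (η x' x)⁻¹, ?_⟩
  have hx'0 : x' ∉ L₀ := by
    intro h
    have := Submodule.disjoint_def.1 hL₀.disjoint₁ _ (L₀.sub_mem h hx) hxx
    rw [sub_eq_zero.1 this, halt.self_eq_zero] at hne
    exact hne rfl
  have hsub : (L₀ ⊓ L₁) ⊔ Submodule.span ℝ {x'} ≤
      L₀.map (symplecticTransvection η (x' - x) (1 * (η x' x)⁻¹) : V →ₗ[ℝ] V) ⊓ L₁ := by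
    refine sup_le (fun z hz => ⟨⟨z, hz.1, ?_⟩, hz.2⟩) ?_
    · have hz0 : η (x' - x) z = 0 := by
        rw [map_sub, LinearMap.sub_apply, hL₁.isotropic x' hx' z hz.2, hL₀.isotropic x hx z hz.1,
          sub_zero]
      exact (symplecticTransvection_apply _ _ _).trans (by rw [hz0]; simp)
    · rw [Submodule.span_singleton_le_iff_mem]
      refine ⟨⟨x, hx, ?_⟩, hx'⟩
      refine (symplecticTransvection_apply _ _ _).trans ?_
      rw [hvx, one_mul, inv_mul_cancel₀ hne, one_smul]
      abel
  have hle := Submodule.finrank_mono hsub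
  rw [finrank_sup_span_of_notMem fun h => hx'0 (Submodule.mem_inf.1 h).1] at hle
  exact hle

/-- Lagrangians with the same two complements, which are orthogonal to each other, are joined by a
path of symplectic automorphisms preserving the complements. -/
theorem exists_isSymplecticPath_map_le (halt : η.IsAlt) (hnd : η.Nondegenerate)
    (hK : ∀ u ∈ K₁, ∀ v ∈ K₂, η u v = 0) (h1 : 2 * finrank ℝ K₁ = finrank ℝ V)
    {L₀ L₁ : Submodule ℝ V}
    (hL₀ : IsTransverseLagrangian η K₁ K₂ L₀) (hL₁ : IsTransverseLagrangian η K₁ K₂ L₁) :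
    ∃ g, IsSymplecticPath η K₁ K₂ g ∧ ∀ x ∈ L₀, g 1 x ∈ L₁ := by
  -- The induction is on the codimension of the intersection; the crude bound `dim V` is enough.
  obtain ⟨m, hm⟩ : ∃ m, finrank ℝ V ≤ finrank ℝ (L₀ ⊓ L₁ : Submodule ℝ V) + m :=
    ⟨finrank ℝ V, by omega⟩
  induction m generalizing L₀ with
  | zero =>
    have hle := Submodule.finrank_mono (inf_le_right : L₀ ⊓ L₁ ≤ L₁)
    have heq : L₀ ⊓ L₁ = L₁ := Submodule.eq_of_le_of_finrank_le inf_le_right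
      ((Submodule.finrank_le L₁).trans (by omega))
    have heq' : L₀ ⊓ L₁ = L₀ := Submodule.eq_of_le_of_finrank_le inf_le_left
      ((Submodule.finrank_le L₀).trans (by omega))
    refine ⟨_, IsSymplecticPath.id, fun x hx => ?_⟩
    rw [← heq'] at hx
    exact hx.2
  | succ m ih =>
    by_cases hle : L₀ ≤ L₁
    · exact ⟨_, IsSymplecticPath.id, fun x hx => hle hx⟩
    -- a path after which the intersection is larger
    obtain ⟨g, hg, hlt⟩ : ∃ g, IsSymplecticPath η K₁ K₂ g ∧
        finrank ℝ (L₀ ⊓ L₁ : Submodule ℝ V) <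
          finrank ℝ (L₀.map (g 1 : V →ₗ[ℝ] V) ⊓ L₁ : Submodule ℝ V) := by
      -- On pairs matched modulo `K₁`, `η(x', x)` is a quadratic form. If it is not zero, one
      -- transvection suffices. If it is zero, a preliminary transvection makes it nonzero on some
      -- pair.
      by_cases hA : ∃ x ∈ L₀, ∃ x' ∈ L₁, x' - x ∈ K₁ ∧ η x' x ≠ 0
      · obtain ⟨x, hx, x', hx', hxx, hne⟩ := hA
        exact exists_transvection_inf_lt halt hK hL₀ hL₁ hx hx' hxx hne
      push Not at hA
      obtain ⟨x, hx, hx1⟩ := Set.not_subset.1 hle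
      obtain ⟨x', hx', hxx⟩ := hL₁.exists_sub_mem h1 x
      obtain ⟨y, hy, hxy⟩ : ∃ y ∈ L₀, η (x' - x) y ≠ 0 := by
        by_contra! hcon
        have h2 : x' - x ∈ L₀ := mem_of_isotropic_of_finrank hnd hL₀.isotropic
          hL₀.finrank_eq fun u hu => halt.isRefl _ _ (hcon u hu)
        have h3 := Submodule.disjoint_def.1 hL₀.disjoint₁ _ h2 hxx
        rw [sub_eq_zero] at h3
        exact hx1 (h3 ▸ hx')
      rw [map_sub, LinearMap.sub_apply, hL₀.isotropic x hx y hy, sub_zero] at hxy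
      obtain ⟨y', hy', hyy⟩ := hL₁.exists_sub_mem h1 y
      -- Polarisation of the vanishing quadratic form.
      have hpol : η x' y + η y' x = 0 := by
        have h2 := hA (x + y) (L₀.add_mem hx hy) (x' + y') (L₁.add_mem hx' hy') (by
          rw [add_sub_add_comm]
          exact K₁.add_mem hxx hyy)
        simp only [map_add, LinearMap.add_apply, hA x hx x' hx' hxx, hA y hy y' hy' hyy] at h2
        linear_combination h2
      -- After `T`, the pair `(T x, x')` is still matched modulo `K₁`, and `η(x', T x) = η(x', y)² ≠
      -- 0`. Also `T` fixes `L₀ ∩ L₁`, so nothing is lost.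
      let T := symplecticTransvection η (y' - y) (1 * 1)
      have hT := isSymplecticPath_transvection halt hK hyy 1
      have hTx : T x = x + η y' x • (y' - y) := by
        simp [T, symplecticTransvection_apply, hL₀.isotropic y hy x hx]
      have hne : η x' (T x) ≠ 0 := by
        have h2 : η x' (T x) = η x' y * η x' y := by
          rw [hTx, map_add, map_smul, map_sub, hA x hx x' hx' hxx, hL₁.isotropic x' hx' y' hy',
            smul_eq_mul]
          linear_combination (-η x' y) * hpol
        rw [h2]
        exact mul_ne_zero hxy hxy
      have hxT : x' - T x ∈ K₁ := by
        rw [hTx, ← sub_sub]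
        exact K₁.sub_mem hxx (K₁.smul_mem _ hyy)
      obtain ⟨g, hg, hlt⟩ := exists_transvection_inf_lt halt hK (hT.map hnd 1 hL₀) hL₁
        ⟨x, hx, rfl⟩ hx' hxT hne
      refine ⟨_, hg.comp hT, ?_⟩
      have hmap : L₀.map ((g 1).comp T : V →ₗ[ℝ] V) = (L₀.map (T : V →ₗ[ℝ] V)).map
          (g 1 : V →ₗ[ℝ] V) := Submodule.map_comp _ _ _
      refine lt_of_le_of_lt (Submodule.finrank_mono ?_) (hmap ▸ hlt)
      refine fun z hz => ⟨⟨z, hz.1, ?_⟩, hz.2⟩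
      have hz0 : η (y' - y) z = 0 := by
        rw [map_sub, LinearMap.sub_apply, hL₁.isotropic y' hy' z hz.2,
          hL₀.isotropic y hy z hz.1, sub_zero]
      exact (symplecticTransvection_apply _ _ _).trans (by rw [hz0]; simp)
    obtain ⟨h, hh, hmem⟩ := ih (hg.map hnd 1 hL₀) (by omega)
    exact ⟨_, hh.comp hg, fun x hx => hmem _ ⟨x, hx, rfl⟩⟩

end Transvections

/-! ### Inverse functions depending on a parameter -/

section FamilyInverse

open Module

variable {E₁ E₂ : Type*} [NormedAddCommGroup E₁] [NormedSpace ℝ E₁] [FiniteDimensional ℝ E₁]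
  [NormedAddCommGroup E₂] [NormedSpace ℝ E₂] [FiniteDimensional ℝ E₂]

lemma exists_continuousLinearEquiv_of_injective (hdim : finrank ℝ E₁ = finrank ℝ E₂)
    (A : E₁ →L[ℝ] E₂) (hA : Function.Injective A) : ∃ e : E₁ ≃L[ℝ] E₂, (e : E₁ →L[ℝ] E₂) = A :=
  ⟨(LinearEquiv.ofInjectiveOfFinrankEq (A : E₁ →ₗ[ℝ] E₂) hA hdim).toContinuousLinearEquiv, by
    ext; rfl⟩

/-- The inverse function theorem with a parameter, along a compact interval of parameters. -/
theorem exists_family_inverse (hdim : finrank ℝ E₁ = finrank ℝ E₂) {Φ : ℝ × E₁ → E₂} {x₀ : E₁}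
    {O : Set (ℝ × E₁)} (hO : IsOpen O) (hΦ : ∀ p ∈ O, ContDiffAt ℝ ∞ Φ p)
    (hx₀ : ∀ t ∈ Icc (0 : ℝ) 1, (t, x₀) ∈ O)
    (hinj : ∀ t ∈ Icc (0 : ℝ) 1, ∀ u, fderiv ℝ (fun x => Φ (t, x)) x₀ u = 0 → u = 0) :
    ∃ N ⊆ O, IsOpen N ∧ (∀ t ∈ Icc (0 : ℝ) 1, (t, x₀) ∈ N) ∧ ∃ h : ℝ × E₂ → E₁, ∀ p ∈ N,
      h (p.1, Φ p) = p.2 ∧ ContDiffAt ℝ ∞ h (p.1, Φ p) ∧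
      ∀ᶠ q in 𝓝 (p.1, Φ p), (q.1, h q) ∈ N ∧ Φ (q.1, h q) = q.2 := by
  have hne : (∞ : WithTop ℕ∞) ≠ 0 := by simp
  -- Keeping the parameter as a coordinate reduces the family to a single local inverse theorem.
  let Ψ : ℝ × E₁ → ℝ × E₂ := fun p => (p.1, Φ p)
  have hΨ : ∀ p ∈ O, ContDiffAt ℝ ∞ Ψ p := fun p hp => contDiffAt_fst.prodMk (hΦ p hp)
  have hdim' : finrank ℝ (ℝ × E₁) = finrank ℝ (ℝ × E₂) := by
    rw [finrank_prod, finrank_prod, hdim]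
  let R : Set (ℝ × E₁ →L[ℝ] ℝ × E₂) := range
    (ContinuousLinearEquiv.toContinuousLinearMap : ((ℝ × E₁) ≃L[ℝ] (ℝ × E₂)) → _)
  have hRo : IsOpen R := ContinuousLinearEquiv.isOpen
  have hcont : ContinuousOn (fderiv ℝ Ψ) O := fun p hp =>
    ((hΨ p hp).fderiv_right (m := 0) (by simp)).continuousAt.continuousWithinAt
  let O' := O ∩ fderiv ℝ Ψ ⁻¹' R
  have hO' : IsOpen O' := hcont.isOpen_inter_preimage hO hRo
  have hx₀' : ∀ t ∈ Icc (0 : ℝ) 1, (t, x₀) ∈ O' := by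
    intro t ht
    refine ⟨hx₀ t ht, ?_⟩
    obtain ⟨e, he⟩ := exists_continuousLinearEquiv_of_injective hdim' (fderiv ℝ Ψ (t, x₀)) (by
      have hd : DifferentiableAt ℝ Φ (t, x₀) := (hΦ _ (hx₀ t ht)).differentiableAt hne
      have h1 : HasFDerivAt Ψ ((ContinuousLinearMap.fst ℝ ℝ E₁).prod (fderiv ℝ Φ (t, x₀)))
          (t, x₀) := hasFDerivAt_fst.prodMk hd.hasFDerivAt
      have h2 : HasFDerivAt (fun x => Φ (t, x)) _ x₀ :=
        HasFDerivAt.comp (g := Φ) x₀ hd.hasFDerivAt (hasFDerivAt_prodMk_right t x₀)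
      rw [h1.fderiv, injective_iff_map_eq_zero]
      rintro ⟨s, u⟩ hsu
      simp only [ContinuousLinearMap.prod_apply, ContinuousLinearMap.coe_fst', Prod.mk_eq_zero]
        at hsu
      obtain ⟨rfl, hu⟩ := hsu
      have := hinj t ht u (by rw [h2.fderiv]; exact hu)
      rw [this]
      rfl)
    exact ⟨e, he⟩
  have hloc : ∀ p ∈ O', ∃ e : OpenPartialHomeomorph (ℝ × E₁) (ℝ × E₂), (e : _ → _) = Ψ ∧
      p ∈ e.source ∧ ContDiffAt ℝ ∞ e.symm (Ψ p) := by
    rintro p ⟨hpO, f, hf⟩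
    have hd : HasFDerivAt Ψ (f : (ℝ × E₁) →L[ℝ] (ℝ × E₂)) p := by
      rw [hf]
      exact ((hΨ p hpO).differentiableAt hne).hasFDerivAt
    exact ⟨(hΨ p hpO).toOpenPartialHomeomorph Ψ hd hne, rfl,
      (hΨ p hpO).mem_toOpenPartialHomeomorph_source hd hne, (hΨ p hpO).to_localInverse hd hne⟩
  -- Injectivity on a compact set and local injectivity near its points give injectivity on a
  -- neighbourhood, so the local inverses glue.
  obtain ⟨T, hT, hTinj⟩ := Set.InjOn.exists_mem_nhdsSet (f := Ψ) (s := Icc (0 : ℝ) 1 ×ˢ {x₀})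
    (by
      rintro ⟨t, x⟩ ⟨-, hx⟩ ⟨t', x'⟩ ⟨-, hx'⟩ h
      rw [mem_singleton_iff] at hx hx'
      have h1 : t = t' := congrArg Prod.fst h
      simp_all)
    (isCompact_Icc.prod isCompact_singleton)
    (by
      rintro ⟨t, x⟩ ⟨ht, hx⟩
      rw [mem_singleton_iff] at hx
      obtain rfl : x = x₀ := hx
      exact (hΨ _ (hx₀ t ht)).continuousAt)
    (by
      rintro ⟨t, x⟩ ⟨ht, hx⟩
      rw [mem_singleton_iff] at hx
      obtain rfl : x = x₀ := hx
      obtain ⟨e, he, hpe, -⟩ := hloc _ (hx₀' t ht)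
      exact ⟨e.source, e.open_source.mem_nhds hpe, he ▸ e.injOn⟩)
  let N := interior T ∩ O'
  have hNo : IsOpen N := isOpen_interior.inter hO'
  have hNinj : InjOn Ψ N := hTinj.mono (inter_subset_left.trans interior_subset)
  have hNx : ∀ t ∈ Icc (0 : ℝ) 1, (t, x₀) ∈ N := fun t ht =>
    ⟨subset_interior_iff_mem_nhdsSet.2 hT ⟨ht, rfl⟩, hx₀' t ht⟩
  have : Nonempty (ℝ × E₁) := ⟨0⟩
  refine ⟨N, fun p hp => hp.2.1, hNo, hNx, fun q => (Function.invFunOn Ψ N q).2, fun p hp => ?_⟩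
  have hinv : ∀ p ∈ N, Function.invFunOn Ψ N (Ψ p) = p := fun p hp =>
    hNinj.leftInvOn_invFunOn hp
  obtain ⟨e, he, hpe, hec⟩ := hloc p hp.2
  have hesymm : e.symm (Ψ p) = p := by rw [← he]; exact e.left_inv hpe
  have hev : ∀ᶠ q in 𝓝 (Ψ p), e.symm q ∈ N ∧ Ψ (e.symm q) = q := by
    have h1 : ∀ᶠ q in 𝓝 (Ψ p), e.symm q ∈ N :=
      hec.continuousAt.eventually (by rw [hesymm]; exact hNo.mem_nhds hp)
    have h2 : e.target ∈ 𝓝 (Ψ p) := e.open_target.mem_nhds (he ▸ e.map_source hpe)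
    filter_upwards [h1, h2] with q hq1 hq2
    refine ⟨hq1, ?_⟩
    rw [← he]
    exact e.right_inv hq2
  have hev' : ∀ᶠ q in 𝓝 (Ψ p), Function.invFunOn Ψ N q = e.symm q := by
    filter_upwards [hev] with q hq
    conv_lhs => rw [← hq.2]
    exact hinv _ hq.1
  refine ⟨congrArg Prod.snd (hinv p hp), ?_, ?_⟩
  · exact (contDiffAt_snd.comp _ hec).congr_of_eventuallyEq
      (hev'.mono fun q hq => congrArg Prod.snd hq)
  · change ∀ᶠ q in 𝓝 (Ψ p), _
    filter_upwards [hev, hev'] with q hq hq'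
    have h1 : (q.1, (Function.invFunOn Ψ N q).2) = e.symm q := by
      rw [hq']
      exact Prod.ext (congrArg Prod.fst hq.2).symm rfl
    rw [h1]
    exact ⟨hq.1, congrArg Prod.snd hq.2⟩

/-- The case of a constant family, at parameter `0`. -/
lemma exists_local_inverse (hdim : finrank ℝ E₁ = finrank ℝ E₂) {f : E₁ → E₂} {x₀ : E₁}
    {O : Set E₁} (hO : IsOpen O) (hf : ∀ x ∈ O, ContDiffAt ℝ ∞ f x) (hx₀ : x₀ ∈ O)
    (hinj : ∀ u, fderiv ℝ f x₀ u = 0 → u = 0) :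
    ∃ (O' : Set E₂) (ρ : E₂ → E₁), IsOpen O' ∧ f x₀ ∈ O' ∧ ρ (f x₀) = x₀ ∧
      ∀ y ∈ O', ρ y ∈ O ∧ f (ρ y) = y ∧ ContDiffAt ℝ ∞ ρ y := by
  obtain ⟨N, hNO, hN, hNx, h, hh⟩ := exists_family_inverse hdim (Φ := fun p : ℝ × E₁ => f p.2)
    (O := univ ×ˢ O) (x₀ := x₀) (isOpen_univ.prod hO)
    (fun p hp => ContDiffAt.comp (g := f) p (hf p.2 hp.2) contDiffAt_snd)
    (fun t _ => ⟨mem_univ _, hx₀⟩) (fun _ _ => hinj)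
  have h0 : ((0 : ℝ), x₀) ∈ N := hNx 0 ⟨le_rfl, zero_le_one⟩
  obtain ⟨hl, -, hr⟩ := hh _ h0
  have hr' : ∀ᶠ y in 𝓝 (f x₀), ((0 : ℝ), h (0, y)) ∈ N ∧ f (h (0, y)) = y := by
    have hc : ContinuousAt (fun y : E₂ => ((0 : ℝ), y)) (f x₀) := by fun_prop
    exact hc.eventually hr
  obtain ⟨O', hO'sub, hO', hxO'⟩ := _root_.eventually_nhds_iff.1 hr'
  refine ⟨O', fun y => h (0, y), hO', hxO', hl, fun y hy => ?_⟩
  obtain ⟨h1, h2⟩ := hO'sub y hy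
  refine ⟨(hNO h1).2, h2, ?_⟩
  have h3 := (hh _ h1).2.1
  simp only [h2] at h3
  exact ContDiffAt.comp (g := h) y h3 (contDiffAt_const.prodMk contDiffAt_id)

end FamilyInverse

/-! ### Isotopies of Lagrangian germs in a symplectic vector space -/

section IsotropicFamily

open Module

variable {V W : Type*} [NormedAddCommGroup V] [NormedSpace ℝ V] [FiniteDimensional ℝ V]
  [NormedAddCommGroup W] [NormedSpace ℝ W]

/-- A Lagrangian embedding has a left inverse with isotropic kernel. -/
lemma exists_lagrangian_projection {η : LinearMap.BilinForm ℝ V} (halt : η.IsAlt)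
    (hnd : η.Nondegenerate) (hVW : 2 * finrank ℝ W = finrank ℝ V) (l : W →L[ℝ] V)
    (hl : Function.Injective l) (hiso : ∀ u v, η (l u) (l v) = 0) :
    ∃ Q : V →L[ℝ] W, (∀ u, Q (l u) = u) ∧ ∀ v w, Q v = 0 → Q w = 0 → η v w = 0 := by
  let L : Submodule ℝ V := LinearMap.range (l : W →ₗ[ℝ] V)
  have hLdim : finrank ℝ L = finrank ℝ W := LinearMap.finrank_range_of_inj hl
  have hL : ∀ u ∈ L, ∀ v ∈ L, η u v = 0 := by
    rintro _ ⟨u, rfl⟩ _ ⟨v, rfl⟩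
    exact hiso u v
  -- With `K₁ = K₂ = L` this is a Lagrangian complement of `L`; `Q` projects along it.
  obtain ⟨N, hN⟩ := exists_isTransverseLagrangian halt hnd hL (hLdim ▸ hVW) (hLdim ▸ hVW)
  have hc : IsCompl L N := by
    refine ⟨hN.disjoint₁.symm, codisjoint_iff.2 ?_⟩
    refine Submodule.eq_top_of_disjoint _ _ ?_ hN.disjoint₁.symm
    have := hN.finrank_eq
    omega
  let e := LinearEquiv.ofInjective (l : W →ₗ[ℝ] V) hl
  let P : V →ₗ[ℝ] L := L.projectionOnto N hc
  refine ⟨LinearMap.toContinuousLinearMap ((e.symm : L →ₗ[ℝ] W).comp P), fun u => ?_,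
    fun v w hv hw => ?_⟩
  · have h1 : P (l u) = e u := Submodule.projectionOnto_apply_left hc (e u)
    simp [h1]
  · have key : ∀ v, (e.symm : L →ₗ[ℝ] W).comp P v = 0 → v ∈ N := by
      intro v hv
      have h1 : P v = 0 := e.symm.map_eq_zero_iff.1 hv
      exact (Submodule.projectionOnto_apply_eq_zero_iff hc).1 h1
    exact hN.isotropic v (key v hv) w (key w hw)

variable [FiniteDimensional ℝ W]

/-- Two germs of Lagrangian submanifolds through the origin, both transverse to two given subspaces
orthogonal to each other, are joined by a smooth family of such germs. -/
theorem exists_isotropic_family {η : LinearMap.BilinForm ℝ V} (halt : η.IsAlt)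
    (hnd : η.Nondegenerate) {K₁ K₂ : Submodule ℝ V} (hK : ∀ u ∈ K₁, ∀ v ∈ K₂, η u v = 0)
    (h1 : 2 * finrank ℝ K₁ = finrank ℝ V) (hVW : 2 * finrank ℝ W = finrank ℝ V)
    {f₀ f₁ : W → V} {y₀ : W} {O : Set W} (hO : IsOpen O) (hy₀ : y₀ ∈ O)
    (hf₀ : ∀ y ∈ O, ContDiffAt ℝ ∞ f₀ y) (hf₁ : ∀ y ∈ O, ContDiffAt ℝ ∞ f₁ y)
    (hz₀ : f₀ y₀ = 0) (hz₁ : f₁ y₀ = 0)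
    (hi₀ : ∀ y ∈ O, ∀ u v, η (fderiv ℝ f₀ y u) (fderiv ℝ f₀ y v) = 0)
    (hi₁ : ∀ y ∈ O, ∀ u v, η (fderiv ℝ f₁ y u) (fderiv ℝ f₁ y v) = 0)
    (ht₀₁ : ∀ u, fderiv ℝ f₀ y₀ u ∈ K₁ → u = 0) (ht₀₂ : ∀ u, fderiv ℝ f₀ y₀ u ∈ K₂ → u = 0)
    (ht₁₁ : ∀ u, fderiv ℝ f₁ y₀ u ∈ K₁ → u = 0) (ht₁₂ : ∀ u, fderiv ℝ f₁ y₀ u ∈ K₂ → u = 0) :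
    ∃ (F : ℝ × W → V) (O' : Set W) (ρ₀ ρ₁ : W → W), IsOpen O' ∧ (0 : W) ∈ O' ∧
      (∀ x ∈ O', ρ₀ x ∈ O ∧ ρ₁ x ∈ O) ∧
      (∀ t, ∀ x ∈ O', ContDiffAt ℝ ∞ F (t, x)) ∧ (∀ t, F (t, 0) = 0) ∧
      (∀ t, ∀ x ∈ O', ∀ u v,
        η (fderiv ℝ (fun x => F (t, x)) x u) (fderiv ℝ (fun x => F (t, x)) x v) = 0) ∧
      (∀ t u, fderiv ℝ (fun x => F (t, x)) 0 u ∈ K₁ → u = 0) ∧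
      (∀ t u, fderiv ℝ (fun x => F (t, x)) 0 u ∈ K₂ → u = 0) ∧
      ∀ x ∈ O', F (0, x) = f₀ (ρ₀ x) ∧ F (1, x) = f₁ (ρ₁ x) := by
  have hne : (∞ : WithTop ℕ∞) ≠ 0 := by simp
  -- the tangent spaces
  have hLag : ∀ f : W → V, (∀ y ∈ O, ∀ u v, η (fderiv ℝ f y u) (fderiv ℝ f y v) = 0) →
      (∀ u, fderiv ℝ f y₀ u ∈ K₁ → u = 0) → (∀ u, fderiv ℝ f y₀ u ∈ K₂ → u = 0) →
      Function.Injective (fderiv ℝ f y₀) ∧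
      IsTransverseLagrangian η K₁ K₂ (LinearMap.range (fderiv ℝ f y₀ : W →ₗ[ℝ] V)) := by
    intro f hi ht1 ht2
    have hinj : Function.Injective (fderiv ℝ f y₀) := by
      rw [injective_iff_map_eq_zero]
      exact fun u hu => ht1 u (hu ▸ K₁.zero_mem)
    refine ⟨hinj, ?_, ?_, ?_, ?_⟩
    · rintro _ ⟨u, rfl⟩ _ ⟨v, rfl⟩
      exact hi y₀ hy₀ u v
    · rw [Submodule.disjoint_def]
      rintro _ ⟨u, rfl⟩ hu
      rw [ht1 u hu, map_zero]
    · rw [Submodule.disjoint_def]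
      rintro _ ⟨u, rfl⟩ hu
      rw [ht2 u hu, map_zero]
    · rw [LinearMap.finrank_range_of_inj hinj, hVW]
  obtain ⟨hinj₀, hL₀⟩ := hLag f₀ hi₀ ht₀₁ ht₀₂
  obtain ⟨hinj₁, hL₁⟩ := hLag f₁ hi₁ ht₁₁ ht₁₂
  -- After `g 1` the two germs have the same tangent space at the origin.
  obtain ⟨g, hg, hg1⟩ := exists_isSymplecticPath_map_le halt hnd hK h1 hL₀ hL₁
  obtain ⟨Q, hQl, hQ⟩ := exists_lagrangian_projection halt hnd hVW (fderiv ℝ f₁ y₀) hinj₁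
    (hi₁ y₀ hy₀)
  have hQL : ∀ w ∈ LinearMap.range (fderiv ℝ f₁ y₀ : W →ₗ[ℝ] V), fderiv ℝ f₁ y₀ (Q w) = w := by
    rintro _ ⟨u, rfl⟩
    exact congrArg _ (hQl u)
  have hd₀ : ∀ y ∈ O, HasFDerivAt f₀ (fderiv ℝ f₀ y) y := fun y hy =>
    ((hf₀ y hy).differentiableAt hne).hasFDerivAt
  have hd₁ : ∀ y ∈ O, HasFDerivAt f₁ (fderiv ℝ f₁ y) y := fun y hy =>
    ((hf₁ y hy).differentiableAt hne).hasFDerivAt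
  -- parametrizations over the first Lagrangian
  obtain ⟨O₀, ρ₀, hO₀, h0O₀, hρ₀0, hρ₀⟩ := exists_local_inverse rfl
    (f := fun y => Q (g 1 (f₀ y))) hO
    (fun y hy => ContDiffAt.comp (g := Q.comp (g 1)) y (Q.comp (g 1)).contDiff.contDiffAt (hf₀ y hy)) hy₀
    (fun u hu => by
      have hd : HasFDerivAt (fun y => Q (g 1 (f₀ y))) ((Q.comp (g 1)).comp (fderiv ℝ f₀ y₀)) y₀ :=
        HasFDerivAt.comp (g := Q.comp (g 1)) y₀ (Q.comp (g 1)).hasFDerivAt (hd₀ y₀ hy₀)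
      rw [hd.fderiv] at hu
      have hu' : Q (g 1 (fderiv ℝ f₀ y₀ u)) = 0 := hu
      have h2 := hQL _ (hg1 _ ⟨u, rfl⟩)
      have h3 : g 1 (fderiv ℝ f₀ y₀ u) = 0 :=
        h2.symm.trans ((congrArg (fderiv ℝ f₁ y₀) hu').trans (map_zero _))
      exact hinj₀ ((hg.injective hnd 1 (h3.trans (map_zero _).symm)).trans (map_zero _).symm))
  obtain ⟨O₁, ρ₁, hO₁, h0O₁, hρ₁0, hρ₁⟩ := exists_local_inverse rfl
    (f := fun y => Q (f₁ y)) hO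
    (fun y hy => ContDiffAt.comp (g := Q) y Q.contDiff.contDiffAt (hf₁ y hy)) hy₀
    (fun u hu => by
      have hd : HasFDerivAt (fun y => Q (f₁ y)) (Q.comp (fderiv ℝ f₁ y₀)) y₀ :=
        HasFDerivAt.comp (g := Q) y₀ Q.hasFDerivAt (hd₁ y₀ hy₀)
      rw [hd.fderiv] at hu
      exact (hQl u).symm.trans hu)
  simp only [hz₀, hz₁, map_zero] at h0O₀ hρ₀0 h0O₁ hρ₁0
  let G₀ : W → V := fun x => g 1 (f₀ (ρ₀ x))
  let G₁ : W → V := fun x => f₁ (ρ₁ x)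
  -- The linear motion takes place for `t ≤ 1/2` and the interpolation for `t ≥ 1/2`. The flat
  -- cutoffs make the concatenation smooth.
  let α : ℝ → ℝ := fun t => Real.smoothTransition (2 * t)
  let β : ℝ → ℝ := fun t => Real.smoothTransition (2 * t - 1)
  have hα : ContDiff ℝ ∞ α := Real.smoothTransition.contDiff.comp (contDiff_const.mul contDiff_id)
  have hβ : ContDiff ℝ ∞ β :=
    Real.smoothTransition.contDiff.comp ((contDiff_const.mul contDiff_id).sub contDiff_const)
  let F : ℝ × W → V := fun p => g (α p.1) (f₀ (ρ₀ p.2)) + β p.1 • (G₁ p.2 - G₀ p.2)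
  let O' := O₀ ∩ O₁
  -- derivatives
  let D₀ : W → W →L[ℝ] V := fun x => (fderiv ℝ f₀ (ρ₀ x)).comp (fderiv ℝ ρ₀ x)
  let D₁ : W → W →L[ℝ] V := fun x => (fderiv ℝ f₁ (ρ₁ x)).comp (fderiv ℝ ρ₁ x)
  have hD₀ : ∀ x ∈ O', HasFDerivAt (fun x => f₀ (ρ₀ x)) (D₀ x) x := fun x hx =>
    HasFDerivAt.comp (g := f₀) x (hd₀ _ (hρ₀ x hx.1).1)
      ((hρ₀ x hx.1).2.2.differentiableAt hne).hasFDerivAt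
  have hD₁ : ∀ x ∈ O', HasFDerivAt G₁ (D₁ x) x := fun x hx =>
    HasFDerivAt.comp (g := f₁) x (hd₁ _ (hρ₁ x hx.2).1)
      ((hρ₁ x hx.2).2.2.differentiableAt hne).hasFDerivAt
  have hDG₀ : ∀ x ∈ O', HasFDerivAt G₀ ((g 1).comp (D₀ x)) x := fun x hx =>
    HasFDerivAt.comp (g := g 1) x (g 1).hasFDerivAt (hD₀ x hx)
  have hF : ∀ t, ∀ x ∈ O', HasFDerivAt (fun x => F (t, x))
      ((g (α t)).comp (D₀ x) + β t • (D₁ x - (g 1).comp (D₀ x))) x := fun t x hx =>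
    (HasFDerivAt.comp (g := g (α t)) x (g (α t)).hasFDerivAt (hD₀ x hx)).add
      (((hD₁ x hx).sub (hDG₀ x hx)).const_smul (β t))
  have hO' : IsOpen O' := hO₀.inter hO₁
  have h0 : (0 : W) ∈ O' := ⟨h0O₀, h0O₁⟩
  have hQD₀ : ∀ x ∈ O', ∀ u, Q (g 1 (D₀ x u)) = u := fun x hx u => by
    have h2 : HasFDerivAt (fun x => Q (G₀ x)) (Q.comp ((g 1).comp (D₀ x))) x :=
      HasFDerivAt.comp (g := Q) x Q.hasFDerivAt (hDG₀ x hx)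
    have h3 : (fun x => Q (G₀ x)) =ᶠ[𝓝 x] _root_.id := by
      filter_upwards [hO'.mem_nhds hx] with y hy using (hρ₀ y hy.1).2.1
    exact congrArg (fun L => L u) (h2.unique ((hasFDerivAt_id x).congr_of_eventuallyEq h3))
  have hQD₁ : ∀ x ∈ O', ∀ u, Q (D₁ x u) = u := fun x hx u => by
    have h2 : HasFDerivAt (fun x => Q (G₁ x)) (Q.comp (D₁ x)) x :=
      HasFDerivAt.comp (g := Q) x Q.hasFDerivAt (hD₁ x hx)
    have h3 : (fun x => Q (G₁ x)) =ᶠ[𝓝 x] _root_.id := by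
      filter_upwards [hO'.mem_nhds hx] with y hy using (hρ₁ y hy.2).2.1
    exact congrArg (fun L => L u) (h2.unique ((hasFDerivAt_id x).congr_of_eventuallyEq h3))
  have hiD₀ : ∀ x ∈ O', ∀ t u v, η (g t (D₀ x u)) (g t (D₀ x v)) = 0 := fun x hx t u v =>
    (hg.symplectic t _ _).trans (hi₀ _ (hρ₀ x hx.1).1 _ _)
  have hiD₁ : ∀ x ∈ O', ∀ u v, η (D₁ x u) (D₁ x v) = 0 := fun x hx u v =>
    hi₁ _ (hρ₁ x hx.2).1 _ _
  -- Both vectors lie in the tangent space of the second germ, on which `Q` is injective, and have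
  -- the same image `u`. Hence interpolation does not change the derivative at the origin, and
  -- transversality there persists.
  have hzero : ∀ u, D₁ 0 u = g 1 (D₀ 0 u) := fun u => by
    have e1 : D₁ 0 u ∈ LinearMap.range (fderiv ℝ f₁ y₀ : W →ₗ[ℝ] V) := by
      refine ⟨fderiv ℝ ρ₁ 0 u, ?_⟩
      simp [D₁, hρ₁0]
    have e2 : g 1 (D₀ 0 u) ∈ LinearMap.range (fderiv ℝ f₁ y₀ : W →ₗ[ℝ] V) := by
      refine hg1 _ ⟨fderiv ℝ ρ₀ 0 u, ?_⟩
      simp [D₀, hρ₀0]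
    rw [← hQL _ e1, ← hQL _ e2, hQD₁ 0 h0, hQD₀ 0 h0]
  have hF0 : ∀ t u, fderiv ℝ (fun x => F (t, x)) 0 u = g (α t) (D₀ 0 u) := fun t u => by
    rw [(hF t 0 h0).fderiv]
    simp [hzero u]
  have hD₀inj : ∀ u, fderiv ℝ ρ₀ 0 u = 0 → u = 0 := fun u hu => by
    have h2 := hQD₀ 0 h0 u
    simp only [D₀, ContinuousLinearMap.comp_apply, hu, map_zero] at h2
    exact h2.symm
  have hD₀0 : ∀ u, D₀ 0 u = fderiv ℝ f₀ y₀ (fderiv ℝ ρ₀ 0 u) := fun u => by simp [D₀, hρ₀0]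
  refine ⟨F, O', ρ₀, ρ₁, hO', h0, fun x hx => ⟨(hρ₀ x hx.1).1, (hρ₁ x hx.2).1⟩, ?_, ?_, ?_, ?_, ?_,
    ?_⟩
  · intro t x hx
    have c0 : ContDiffAt ℝ ∞ (fun p : ℝ × W => f₀ (ρ₀ p.2)) (t, x) :=
      ContDiffAt.comp (g := f₀) (t, x) (hf₀ _ (hρ₀ x hx.1).1)
        (ContDiffAt.comp (g := ρ₀) (t, x) (hρ₀ x hx.1).2.2 contDiffAt_snd)
    have c1 : ContDiffAt ℝ ∞ (fun p : ℝ × W => G₁ p.2) (t, x) :=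
      ContDiffAt.comp (g := f₁) (t, x) (hf₁ _ (hρ₁ x hx.2).1)
        (ContDiffAt.comp (g := ρ₁) (t, x) (hρ₁ x hx.2).2.2 contDiffAt_snd)
    have c2 : ContDiffAt ℝ ∞ (fun p : ℝ × W => G₀ p.2) (t, x) :=
      ContDiffAt.comp (g := g 1) (t, x) (g 1).contDiff.contDiffAt c0
    have c3 : ContDiffAt ℝ ∞ (fun p : ℝ × W => g (α p.1)) (t, x) :=
      ((hg.contDiff.comp hα).comp contDiff_fst).contDiffAt
    have c4 : ContDiffAt ℝ ∞ (fun p : ℝ × W => β p.1) (t, x) :=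
      (hβ.comp contDiff_fst).contDiffAt
    exact (c3.clm_apply c0).add (c4.smul (c1.sub c2))
  · intro t
    simp [F, G₀, G₁, hρ₀0, hρ₁0, hz₀, hz₁]
  · intro t x hx u v
    rw [(hF t x hx).fderiv]
    rcases le_total t (1 / 2) with ht | ht
    · have hb : β t = 0 := Real.smoothTransition.zero_of_nonpos (by linarith)
      simpa [hb] using hiD₀ x hx (α t) u v
    · have ha : α t = 1 := Real.smoothTransition.one_of_one_le (by linarith)
      -- The two differentials have the same `Q`-component, so their differences lie in the
      -- isotropic kernel of `Q`. As both are isotropic, the form on the interpolation is `(β² - β)`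
      -- times its value on these differences.
      have key := hQ (D₁ x u - g 1 (D₀ x u)) (D₁ x v - g 1 (D₀ x v))
        (by rw [map_sub, hQD₁ x hx, hQD₀ x hx, sub_self])
        (by rw [map_sub, hQD₁ x hx, hQD₀ x hx, sub_self])
      simp only [ha, add_apply, smul_apply, sub_apply, ContinuousLinearMap.comp_apply, map_add,
        map_sub, map_smul, LinearMap.add_apply, LinearMap.sub_apply, LinearMap.smul_apply,
        smul_eq_mul, hiD₀ x hx 1, hiD₁ x hx] at key ⊢
      linear_combination (-β t + β t * β t) * key
  · intro t u hu
    rw [hF0, hg.mem₁, hD₀0] at hu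
    exact hD₀inj u (ht₀₁ _ hu)
  · intro t u hu
    rw [hF0, hg.mem₂, hD₀0] at hu
    exact hD₀inj u (ht₀₂ _ hu)
  · intro x hx
    have a0 : α 0 = 0 := Real.smoothTransition.zero_of_nonpos (by norm_num)
    have b0 : β 0 = 0 := Real.smoothTransition.zero_of_nonpos (by norm_num)
    have a1 : α 1 = 1 := Real.smoothTransition.one_of_one_le (by norm_num)
    have b1 : β 1 = 1 := Real.smoothTransition.one_of_one_le (by norm_num)
    constructor
    · simp [F, a0, b0, hg.zero]
    · simp [F, G₀, G₁, a1, b1]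

end IsotropicFamily

/-! ### From families of germs to families of sections -/

section SectionFamily

open Module

variable {V W W' : Type*} [NormedAddCommGroup V] [NormedSpace ℝ V] [FiniteDimensional ℝ V]
  [NormedAddCommGroup W] [NormedSpace ℝ W] [FiniteDimensional ℝ W]
  [NormedAddCommGroup W'] [NormedSpace ℝ W'] [FiniteDimensional ℝ W']

/-- Two germs of Lagrangian sections of a submersion, both transverse to a second submersion whose
fibres are symplectically orthogonal, are joined by a smooth family of such germs. -/
theorem exists_section_family {η : LinearMap.BilinForm ℝ V} (halt : η.IsAlt)
    (hnd : η.Nondegenerate) {pm : V → W} {pp : V → W'} {OV : Set V} (hOV : IsOpen OV)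
    (h0V : (0 : V) ∈ OV) (hpm : ∀ v ∈ OV, ContDiffAt ℝ ∞ pm v) (hpp : ∀ v ∈ OV, ContDiffAt ℝ ∞ pp v)
    (hK : ∀ u v, fderiv ℝ pp 0 u = 0 → fderiv ℝ pm 0 v = 0 → η u v = 0)
    (hKdim : 2 * finrank ℝ (LinearMap.ker (fderiv ℝ pp 0 : V →ₗ[ℝ] W')) = finrank ℝ V)
    (hVW : 2 * finrank ℝ W = finrank ℝ V) (hWW : finrank ℝ W = finrank ℝ W')
    {f₀ f₁ : W → V} {O : Set W} (hO : IsOpen O) (hy₀ : pm 0 ∈ O)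
    (hf₀ : ∀ y ∈ O, ContDiffAt ℝ ∞ f₀ y) (hf₁ : ∀ y ∈ O, ContDiffAt ℝ ∞ f₁ y)
    (hz₀ : f₀ (pm 0) = 0) (hz₁ : f₁ (pm 0) = 0)
    (hs₀ : ∀ y ∈ O, pm (f₀ y) = y) (hs₁ : ∀ y ∈ O, pm (f₁ y) = y)
    (hi₀ : ∀ y ∈ O, ∀ u v, η (fderiv ℝ f₀ y u) (fderiv ℝ f₀ y v) = 0)
    (hi₁ : ∀ y ∈ O, ∀ u v, η (fderiv ℝ f₁ y u) (fderiv ℝ f₁ y v) = 0)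
    (ht₀ : ∀ u, fderiv ℝ pp 0 (fderiv ℝ f₀ (pm 0) u) = 0 → u = 0)
    (ht₁ : ∀ u, fderiv ℝ pp 0 (fderiv ℝ f₁ (pm 0) u) = 0 → u = 0) :
    ∃ (S : Set W) (β : ℝ × W → V) (κ : ℝ × W' → W), IsOpen S ∧ pm 0 ∈ S ∧ S ⊆ O ∧
      (∀ y ∈ S, β (0, y) = f₀ y ∧ β (1, y) = f₁ y) ∧
      ∀ t ∈ Icc (0 : ℝ) 1, β (t, pm 0) = 0 ∧ ∀ y ∈ S,
        ContDiffAt ℝ ∞ β (t, y) ∧ β (t, y) ∈ OV ∧ pm (β (t, y)) = y ∧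
        (∀ u v, η (fderiv ℝ (fun y => β (t, y)) y u) (fderiv ℝ (fun y => β (t, y)) y v) = 0) ∧
        ContDiffAt ℝ ∞ κ (t, pp (β (t, y))) ∧ κ (t, pp (β (t, y))) = y ∧
        ∀ᶠ e in 𝓝 (pp (β (t, y))), ∃ y' ∈ S, pp (β (t, y')) = e := by
  have hne : (∞ : WithTop ℕ∞) ≠ 0 := by simp
  have hpm0 : HasFDerivAt pm (fderiv ℝ pm 0) 0 :=
    ((hpm 0 h0V).differentiableAt hne).hasFDerivAt
  have hpp0 : HasFDerivAt pp (fderiv ℝ pp 0) 0 :=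
    ((hpp 0 h0V).differentiableAt hne).hasFDerivAt
  -- A section of `pm` is transverse to its fibres, as its derivative is a right inverse.
  have hsec : ∀ f : W → V, (∀ y ∈ O, ContDiffAt ℝ ∞ f y) → f (pm 0) = 0 →
      (∀ y ∈ O, pm (f y) = y) → ∀ u, fderiv ℝ pm 0 (fderiv ℝ f (pm 0) u) = 0 → u = 0 := by
    intro f hf hf0 hs u hu
    have h1 : HasFDerivAt (fun y => pm (f y)) ((fderiv ℝ pm 0).comp (fderiv ℝ f (pm 0))) (pm 0) :=
      HasFDerivAt.comp (g := pm) (pm 0) (by rw [hf0]; exact hpm0)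
        ((hf _ hy₀).differentiableAt hne).hasFDerivAt
    have h2 : (fun y => pm (f y)) =ᶠ[𝓝 (pm 0)] _root_.id := by
      filter_upwards [hO.mem_nhds hy₀] with y hy using hs y hy
    have h3 := congrArg (fun L => L u) (h1.unique ((hasFDerivAt_id _).congr_of_eventuallyEq h2))
    exact h3.symm.trans hu
  obtain ⟨F, O', ρ₀, ρ₁, hO', h0, hρ, hF, hF0, hFi, hF1, hF2, hFe⟩ := exists_isotropic_family
    (K₁ := LinearMap.ker (fderiv ℝ pp 0 : V →ₗ[ℝ] W'))
    (K₂ := LinearMap.ker (fderiv ℝ pm 0 : V →ₗ[ℝ] W)) halt hnd (fun u hu v hv => hK u v hu hv)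
    hKdim hVW hO hy₀ hf₀ hf₁ hz₀ hz₁ hi₀ hi₁ ht₀ (hsec f₀ hf₀ hz₀ hs₀) ht₁ (hsec f₁ hf₁ hz₁ hs₁)
  let OF : Set (ℝ × W) := (univ ×ˢ O') ∩ F ⁻¹' OV
  have hOF : IsOpen OF := by
    refine ContinuousOn.isOpen_inter_preimage ?_ (isOpen_univ.prod hO') hOV
    exact fun p hp => (hF p.1 p.2 hp.2).continuousAt.continuousWithinAt
  have h0F : ∀ t : ℝ, (t, (0 : W)) ∈ OF := fun t => ⟨⟨mem_univ _, h0⟩, by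
    change F (t, 0) ∈ OV
    rw [hF0]
    exact h0V⟩
  have hFp : ∀ p ∈ OF, ContDiffAt ℝ ∞ F p := fun p hp => hF p.1 p.2 hp.1.2
  have hFx : ∀ t, HasFDerivAt (fun x => F (t, x)) (fderiv ℝ (fun x => F (t, x)) 0) 0 := fun t => by
    have h1 : ContDiffAt ℝ ∞ (fun x => F (t, x)) 0 :=
      ContDiffAt.comp (g := F) 0 (hF t 0 h0) (contDiffAt_const.prodMk contDiffAt_id)
    exact (h1.differentiableAt hne).hasFDerivAt
  obtain ⟨N₂, hN₂F, hN₂, h0N₂, h₂, hh₂⟩ := exists_family_inverse hWW (Φ := fun p => pp (F p))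
    (x₀ := 0) hOF (fun p hp => ContDiffAt.comp (g := pp) p (hpp _ hp.2) (hFp p hp))
    (fun t _ => h0F t) (fun t _ u hu => by
      have h1 : HasFDerivAt (fun x => pp (F (t, x))) _ 0 :=
        HasFDerivAt.comp (g := pp) 0 (by rw [hF0]; exact hpp0) (hFx t)
      rw [h1.fderiv] at hu
      exact hF1 t u hu)
  -- Inverting `pm ∘ F` inside the domain `N₂` where `pp ∘ F` is already inverted makes both
  -- inverses available on `N₁`.
  obtain ⟨N₁, hN₁₂, hN₁, h0N₁, h₁, hh₁⟩ := exists_family_inverse rfl (Φ := fun p => pm (F p))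
    (x₀ := 0) hN₂
    (fun p hp => ContDiffAt.comp (g := pm) p (hpm _ (hN₂F hp).2) (hFp p (hN₂F hp)))
    h0N₂ (fun t _ u hu => by
      have h1 : HasFDerivAt (fun x => pm (F (t, x))) _ 0 :=
        HasFDerivAt.comp (g := pm) 0 (by rw [hF0]; exact hpm0) (hFx t)
      rw [h1.fderiv] at hu
      exact hF2 t u hu)
  -- Compactness of the time interval gives one domain `S` for all times.
  have htube : ∀ᶠ y in 𝓝 (pm 0), ∀ t ∈ Icc (0 : ℝ) 1,
      (t, h₁ (t, y)) ∈ N₁ ∧ pm (F (t, h₁ (t, y))) = y := by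
    refine isCompact_Icc.eventually_forall_of_forall_eventually fun t ht => ?_
    have h2 := (hh₁ _ (h0N₁ t ht)).2.2
    simp only [hF0] at h2
    have hc : ContinuousAt (fun z : W × ℝ => (z.2, z.1)) (pm 0, t) := by fun_prop
    exact hc.eventually h2
  obtain ⟨S, hS, hSo, h0S⟩ := _root_.eventually_nhds_iff.1 (htube.and (hO.mem_nhds hy₀))
  -- `β` is the family reparametrised as sections of `pm`; `κ` below inverts `pp ∘ β` at each time.
  let β : ℝ × W → V := fun q => F (q.1, h₁ q)
  let κ : ℝ × W' → W := fun q => pm (F (q.1, h₂ q))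
  refine ⟨S, β, κ, hSo, h0S, fun y hy => (hS y hy).2, fun y hy => ⟨?_, ?_⟩, fun t ht => ⟨?_, ?_⟩⟩
  · obtain ⟨hN, he⟩ := (hS y hy).1 0 ⟨le_rfl, zero_le_one⟩
    have hx := (hN₂F (hN₁₂ hN)).1.2
    have e1 := (hFe _ hx).1
    -- Since `f₀` is a section, this says `ρ₀ (h₁ (0, y)) = y`: the reparametrisation disappears at
    -- the endpoint.
    rw [e1, hs₀ _ (hρ _ hx).1] at he
    change F (0, h₁ (0, y)) = f₀ y
    rw [e1, he]
  · obtain ⟨hN, he⟩ := (hS y hy).1 1 ⟨zero_le_one, le_rfl⟩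
    have hx := (hN₂F (hN₁₂ hN)).1.2
    have e1 := (hFe _ hx).2
    rw [e1, hs₁ _ (hρ _ hx).2] at he
    change F (1, h₁ (1, y)) = f₁ y
    rw [e1, he]
  · have h2 := (hh₁ _ (h0N₁ t ht)).1
    simp only [hF0] at h2
    change F (t, h₁ (t, pm 0)) = 0
    rw [h2, hF0]
  · intro y hy
    obtain ⟨hN, he⟩ := (hS y hy).1 t ht
    have hOFp := hN₂F (hN₁₂ hN)
    obtain ⟨hl₁, hc₁, hr₁⟩ := hh₁ _ hN
    obtain ⟨hl₂, hc₂, hr₂⟩ := hh₂ _ (hN₁₂ hN)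
    simp only [he] at hl₁ hc₁ hr₁
    have hβc : ContDiffAt ℝ ∞ β (t, y) :=
      ContDiffAt.comp (g := F) (t, y) (hFp _ hOFp) (contDiffAt_fst.prodMk hc₁)
    have hκin : ContDiffAt ℝ ∞ (fun q : ℝ × W' => F (q.1, h₂ q)) (t, pp (β (t, y))) :=
      ContDiffAt.comp (g := F) (t, pp (β (t, y))) (by
        change ContDiffAt ℝ ∞ F (t, h₂ (t, pp (F (t, h₁ (t, y)))))
        rw [hl₂]
        exact hFp _ hOFp) (contDiffAt_fst.prodMk hc₂)
    have hκ1 : F (t, h₂ (t, pp (β (t, y)))) = β (t, y) := by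
      change F (t, h₂ (t, pp (F (t, h₁ (t, y))))) = F (t, h₁ (t, y))
      rw [hl₂]
    have hκc : ContDiffAt ℝ ∞ κ (t, pp (β (t, y))) :=
      ContDiffAt.comp (g := pm) (t, pp (β (t, y))) (by
        change ContDiffAt ℝ ∞ pm (F (t, h₂ (t, pp (β (t, y)))))
        rw [hκ1]
        exact hpm _ hOFp.2) hκin
    have hκe : κ (t, pp (β (t, y))) = y := by
      change pm (F (t, h₂ (t, pp (β (t, y))))) = y
      rw [hκ1]
      exact he
    refine ⟨hβc, hOFp.2, he, fun u v => ?_, hκc, hκe, ?_⟩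
    · have hhx : HasFDerivAt (fun y => h₁ (t, y)) (fderiv ℝ (fun y => h₁ (t, y)) y) y := by
        have h3 : ContDiffAt ℝ ∞ (fun y => h₁ (t, y)) y :=
          ContDiffAt.comp (g := h₁) y hc₁ (contDiffAt_const.prodMk contDiffAt_id)
        exact (h3.differentiableAt hne).hasFDerivAt
      have hFx' : HasFDerivAt (fun x => F (t, x)) (fderiv ℝ (fun x => F (t, x)) (h₁ (t, y)))
          (h₁ (t, y)) := by
        have h3 : ContDiffAt ℝ ∞ (fun x => F (t, x)) (h₁ (t, y)) :=
          ContDiffAt.comp (g := F) (h₁ (t, y)) (hFp _ hOFp) (contDiffAt_const.prodMk contDiffAt_id)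
        exact (h3.differentiableAt hne).hasFDerivAt
      have h4 : HasFDerivAt (fun y => β (t, y)) _ y :=
        HasFDerivAt.comp (g := fun x => F (t, x)) y hFx' hhx
      rw [h4.fderiv]
      exact hFi t _ hOFp.1.2 _ _
    · have hce : ContinuousAt (fun e : W' => (t, e)) (pp (β (t, y))) := by fun_prop
      have k1 : ∀ᶠ e in 𝓝 (pp (β (t, y))), (t, h₂ (t, e)) ∈ N₂ ∧ pp (F (t, h₂ (t, e))) = e :=
        hce.eventually hr₂
      have k2 : ∀ᶠ e in 𝓝 (pp (β (t, y))), (t, h₂ (t, e)) ∈ N₁ := by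
        have h5 : ContinuousAt (fun e : W' => (t, h₂ (t, e))) (pp (β (t, y))) :=
          continuousAt_const.prodMk (ContinuousAt.comp (g := h₂) hc₂.continuousAt hce)
        refine h5.eventually (hN₁.mem_nhds ?_)
        change (t, h₂ (t, pp (F (t, h₁ (t, y))))) ∈ N₁
        rw [hl₂]
        exact hN
      have k3 : ∀ᶠ e in 𝓝 (pp (β (t, y))), κ (t, e) ∈ S := by
        have h5 : ContinuousAt (fun e : W' => κ (t, e)) (pp (β (t, y))) :=
          ContinuousAt.comp (g := κ) hκc.continuousAt hce
        exact h5.eventually (hSo.mem_nhds (by change κ (t, pp (β (t, y))) ∈ S; rw [hκe]; exact hy))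
      filter_upwards [k1, k2, k3] with e he1 he2 he3
      refine ⟨κ (t, e), he3, ?_⟩
      -- The point with `pp`-value `e` is the one over `κ (t, e)`, so `pp ∘ β` covers a
      -- neighbourhood.
      have h6 : h₁ (t, κ (t, e)) = h₂ (t, e) := (hh₁ _ he2).1
      change pp (F (t, h₁ (t, κ (t, e)))) = e
      rw [h6]
      exact he1.2

end SectionFamily

/-! ### Real smooth structures underlying complex ones -/

section RealStructure

variable {E X F Y : Type*} [NormedAddCommGroup E] [NormedSpace ℂ E] [TopologicalSpace X]
  [ChartedSpace E X] [NormedAddCommGroup F] [NormedSpace ℂ F] [TopologicalSpace Y]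
  [ChartedSpace F Y]

/-- The charts are the same for both structures, so only the scalars have to be restricted. -/
theorem ContMDiffWithinAt.real_of_complex {f : X → Y} {s : Set X} {x : X}
    (hf : ContMDiffWithinAt 𝓘(ℂ, E) 𝓘(ℂ, F) ω f s x) :
    ContMDiffWithinAt 𝓘(ℝ, E) 𝓘(ℝ, F) ∞ f s x :=
  ⟨hf.1, (ContDiffWithinAt.restrict_scalars ℝ hf.2).of_le le_top⟩

theorem ContMDiffOn.real_of_complex {f : X → Y} {s : Set X}
    (hf : ContMDiffOn 𝓘(ℂ, E) 𝓘(ℂ, F) ω f s) : ContMDiffOn 𝓘(ℝ, E) 𝓘(ℝ, F) ∞ f s :=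
  fun x hx => (hf x hx).real_of_complex

theorem ContMDiff.real_of_complex {f : X → Y} (hf : ContMDiff 𝓘(ℂ, E) 𝓘(ℂ, F) ω f) :
    ContMDiff 𝓘(ℝ, E) 𝓘(ℝ, F) ∞ f :=
  fun x => ContMDiffWithinAt.real_of_complex (hf x)

theorem mfderiv_real_eq_complex {f : X → Y} {x : X} (hf : MDifferentiableAt 𝓘(ℂ, E) 𝓘(ℂ, F) f x)
    (u : E) : mfderiv 𝓘(ℝ, E) 𝓘(ℝ, F) f x u = mfderiv 𝓘(ℂ, E) 𝓘(ℂ, F) f x u := by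
  let f' : E →L[ℂ] F := mfderiv 𝓘(ℂ, E) 𝓘(ℂ, F) f x
  let f'' : E →L[ℝ] F := f'.restrictScalars ℝ
  have h : HasMFDerivAt 𝓘(ℝ, E) 𝓘(ℝ, F) f x f'' :=
    ⟨hf.hasMFDerivAt.1, HasFDerivWithinAt.restrictScalars ℝ hf.hasMFDerivAt.2⟩
  rw [h.mfderiv]
  rfl

end RealStructure

/-! ### Bisections over a general field, built from charts -/

section Bisection

variable {𝕜 : Type*} [NontriviallyNormedField 𝕜] {n : WithTop ℕ∞}
  {Ep Xp Em Xm EZ Z : Type*}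
  [NormedAddCommGroup Ep] [NormedSpace 𝕜 Ep] [TopologicalSpace Xp] [ChartedSpace Ep Xp]
  [NormedAddCommGroup Em] [NormedSpace 𝕜 Em] [TopologicalSpace Xm] [ChartedSpace Em Xm]
  [NormedAddCommGroup EZ] [NormedSpace 𝕜 EZ] [TopologicalSpace Z] [ChartedSpace EZ Z]

/-- A local homeomorphism to the model space which is a smooth diffeomorphism onto its image. -/
structure IsSmoothChart (𝕜 : Type*) [NontriviallyNormedField 𝕜] (n : WithTop ℕ∞)
    {E X : Type*} [NormedAddCommGroup E] [NormedSpace 𝕜 E] [TopologicalSpace X]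
    [ChartedSpace E X] (ψ : OpenPartialHomeomorph X E) : Prop where
  contMDiffOn : ContMDiffOn 𝓘(𝕜, E) 𝓘(𝕜, E) n ψ ψ.source
  contMDiffOn_symm : ContMDiffOn 𝓘(𝕜, E) 𝓘(𝕜, E) n ψ.symm ψ.target

/-- A local bisection of a pair of maps, isotropic for a field of bilinear forms. -/
structure IsIsotropicBisectionOn (𝕜 : Type*) [NontriviallyNormedField 𝕜] (n : WithTop ℕ∞)
    (Ep Em : Type*) {Xp Xm EZ Z : Type*}
    [NormedAddCommGroup Ep] [NormedSpace 𝕜 Ep] [TopologicalSpace Xp] [ChartedSpace Ep Xp]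
    [NormedAddCommGroup Em] [NormedSpace 𝕜 Em] [TopologicalSpace Xm] [ChartedSpace Em Xm]
    [NormedAddCommGroup EZ] [NormedSpace 𝕜 EZ] [TopologicalSpace Z] [ChartedSpace EZ Z]
    (G : Z → LinearMap.BilinForm 𝕜 EZ) (πp : Z → Xp) (πm : Z → Xm) (U : Set Xm) (b : Xm → Z) :
    Prop where
  isOpen : IsOpen U
  smooth : ContMDiffOn 𝓘(𝕜, Em) 𝓘(𝕜, EZ) n b U
  section_m : ∀ x ∈ U, πm (b x) = x
  isOpen_image : IsOpen ((πp ∘ b) '' U)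
  section_p : ∃ g : Xp → Xm, ContMDiffOn 𝓘(𝕜, Ep) 𝓘(𝕜, Em) n g ((πp ∘ b) '' U) ∧
    ∀ x ∈ U, g (πp (b x)) = x
  isotropic : ∀ x ∈ U, ∀ u w : Em, G (b x) (mfderiv 𝓘(𝕜, Em) 𝓘(𝕜, EZ) b x u)
    (mfderiv 𝓘(𝕜, Em) 𝓘(𝕜, EZ) b x w) = 0

theorem IsSmoothChart.contMDiffAt {ψ : OpenPartialHomeomorph Z EZ} (h : IsSmoothChart 𝕜 n ψ)
    {x : Z} (hx : x ∈ ψ.source) : ContMDiffAt 𝓘(𝕜, EZ) 𝓘(𝕜, EZ) n ψ x :=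
  (h.contMDiffOn x hx).contMDiffAt (ψ.open_source.mem_nhds hx)

theorem IsSmoothChart.contMDiffAt_symm {ψ : OpenPartialHomeomorph Z EZ}
    (h : IsSmoothChart 𝕜 n ψ) {y : EZ} (hy : y ∈ ψ.target) :
    ContMDiffAt 𝓘(𝕜, EZ) 𝓘(𝕜, EZ) n ψ.symm y :=
  (h.contMDiffOn_symm y hy).contMDiffAt (ψ.open_target.mem_nhds hy)

theorem isSmoothChart_chartAt [IsManifold 𝓘(𝕜, EZ) n Z] (z : Z) :
    IsSmoothChart 𝕜 n (chartAt EZ z) :=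
  ⟨contMDiffOn_chart, contMDiffOn_chart_symm⟩

/-- The expression in charts of a differentiable map has the expected derivative. -/
theorem hasFDerivAt_in_charts {ψ : OpenPartialHomeomorph Z EZ} (hψ : IsSmoothChart 𝕜 n ψ)
    {ξ : OpenPartialHomeomorph Xm Em} (hξ : IsSmoothChart 𝕜 n ξ) (hn : n ≠ 0) {p : Z → Xm} {v : EZ}
    (hv : v ∈ ψ.target) (hpv : p (ψ.symm v) ∈ ξ.source)
    (hp : MDifferentiableAt 𝓘(𝕜, EZ) 𝓘(𝕜, Em) p (ψ.symm v)) :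
    HasFDerivAt (fun v => ξ (p (ψ.symm v)))
      (((mfderiv 𝓘(𝕜, Em) 𝓘(𝕜, Em) ξ (p (ψ.symm v)) : Em →L[𝕜] Em).comp
        (mfderiv 𝓘(𝕜, EZ) 𝓘(𝕜, Em) p (ψ.symm v) : EZ →L[𝕜] Em)).comp
        (mfderiv 𝓘(𝕜, EZ) 𝓘(𝕜, EZ) ψ.symm v : EZ →L[𝕜] EZ)) v := by
  have h1 := ((hξ.contMDiffAt hpv).mdifferentiableAt hn).hasMFDerivAt
  have h2 := ((hψ.contMDiffAt_symm hv).mdifferentiableAt hn).hasMFDerivAt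
  have h3 := HasMFDerivAt.comp v (HasMFDerivAt.comp _ h1 hp.hasMFDerivAt) h2
  exact hasMFDerivAt_iff_hasFDerivAt.1 h3

theorem IsSmoothChart.mfderiv_symm_mfderiv {ψ : OpenPartialHomeomorph Z EZ}
    (hψ : IsSmoothChart 𝕜 n ψ) (hn : n ≠ 0) {x : Z} (hx : x ∈ ψ.source) (u : EZ) :
    mfderiv 𝓘(𝕜, EZ) 𝓘(𝕜, EZ) ψ.symm (ψ x) (mfderiv 𝓘(𝕜, EZ) 𝓘(𝕜, EZ) ψ x u) = u := by
  have h1 := ((hψ.contMDiffAt hx).mdifferentiableAt hn).hasMFDerivAt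
  have h2 := ((hψ.contMDiffAt_symm (ψ.map_source hx)).mdifferentiableAt hn).hasMFDerivAt
  have h3 := HasMFDerivAt.comp x h2 h1
  have h4 : HasMFDerivAt 𝓘(𝕜, EZ) 𝓘(𝕜, EZ) (ψ.symm ∘ ψ) x (ContinuousLinearMap.id 𝕜 _) :=
    (hasMFDerivAt_id x).congr_of_eventuallyEq (by
      filter_upwards [ψ.open_source.mem_nhds hx] with y hy using ψ.left_inv hy)
  exact congrArg (fun L : EZ →L[𝕜] EZ => L u) (hasMFDerivAt_unique h3 h4)

theorem IsSmoothChart.mfderiv_mfderiv_symm {ψ : OpenPartialHomeomorph Z EZ}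
    (hψ : IsSmoothChart 𝕜 n ψ) (hn : n ≠ 0) {v : EZ} (hv : v ∈ ψ.target) (u : EZ) :
    mfderiv 𝓘(𝕜, EZ) 𝓘(𝕜, EZ) ψ (ψ.symm v) (mfderiv 𝓘(𝕜, EZ) 𝓘(𝕜, EZ) ψ.symm v u) = u := by
  have h1 := ((hψ.contMDiffAt (ψ.map_target hv)).mdifferentiableAt hn).hasMFDerivAt
  have h2 := ((hψ.contMDiffAt_symm hv).mdifferentiableAt hn).hasMFDerivAt
  have h3 := HasMFDerivAt.comp v h1 h2
  have h4 : HasMFDerivAt 𝓘(𝕜, EZ) 𝓘(𝕜, EZ) (ψ ∘ ψ.symm) v (ContinuousLinearMap.id 𝕜 _) :=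
    (hasMFDerivAt_id v).congr_of_eventuallyEq (by
      filter_upwards [ψ.open_target.mem_nhds hv] with y hy using ψ.right_inv hy)
  exact congrArg (fun L : EZ →L[𝕜] EZ => L u) (hasMFDerivAt_unique h3 h4)

/-- A family of maps defined in charts gives an isotropic bisection. -/
theorem isIsotropicBisectionOn_of_charts {G : Z → LinearMap.BilinForm 𝕜 EZ}
    {η : LinearMap.BilinForm 𝕜 EZ} {πp : Z → Xp} {πm : Z → Xm} (hn : n ≠ 0)
    {ψ : OpenPartialHomeomorph Z EZ} (hψ : IsSmoothChart 𝕜 n ψ)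
    {ξm : OpenPartialHomeomorph Xm Em} (hξm : IsSmoothChart 𝕜 n ξm)
    {ξp : OpenPartialHomeomorph Xp Ep} (hξp : IsSmoothChart 𝕜 n ξp)
    (hG : ∀ v ∈ ψ.target, ∀ u w : EZ, G (ψ.symm v) (mfderiv 𝓘(𝕜, EZ) 𝓘(𝕜, EZ) ψ.symm v u)
      (mfderiv 𝓘(𝕜, EZ) 𝓘(𝕜, EZ) ψ.symm v w) = η u w)
    {S : Set Em} (hS : IsOpen S) (hSt : S ⊆ ξm.target) {β : Em → EZ} {κ : Ep → Em}
    (hβ : ∀ y ∈ S, ContDiffAt 𝕜 n β y)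
    (hβm : ∀ y ∈ S, β y ∈ ψ.target ∧ πm (ψ.symm (β y)) ∈ ξm.source ∧
      πp (ψ.symm (β y)) ∈ ξp.source)
    (hsec : ∀ y ∈ S, ξm (πm (ψ.symm (β y))) = y)
    (hiso : ∀ y ∈ S, ∀ u w, η (fderiv 𝕜 β y u) (fderiv 𝕜 β y w) = 0)
    (hκ : ∀ y ∈ S, ContDiffAt 𝕜 n κ (ξp (πp (ψ.symm (β y)))))
    (hκβ : ∀ y ∈ S, κ (ξp (πp (ψ.symm (β y)))) = y)
    (hop : ∀ y ∈ S, ∀ᶠ e in 𝓝 (ξp (πp (ψ.symm (β y)))),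
      ∃ y' ∈ S, ξp (πp (ψ.symm (β y'))) = e) :
    IsIsotropicBisectionOn 𝕜 n Ep Em G πp πm (ξm.source ∩ ξm ⁻¹' S) (fun x => ψ.symm (β (ξm x))) where
  isOpen := ξm.isOpen_inter_preimage hS
  smooth := by
    rintro x ⟨hx, hxS⟩
    have h1 := ContMDiffAt.comp x (hβ _ hxS).contMDiffAt (hξm.contMDiffAt hx)
    exact (ContMDiffAt.comp x (hψ.contMDiffAt_symm (hβm _ hxS).1) h1).contMDiffWithinAt
  section_m := by
    rintro x ⟨hx, hxS⟩
    exact ξm.injOn (hβm _ hxS).2.1 hx (hsec _ hxS)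
  isOpen_image := by
    rw [isOpen_iff_mem_nhds]
    rintro _ ⟨x, ⟨hx, hxS⟩, rfl⟩
    have hs := (hβm _ hxS).2.2
    have h1 := (ξp.continuousAt hs).eventually (hop _ hxS)
    filter_upwards [h1, ξp.open_source.mem_nhds hs] with e he hes
    obtain ⟨y', hy', h⟩ := he
    refine ⟨ξm.symm y', ⟨ξm.map_target (hSt hy'), ?_⟩, ?_⟩
    · change ξm (ξm.symm y') ∈ S
      rwa [ξm.right_inv (hSt hy')]
    · change πp (ψ.symm (β (ξm (ξm.symm y')))) = e
      rw [ξm.right_inv (hSt hy')]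
      exact ξp.injOn (hβm _ hy').2.2 hes h
  section_p := by
    refine ⟨fun e => ξm.symm (κ (ξp e)), ?_, ?_⟩
    · rintro _ ⟨x, ⟨hx, hxS⟩, rfl⟩
      refine ContMDiffAt.contMDiffWithinAt ?_
      refine ContMDiffAt.comp (I' := 𝓘(𝕜, Em)) (g := ξm.symm) (f := fun e => κ (ξp e)) _
        (hξm.contMDiffAt_symm ?_) (ContMDiffAt.comp _ (hκ _ hxS).contMDiffAt
          (hξp.contMDiffAt (hβm _ hxS).2.2))
      change κ (ξp (πp (ψ.symm (β (ξm x))))) ∈ ξm.target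
      rw [hκβ _ hxS]
      exact hSt hxS
    · rintro x ⟨hx, hxS⟩
      change ξm.symm (κ (ξp (πp (ψ.symm (β (ξm x)))))) = x
      rw [hκβ _ hxS, ξm.left_inv hx]
  isotropic := by
    rintro x ⟨hx, hxS⟩ u w
    have h1 := ((hξm.contMDiffAt hx).mdifferentiableAt hn).hasMFDerivAt
    have h2 := ((hψ.contMDiffAt_symm (hβm _ hxS).1).mdifferentiableAt hn).hasMFDerivAt
    have h3 := hasMFDerivAt_iff_hasFDerivAt.2 ((hβ _ hxS).differentiableAt hn).hasFDerivAt
    have h4 := HasMFDerivAt.comp x h2 (HasMFDerivAt.comp x h3 h1)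
    have h5 : mfderiv 𝓘(𝕜, Em) 𝓘(𝕜, EZ) (fun x => ψ.symm (β (ξm x))) x = _ := h4.mfderiv
    rw [h5]
    exact (hG _ (hβm _ hxS).1 _ _).trans (hiso _ hxS _ _)

end Bisection

/-! ### Bisections read in charts -/

section ChartExpression

variable {𝕜 : Type*} [NontriviallyNormedField 𝕜] {n : WithTop ℕ∞}
  {Ep Xp Em Xm EZ Z : Type*}
  [NormedAddCommGroup Ep] [NormedSpace 𝕜 Ep] [TopologicalSpace Xp] [ChartedSpace Ep Xp]
  [NormedAddCommGroup Em] [NormedSpace 𝕜 Em] [TopologicalSpace Xm] [ChartedSpace Em Xm]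
  [NormedAddCommGroup EZ] [NormedSpace 𝕜 EZ] [TopologicalSpace Z] [ChartedSpace EZ Z]

/-- The expression of a bisection in charts is an isotropic section, which is transverse to the
fibres of the second projection. -/
theorem IsIsotropicBisectionOn.exists_isOpen_charts {G : Z → LinearMap.BilinForm 𝕜 EZ}
    {η : LinearMap.BilinForm 𝕜 EZ} {πp : Z → Xp} {πm : Z → Xm} {U : Set Xm} {b : Xm → Z}
    (hb : IsIsotropicBisectionOn 𝕜 n Ep Em G πp πm U b) (hn : n ≠ 0)
    (hπp : ContMDiff 𝓘(𝕜, EZ) 𝓘(𝕜, Ep) n πp)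
    {ψ : OpenPartialHomeomorph Z EZ} (hψ : IsSmoothChart 𝕜 n ψ)
    {ξm : OpenPartialHomeomorph Xm Em} (hξm : IsSmoothChart 𝕜 n ξm)
    {ξp : OpenPartialHomeomorph Xp Ep} (hξp : IsSmoothChart 𝕜 n ξp)
    (hG : ∀ v ∈ ψ.target, ∀ u w : EZ, G (ψ.symm v) (mfderiv 𝓘(𝕜, EZ) 𝓘(𝕜, EZ) ψ.symm v u)
      (mfderiv 𝓘(𝕜, EZ) 𝓘(𝕜, EZ) ψ.symm v w) = η u w)
    {m : Xm} (hmU : m ∈ U) (hm : m ∈ ξm.source) (hz : b m ∈ ψ.source) :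
    ∃ O : Set Em, IsOpen O ∧ ξm m ∈ O ∧ O ⊆ ξm.target ∧ ∀ y ∈ O, ξm.symm y ∈ U ∧
      ψ.symm (ψ (b (ξm.symm y))) = b (ξm.symm y) ∧
      ContDiffAt 𝕜 n (fun y => ψ (b (ξm.symm y))) y ∧
      ξm (πm (ψ.symm (ψ (b (ξm.symm y))))) = y ∧
      (∀ u w, η (fderiv 𝕜 (fun y => ψ (b (ξm.symm y))) y u)
        (fderiv 𝕜 (fun y => ψ (b (ξm.symm y))) y w) = 0) ∧
      (πp (b (ξm.symm y)) ∈ ξp.source → ∀ u,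
        fderiv 𝕜 (fun v => ξp (πp (ψ.symm v))) (ψ (b (ξm.symm y)))
          (fderiv 𝕜 (fun y => ψ (b (ξm.symm y))) y u) = 0 → u = 0) := by
  have hO1 : IsOpen (U ∩ b ⁻¹' ψ.source) :=
    hb.smooth.continuousOn.isOpen_inter_preimage hb.isOpen ψ.open_source
  have hO : IsOpen (ξm.target ∩ ξm.symm ⁻¹' (U ∩ b ⁻¹' ψ.source)) :=
    ξm.symm.isOpen_inter_preimage hO1
  refine ⟨ξm.target ∩ ξm.symm ⁻¹' (U ∩ b ⁻¹' ψ.source), hO, ⟨ξm.map_source hm, ?_⟩,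
    inter_subset_left, ?_⟩
  · change ξm.symm (ξm m) ∈ U ∩ b ⁻¹' ψ.source
    rw [ξm.left_inv hm]
    exact ⟨hmU, hz⟩
  rintro y ⟨hyt, hyU, hyψ⟩
  have hyψ' : b (ξm.symm y) ∈ ψ.source := hyψ
  have hbs : ContMDiffAt 𝓘(𝕜, Em) 𝓘(𝕜, EZ) n b (ξm.symm y) :=
    (hb.smooth _ hyU).contMDiffAt (hb.isOpen.mem_nhds hyU)
  have hbd := hbs.mdifferentiableAt hn
  have hf := hasFDerivAt_in_charts hξm hψ hn hyt hyψ' hbd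
  have hfe : fderiv 𝕜 (fun y => ψ (b (ξm.symm y))) y = _ := HasFDerivAt.fderiv (E := Em) (F := EZ) hf
  have hleft : ψ.symm (ψ (b (ξm.symm y))) = b (ξm.symm y) := ψ.left_inv hyψ'
  refine ⟨hyU, hleft, ?_, ?_, ?_, ?_⟩
  · have h1 := ContMDiffAt.comp y hbs (hξm.contMDiffAt_symm hyt)
    exact (ContMDiffAt.comp y (hψ.contMDiffAt hyψ') h1).contDiffAt
  · rw [hleft, hb.section_m _ hyU, ξm.right_inv hyt]
  · intro u w
    have hfu : ∀ u : Em, mfderiv 𝓘(𝕜, EZ) 𝓘(𝕜, EZ) ψ.symm (ψ (b (ξm.symm y)))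
        (fderiv 𝕜 (fun y => ψ (b (ξm.symm y))) y u) = mfderiv 𝓘(𝕜, Em) 𝓘(𝕜, EZ) b (ξm.symm y)
          (mfderiv 𝓘(𝕜, Em) 𝓘(𝕜, Em) ξm.symm y u) := by
      intro u
      rw [hfe]
      exact hψ.mfderiv_symm_mfderiv hn hyψ' _
    rw [← hG _ (ψ.map_source hyψ'), hfu, hfu, hleft]
    exact hb.isotropic _ hyU _ _
  · intro hps u hu
    -- The inverse `g` of `πp ∘ b`, read in charts, has a derivative `L` which is a left inverse of
    -- the derivative of `πp ∘ b`; this yields transversality to the fibres of `πp`.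
    obtain ⟨g, hg, hgb⟩ := hb.section_p
    have hpp := hasFDerivAt_in_charts (p := πp) hψ hξp hn (ψ.map_source hyψ')
      (by rwa [hleft]) (hπp.mdifferentiableAt hn)
    have hppe : fderiv 𝕜 (fun v => ξp (πp (ψ.symm v))) (ψ (b (ξm.symm y))) = _ :=
      HasFDerivAt.fderiv (E := EZ) (F := Ep) hpp
    have hgd : MDifferentiableAt 𝓘(𝕜, Ep) 𝓘(𝕜, Em) g (ξp.symm (ξp (πp (b (ξm.symm y))))) := by
      rw [ξp.left_inv hps]
      have h1 : πp (b (ξm.symm y)) ∈ (πp ∘ b) '' U := ⟨_, hyU, rfl⟩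
      exact ((hg _ h1).contMDiffAt (hb.isOpen_image.mem_nhds h1)).mdifferentiableAt hn
    obtain ⟨L, hk⟩ : ∃ L : Ep →L[𝕜] Em, HasFDerivAt (fun e => ξm (g (ξp.symm e))) L
        (ξp (πp (b (ξm.symm y)))) :=
      ⟨_, hasFDerivAt_in_charts (p := g) hξp hξm hn (ξp.map_source hps)
        (by rw [ξp.left_inv hps, hgb _ hyU]; exact ξm.map_target hyt) hgd⟩
    have hk' := hk
    rw [← hleft] at hk'
    have hc := HasFDerivAt.comp (g := fun e => ξm (g (ξp.symm e)))
      (f := fun y => ξp (πp (ψ.symm (ψ (b (ξm.symm y)))))) y hk'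
      (HasFDerivAt.comp (g := fun v => ξp (πp (ψ.symm v))) (f := fun y => ψ (b (ξm.symm y))) y
        hpp hf)
    have hid : (fun y => ξm (g (ξp.symm (ξp (πp (ψ.symm (ψ (b (ξm.symm y)))))))))
        =ᶠ[𝓝 y] _root_.id := by
      have hcont : ContinuousAt (fun y => πp (b (ξm.symm y))) y :=
        ContinuousAt.comp (g := πp) hπp.continuous.continuousAt
          (ContinuousAt.comp (g := b) hbs.continuousAt (ξm.continuousAt_symm hyt))
      filter_upwards [hO.mem_nhds ⟨hyt, hyU, hyψ⟩,
        hcont.eventually (ξp.open_source.mem_nhds hps)] with y' hy' hps'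
      rw [ψ.left_inv hy'.2.2, ξp.left_inv hps', hgb _ hy'.2.1, ξm.right_inv hy'.1]
      rfl
    have h3 := congrArg (fun L => L u) (hc.unique ((hasFDerivAt_id y).congr_of_eventuallyEq hid))
    rw [hfe, hppe] at hu
    refine h3.symm.trans ?_
    exact (congrArg L hu).trans (map_zero L)

end ChartExpression

/-! ### Holomorphic inverse functions and sections -/

section InverseFunction

open Module

variable {E F F' : Type*} [NormedAddCommGroup E] [NormedSpace ℂ E]
  [NormedAddCommGroup F] [NormedSpace ℂ F]

/-- The restriction of a holomorphic map to a linear subspace. -/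
theorem contDiffAt_restrict_submodule {p : E → F} (hp : ContDiffAt ℂ ω p 0) (N : Submodule ℂ E) :
    ContDiffAt ℂ ω (fun x : N => p x) 0 ∧
      ∀ u : N, fderiv ℂ (fun x : N => p x) 0 u = fderiv ℂ p 0 u := by
  have h1 : ContDiffAt ℂ ω p (N.subtypeL 0) := hp
  have h2 : HasFDerivAt p (fderiv ℂ p 0) (N.subtypeL 0) :=
    (hp.differentiableAt (by simp)).hasFDerivAt
  refine ⟨ContDiffAt.comp (g := p) (0 : N) h1 N.subtypeL.contDiff.contDiffAt, fun u => ?_⟩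
  have h3 := HasFDerivAt.comp (g := p) (0 : N) h2 N.subtypeL.hasFDerivAt
  have h4 : fderiv ℂ (fun x : N => p x) 0 = _ := h3.fderiv
  rw [h4]
  rfl

variable [FiniteDimensional ℂ E] [FiniteDimensional ℂ F]
  [NormedAddCommGroup F'] [NormedSpace ℂ F'] [FiniteDimensional ℂ F']

/-- The holomorphic inverse function theorem, as a statement about biholomorphic germs. -/
theorem exists_openPartialHomeomorph_of_injective (hdim : finrank ℂ E = finrank ℂ F) {f : E → F}
    {a : E} (hf : ContDiffAt ℂ ω f a) (hinj : ∀ u, fderiv ℂ f a u = 0 → u = 0) {O : Set E}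
    (hO : O ∈ 𝓝 a) :
    ∃ ψ : OpenPartialHomeomorph E F, a ∈ ψ.source ∧ ψ.source ⊆ O ∧ (∀ x, ψ x = f x) ∧
      (∀ x ∈ ψ.source, ContDiffAt ℂ ω f x) ∧ ∀ y ∈ ψ.target, ContDiffAt ℂ ω ψ.symm y := by
  have hn : (ω : WithTop ℕ∞) ≠ 0 := by simp
  have hn' : (ω : WithTop ℕ∞) ≠ ∞ := by simp
  have hinj' : Function.Injective (fderiv ℂ f a : E →ₗ[ℂ] F) :=
    (injective_iff_map_eq_zero _).2 hinj
  let e : E ≃L[ℂ] F :=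
    (LinearEquiv.ofInjectiveOfFinrankEq _ hinj' hdim).toContinuousLinearEquiv
  have he : HasFDerivAt f (e : E →L[ℂ] F) a := (hf.differentiableAt hn).hasFDerivAt
  let ψ := hf.toOpenPartialHomeomorph f he hn
  have ha : a ∈ ψ.source := hf.mem_toOpenPartialHomeomorph_source he hn
  have hs : ContDiffAt ℂ ω ψ.symm (f a) := hf.to_localInverse he hn
  have h1 := hf.eventually hn'
  have h2 := (ψ.continuousAt ha).eventually (hs.eventually hn')
  -- Shrinking the source makes `f` and its inverse analytic at every point, not only at `a` and `f
  -- a`.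
  obtain ⟨T, hT, hTo, haT⟩ := _root_.eventually_nhds_iff.1 (h1.and (h2.and hO))
  refine ⟨ψ.restrOpen T hTo, ⟨ha, haT⟩, fun x hx => (hT x hx.2).2.2, fun x => rfl,
    fun x hx => (hT x hx.2).1, ?_⟩
  intro y hy
  have h3 := (hT _ hy.2).2.1
  rw [ψ.right_inv hy.1] at h3
  exact h3

/-- A linear complement to the kernels of the derivatives of two maps gives a germ of a
holomorphic section of the first, transverse to the second. -/
theorem exists_holomorphic_section {pm : E → F} {pp : E → F'} {OV : Set E} (hOV : IsOpen OV)
    (h0 : (0 : E) ∈ OV) (hpm : ContDiffAt ℂ ω pm 0) (hpp : ContDiffAt ℂ ω pp 0)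
    {N : Submodule ℂ E} (hNm : ∀ u ∈ N, fderiv ℂ pm 0 u = 0 → u = 0)
    (hNp : ∀ u ∈ N, fderiv ℂ pp 0 u = 0 → u = 0) (hdm : finrank ℂ N = finrank ℂ F)
    (hdp : finrank ℂ N = finrank ℂ F') :
    ∃ (S : Set F) (β : F → E) (κ : F' → F), IsOpen S ∧ pm 0 ∈ S ∧ β (pm 0) = 0 ∧ ∀ y ∈ S,
      ContDiffAt ℂ ω β y ∧ β y ∈ OV ∧ pm (β y) = y ∧ (∀ u, fderiv ℂ β y u ∈ N) ∧
      ContDiffAt ℂ ω κ (pp (β y)) ∧ κ (pp (β y)) = y ∧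
      ∀ᶠ e in 𝓝 (pp (β y)), ∃ y' ∈ S, pp (β y') = e := by
  have hn : (ω : WithTop ℕ∞) ≠ 0 := by simp
  have hOVn : ((↑) : N → E) ⁻¹' OV ∈ 𝓝 (0 : N) :=
    (hOV.preimage continuous_subtype_val).mem_nhds h0
  obtain ⟨h, h0s, hsub, hh, hhs, hht⟩ := exists_openPartialHomeomorph_of_injective hdm
    (f := fun x : N => pm x) (a := 0) (contDiffAt_restrict_submodule hpm N).1
    (fun u hu => Subtype.ext (hNm u u.2 (by rw [← (contDiffAt_restrict_submodule hpm N).2]; exact hu))) hOVn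
  obtain ⟨k, k0s, ksub, hk, hks, hkt⟩ := exists_openPartialHomeomorph_of_injective hdp
    (f := fun x : N => pp x) (a := 0) (contDiffAt_restrict_submodule hpp N).1
    (fun u hu => Subtype.ext (hNp u u.2 (by rw [← (contDiffAt_restrict_submodule hpp N).2]; exact hu)))
    (h.open_source.mem_nhds h0s)
  have hp0 : pm 0 = h 0 := (hh 0).symm
  -- The section is the plane `N` itself, parametrised by the inverse of `pm` on `N`, so its tangent
  -- vectors lie in `N`. The inverse of its `pp`-projection goes back to `N` by `k.symm` and then
  -- down by `pm`.
  refine ⟨h.target ∩ h.symm ⁻¹' k.source, fun y => (h.symm y : E), fun e => h (k.symm e),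
    h.symm.isOpen_inter_preimage k.open_source, ?_, ?_, ?_⟩
  · rw [hp0]
    refine ⟨h.map_source h0s, ?_⟩
    change h.symm (h 0) ∈ k.source
    rwa [h.left_inv h0s]
  · rw [hp0]
    change ((h.symm (h 0) : N) : E) = 0
    rw [h.left_inv h0s]
    rfl
  · rintro y ⟨hy, hyk⟩
    have hyk' : h.symm y ∈ k.source := hyk
    have hpy : pp (h.symm y : E) = k (h.symm y) := (hk _).symm
    have hβ : HasFDerivAt (fun y => (h.symm y : E)) (N.subtypeL.comp (fderiv ℂ h.symm y)) y :=
      HasFDerivAt.comp (g := N.subtypeL) y N.subtypeL.hasFDerivAt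
        ((hht y hy).differentiableAt hn).hasFDerivAt
    refine ⟨ContDiffAt.comp (g := N.subtypeL) y N.subtypeL.contDiff.contDiffAt (hht y hy),
      hsub (h.map_target hy), ?_, ?_, ?_, ?_, ?_⟩
    · exact (hh _).symm.trans (h.right_inv hy)
    · intro u
      rw [hβ.fderiv]
      exact (fderiv ℂ h.symm y u).2
    · rw [hpy]
      refine ContDiffAt.comp (g := h) (f := k.symm) _ ?_ (hkt _ (k.map_source hyk'))
      rw [k.left_inv hyk']
      exact (hhs _ (ksub hyk')).congr_of_eventuallyEq (Eventually.of_forall hh)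
    · change h (k.symm (pp (h.symm y : E))) = y
      rw [hpy, k.left_inv hyk', h.right_inv hy]
    · rw [hpy]
      filter_upwards [k.open_target.mem_nhds (k.map_source hyk')] with e he
      have hke := k.map_target he
      have hl := h.left_inv (ksub hke)
      refine ⟨h (k.symm e), ⟨h.map_source (ksub hke), ?_⟩, ?_⟩
      · change h.symm (h (k.symm e)) ∈ k.source
        rwa [hl]
      · rw [hl]
        exact (hk _).symm.trans (k.right_inv he)

end InverseFunction

/-! ### Alternating forms, their imaginary parts and closedness -/

section TwoForm

open Module

variable {E : Type*} [NormedAddCommGroup E] [NormedSpace ℂ E]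

theorem alternating_swap (A : E [⋀^Fin 2]→L[ℂ] ℂ) (u v : E) : A ![u, v] = -A ![v, u] := by
  have h := A.toAlternatingMap.map_swap ![v, u] (i := 0) (j := 1) (by simp)
  have h2 : (![v, u] ∘ Equiv.swap (0 : Fin 2) 1) = ![u, v] := by
    ext i
    fin_cases i <;> simp
  rw [h2] at h
  exact h

/-- The bilinear form of an alternating form of degree two. -/
def alternatingBilin (A : E [⋀^Fin 2]→L[ℂ] ℂ) : LinearMap.BilinForm ℂ E :=
  LinearMap.mk₂ ℂ (fun u v => A ![u, v]) (fun u u' v => A.vecCons_add _ u u')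
    (fun c u v => A.vecCons_smul _ c u)
    -- Linearity in the second slot is transported from the first by antisymmetry.
    (fun u v v' => by
      rw [alternating_swap, alternating_swap A u v, alternating_swap A u v']
      exact (congrArg _ (A.vecCons_add _ v v')).trans (neg_add _ _))
    (fun c u v => by
      rw [alternating_swap, alternating_swap A u v]
      exact (congrArg _ (A.vecCons_smul _ c v)).trans (smul_neg _ _).symm)

theorem alternatingBilin_apply (A : E [⋀^Fin 2]→L[ℂ] ℂ) (u v : E) :
    alternatingBilin A u v = A ![u, v] := rfl

theorem alternatingBilin_isAlt (A : E [⋀^Fin 2]→L[ℂ] ℂ) : (alternatingBilin A).IsAlt := by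
  intro u
  rw [alternatingBilin_apply]
  exact A.map_eq_zero_of_eq _ (i := 0) (j := 1) (by simp) (by simp)

theorem LinearMap.BilinForm.IsAlt.nondegenerate_of_separating {𝕜 V : Type*} [Field 𝕜]
    [AddCommGroup V] [Module 𝕜 V] {η : LinearMap.BilinForm 𝕜 V} (halt : η.IsAlt)
    (h : ∀ u, (∀ v, η u v = 0) → u = 0) : η.Nondegenerate :=
  ⟨h, fun v hv => h v fun u => halt.isRefl u v (hv u)⟩

/-- The imaginary part of a complex bilinear form. -/
def imBilin (η : LinearMap.BilinForm ℂ E) : LinearMap.BilinForm ℝ E :=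
  LinearMap.mk₂ ℝ (fun u v => (η u v).im) (fun u u' v => by simp) (fun c u v => by
      rw [← Complex.coe_smul, map_smul, LinearMap.smul_apply]; simp)
    (fun u v v' => by simp) (fun c u v => by rw [← Complex.coe_smul, map_smul]; simp)

theorem imBilin_apply (η : LinearMap.BilinForm ℂ E) (u v : E) : imBilin η u v = (η u v).im := rfl

theorem imBilin_isAlt {η : LinearMap.BilinForm ℂ E} (halt : η.IsAlt) : (imBilin η).IsAlt := by
  intro u
  rw [imBilin_apply, halt.self_eq_zero u, Complex.zero_im]

theorem imBilin_nondegenerate {η : LinearMap.BilinForm ℂ E} (halt : η.IsAlt)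
    (hnd : η.Nondegenerate) : (imBilin η).Nondegenerate := by
  refine (imBilin_isAlt halt).nondegenerate_of_separating fun u hu => hnd.1 u fun v => ?_
  have h1 := hu v
  -- `Im η(u, iv) = Re η(u, v)`, so the imaginary part alone separates vectors.
  have h2 := hu (Complex.I • v)
  rw [imBilin_apply] at h1 h2
  rw [map_smul] at h2
  exact Complex.ext (by simpa using h2) h1

/-- Antisymmetry turns the alternating sum defining `extDeriv` into the cyclic sum used in the Moser
argument. -/
theorem extDeriv_two_form_cyclic {A : E → E [⋀^Fin 2]→L[ℂ] ℂ} {y : E}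
    (hA : DifferentiableAt ℂ A y) (h : extDeriv A y = 0) (u v w : E) :
    fderiv ℂ (fun x => A x ![v, w]) y u + fderiv ℂ (fun x => A x ![w, u]) y v +
      fderiv ℂ (fun x => A x ![u, v]) y w = 0 := by
  have h1 := extDeriv_apply hA ![u, v, w]
  rw [h, Fin.sum_univ_three] at h1
  have e0 : (0 : Fin 3).removeNth ![u, v, w] = ![v, w] := by
    ext i; fin_cases i <;> rfl
  have e1 : (1 : Fin 3).removeNth ![u, v, w] = ![u, w] := by
    ext i; fin_cases i <;> rfl
  have e2 : (2 : Fin 3).removeNth ![u, v, w] = ![u, v] := by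
    ext i; fin_cases i <;> rfl
  rw [e0, e1, e2] at h1
  have e3 : (fun x => A x ![w, u]) = fun x => -A x ![u, w] := by
    ext x
    exact alternating_swap _ _ _
  rw [e3, fderiv_fun_neg]
  simp at h1 ⊢
  linear_combination -h1

variable {Z : Type*} [TopologicalSpace Z] [ChartedSpace E Z]

/-- The bilinear form of a holomorphic symplectic form at a point. -/
def HolSymplecticForm.bilin (Ω : HolSymplecticForm E Z) (z : Z) : LinearMap.BilinForm ℂ E :=
  alternatingBilin (E := E) (Ω.form z)

theorem HolSymplecticForm.bilin_isAlt (Ω : HolSymplecticForm E Z) (z : Z) :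
    (Ω.bilin z).IsAlt := alternatingBilin_isAlt _

theorem HolSymplecticForm.bilin_nondegenerate (Ω : HolSymplecticForm E Z) (z : Z) :
    (Ω.bilin z).Nondegenerate :=
  (Ω.bilin_isAlt z).nondegenerate_of_separating (Ω.nondegenerate z)

theorem fderiv_clm_apply_apply {F G H : Type*} [NormedAddCommGroup F] [NormedSpace ℂ F]
    [NormedAddCommGroup G] [NormedSpace ℂ G] [NormedAddCommGroup H] [NormedSpace ℂ H]
    {B : E → F →L[ℂ] G →L[ℂ] H} {y : E} (hB : DifferentiableAt ℂ B y) (u : E) (v : F) (w : G) :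
    fderiv ℂ B y u v w = fderiv ℂ (fun x => B x v w) y u := by
  have h1 : HasFDerivAt (fun x => B x v)
      ((ContinuousLinearMap.apply ℂ (G →L[ℂ] H) v).comp (fderiv ℂ B y)) y :=
    HasFDerivAt.comp (g := ContinuousLinearMap.apply ℂ (G →L[ℂ] H) v) (f := B) y
      (ContinuousLinearMap.apply ℂ (G →L[ℂ] H) v).hasFDerivAt hB.hasFDerivAt
  have h2 : HasFDerivAt (fun x => B x v w) ((ContinuousLinearMap.apply ℂ H w).comp
      ((ContinuousLinearMap.apply ℂ (G →L[ℂ] H) v).comp (fderiv ℂ B y))) y :=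
    HasFDerivAt.comp (g := ContinuousLinearMap.apply ℂ H w) (f := fun x => B x v) y
      (ContinuousLinearMap.apply ℂ H w).hasFDerivAt h1
  rw [h2.fderiv]
  rfl

end TwoForm

/-! ### Darboux charts on a holomorphic symplectic manifold -/

section Darboux

open Module

variable {E : Type*} [NormedAddCommGroup E] [NormedSpace ℂ E] [FiniteDimensional ℂ E]

theorem contDiffOn_toContinuousBilinearMap {A : E → E [⋀^Fin 2]→L[ℂ] ℂ} {n : WithTop ℕ∞}
    {s : Set E} (hA : ContDiffOn ℂ n A s) :
    ContDiffOn ℂ n (fun y => (alternatingBilin (A y)).toContinuousBilinearMap) s := by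
  rw [contDiffOn_clm_apply]
  intro u
  rw [contDiffOn_clm_apply]
  intro v
  exact (ContinuousAlternatingMap.apply ℂ E ℂ ![u, v]).contDiff.comp_contDiffOn hA

variable {Z : Type*} [TopologicalSpace Z] [ChartedSpace E Z]

/-- A holomorphic symplectic form is constant in suitable holomorphic coordinates. -/
theorem HolSymplecticForm.exists_darboux_chart [IsManifold 𝓘(ℂ, E) ω Z]
    (Ω : HolSymplecticForm E Z) (z : Z) :
    ∃ (ψ : OpenPartialHomeomorph Z E) (η : LinearMap.BilinForm ℂ E), IsSmoothChart ℂ ω ψ ∧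
      z ∈ ψ.source ∧ ψ z = 0 ∧ η.IsAlt ∧ η.Nondegenerate ∧ ∀ v ∈ ψ.target, ∀ u w : E,
        Ω.bilin (ψ.symm v) (mfderiv 𝓘(ℂ, E) 𝓘(ℂ, E) ψ.symm v u)
          (mfderiv 𝓘(ℂ, E) 𝓘(ℂ, E) ψ.symm v w) = η u w := by
  have hn : (ω : WithTop ℕ∞) ≠ 0 := by simp
  let ζ := chartAt E z
  have hζ : IsSmoothChart ℂ ω ζ := isSmoothChart_chartAt z
  have hzζ : z ∈ ζ.source := mem_chart_source E z
  -- The form in the preferred chart, translated so that `z` becomes the origin.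
  let A : E → E [⋀^Fin 2]→L[ℂ] ℂ := fun y => formInChart Ω.form z (y + ζ z)
  have hAT : ∀ y, y + ζ z ∈ ζ.target → y + ζ z ∈ (extChartAt 𝓘(ℂ, E) z).target := by
    intro y hy
    rw [extChartAt_target]
    exact ⟨hy, mem_range_self _⟩
  let T : Set E := (fun y => y + ζ z) ⁻¹' ζ.target
  have hT : IsOpen T := ζ.open_target.preimage (by fun_prop)
  have h0T : (0 : E) ∈ T := by
    change 0 + ζ z ∈ ζ.target
    rw [zero_add]
    exact ζ.map_source hzζ
  have hA : ContDiffOn ℂ ω A T :=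
    (Ω.holomorphic z).comp (contDiff_id.add contDiff_const).contDiffOn fun y hy => hAT y hy
  have hAc : ∀ y ∈ T, extDeriv A y = 0 := by
    intro y hy
    have h1 : fderiv ℂ A y = fderiv ℂ (formInChart Ω.form z) (y + ζ z) :=
      fderiv_comp_add_right _
    rw [extDeriv, h1]
    exact Ω.closed z _ (hAT y hy)
  have hAval : ∀ y ∈ T, ∀ u w : E, A y ![u, w] = Ω.bilin (ζ.symm (y + ζ z))
      (mfderiv 𝓘(ℂ, E) 𝓘(ℂ, E) ζ.symm (y + ζ z) u)
      (mfderiv 𝓘(ℂ, E) 𝓘(ℂ, E) ζ.symm (y + ζ z) w) := by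
    intro y hy u w
    change Ω.form _ _ = Ω.form _ _
    refine congrArg _ (funext fun i => ?_)
    fin_cases i <;> rfl
  let B : E → E →L[ℂ] E →L[ℂ] ℂ := fun y => (alternatingBilin (A y)).toContinuousBilinearMap
  have hB : ContDiffOn ℂ ω B T := contDiffOn_toContinuousBilinearMap hA
  have hBnd : ∀ u, (∀ v, B 0 u v = 0) → u = 0 := by
    intro u hu
    have h1 : mfderiv 𝓘(ℂ, E) 𝓘(ℂ, E) ζ.symm (0 + ζ z) u = 0 := by
      refine (Ω.bilin_nondegenerate (ζ.symm (0 + ζ z))).1 _ fun v => ?_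
      have h2 := hζ.mfderiv_symm_mfderiv hn (ζ.map_target h0T) v
      rw [ζ.right_inv h0T] at h2
      rw [← h2]
      exact (hAval 0 h0T u _).symm.trans (hu _)
    have h3 := hζ.mfderiv_mfderiv_symm hn h0T u
    rw [h1] at h3
    exact h3.symm.trans (map_zero _)
  have hBcl : ∀ᶠ y in 𝓝 0, ∀ u v w,
      fderiv ℂ B y u v w + fderiv ℂ B y v w u + fderiv ℂ B y w u v = 0 := by
    filter_upwards [hT.mem_nhds h0T] with y hy u v w
    have hd : DifferentiableAt ℂ B y := (hB.contDiffAt (hT.mem_nhds hy)).differentiableAt hn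
    rw [fderiv_clm_apply_apply hd, fderiv_clm_apply_apply hd, fderiv_clm_apply_apply hd]
    exact extDeriv_two_form_cyclic
      ((hA.contDiffAt (hT.mem_nhds hy)).differentiableAt hn) (hAc y hy) u v w
  obtain ⟨φ, hφ, hφ0, hφB⟩ := exists_darboux
    ((hB.contDiffAt (hT.mem_nhds h0T)).of_le le_top)
    (fun y u v => alternating_swap (A y) u v) hBcl hBnd
  -- A map pulling `B` back to the nondegenerate form `B 0` is immersive, so `φ` is a local
  -- biholomorphism.
  have hinj : ∀ u, fderiv ℂ φ 0 u = 0 → u = 0 := by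
    intro u hu
    refine hBnd u fun v => ?_
    rw [← hφB.self_of_nhds u v, hu, map_zero, zero_apply]
  have hOφ : ∀ᶠ x in 𝓝 0, φ x ∈ T ∧
      ∀ u v, B (φ x) (fderiv ℂ φ x u) (fderiv ℂ φ x v) = B 0 u v :=
    (hφ.continuousAt.eventually (by rw [hφ0]; exact hT.mem_nhds h0T)).and hφB
  obtain ⟨Φ, h0Φ, hΦO, hΦ, hΦs, hΦt⟩ :=
    exists_openPartialHomeomorph_of_injective rfl hφ hinj hOφ
  let τ : OpenPartialHomeomorph E E := (Homeomorph.addRight (ζ z)).symm.toOpenPartialHomeomorph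
  let ψ : OpenPartialHomeomorph Z E := (ζ.trans τ).trans Φ.symm
  have hψsymm : ∀ v, ψ.symm v = ζ.symm (Φ v + ζ z) := fun v => rfl
  have hψ0 : Φ.symm (ζ z + -ζ z) = 0 := by
    have h1 := Φ.left_inv h0Φ
    rw [add_neg_cancel]
    rwa [hΦ, hφ0] at h1
  have hsmooth : ∀ v ∈ ψ.target, ContMDiffAt 𝓘(ℂ, E) 𝓘(ℂ, E) ω Φ v := fun v hv =>
    ((hΦs v hv.1).congr_of_eventuallyEq (Eventually.of_forall hΦ)).contMDiffAt
  have hΦT : ∀ v ∈ ψ.target, Φ v ∈ T := fun v hv => by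
    rw [hΦ]
    exact (hΦO hv.1).1
  refine ⟨ψ, alternatingBilin (A 0), ⟨?_, ?_⟩, ?_, hψ0, alternatingBilin_isAlt _,
    (alternatingBilin_isAlt _).nondegenerate_of_separating hBnd, ?_⟩
  · intro x hx
    have h1 := ContMDiffAt.comp x
      ((contDiff_id.add contDiff_const : ContDiff ℂ ω fun y => y + -ζ z).contDiffAt.contMDiffAt)
      (hζ.contMDiffAt hx.1.1)
    exact (ContMDiffAt.comp x (hΦt _ hx.2).contMDiffAt h1).contMDiffWithinAt
  · intro v hv
    have h1 := ContMDiffAt.comp v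
      ((contDiff_id.add contDiff_const : ContDiff ℂ ω fun y => y + ζ z).contDiffAt.contMDiffAt)
      (hsmooth v hv)
    exact (ContMDiffAt.comp v (hζ.contMDiffAt_symm (hΦT v hv)) h1).contMDiffWithinAt
  · refine ⟨⟨hzζ, mem_univ _⟩, ?_⟩
    change ζ z + -ζ z ∈ Φ.target
    have h1 := Φ.map_source h0Φ
    rw [add_neg_cancel]
    rwa [hΦ, hφ0] at h1
  · intro v hv
    have h1 : HasFDerivAt (fun x => Φ x + ζ z) (fderiv ℂ φ v) v :=
      (((hΦs v hv.1).differentiableAt hn).hasFDerivAt.congr_of_eventuallyEq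
        (Eventually.of_forall hΦ)).add_const _
    have h2 := ((hζ.contMDiffAt_symm (hΦT v hv)).mdifferentiableAt hn).hasMFDerivAt
    have h3 : ∀ u : E, mfderiv 𝓘(ℂ, E) 𝓘(ℂ, E) ψ.symm v u =
        mfderiv 𝓘(ℂ, E) 𝓘(ℂ, E) ζ.symm (Φ v + ζ z) (fderiv ℂ φ v u) := by
      intro u
      have h4 := HasMFDerivAt.comp v h2 (hasMFDerivAt_iff_hasFDerivAt.2 h1)
      exact congrArg (fun L : E →L[ℂ] E => L u) h4.mfderiv
    intro u w
    refine (congrArg₂ (fun p q : E => Ω.bilin (ψ.symm v) p q) (h3 u) (h3 w)).trans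
      ((hAval _ (hΦT v hv) _ _).symm.trans ?_)
    rw [hΦ]
    exact (hΦO hv.1).2 u w

end Darboux

/-! ### Lagrangian tangent spaces from isotropy and dimension -/

section Lagrangian

open Module

variable {𝕜 : Type*} [NontriviallyNormedField 𝕜] {n : WithTop ℕ∞}
  {Ep Xp Em Xm EZ Z : Type*}
  [NormedAddCommGroup Ep] [NormedSpace 𝕜 Ep] [TopologicalSpace Xp] [ChartedSpace Ep Xp]
  [NormedAddCommGroup Em] [NormedSpace 𝕜 Em] [TopologicalSpace Xm] [ChartedSpace Em Xm]
  [NormedAddCommGroup EZ] [NormedSpace 𝕜 EZ] [TopologicalSpace Z] [ChartedSpace EZ Z]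

theorem IsSmoothChart.mfderiv_bijective {ψ : OpenPartialHomeomorph Z EZ}
    (hψ : IsSmoothChart 𝕜 n ψ) (hn : n ≠ 0) {x : Z} (hx : x ∈ ψ.source) :
    Function.Bijective (mfderiv 𝓘(𝕜, EZ) 𝓘(𝕜, EZ) ψ x) := by
  refine Function.bijective_iff_has_inverse.2 ⟨mfderiv 𝓘(𝕜, EZ) 𝓘(𝕜, EZ) ψ.symm (ψ x),
    hψ.mfderiv_symm_mfderiv hn hx, fun u => ?_⟩
  have h := hψ.mfderiv_mfderiv_symm hn (ψ.map_source hx) u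
  rwa [ψ.left_inv hx] at h

theorem IsSmoothChart.mfderiv_symm_bijective {ψ : OpenPartialHomeomorph Z EZ}
    (hψ : IsSmoothChart 𝕜 n ψ) (hn : n ≠ 0) {v : EZ} (hv : v ∈ ψ.target) :
    Function.Bijective (mfderiv 𝓘(𝕜, EZ) 𝓘(𝕜, EZ) ψ.symm v) := by
  refine Function.bijective_iff_has_inverse.2 ⟨mfderiv 𝓘(𝕜, EZ) 𝓘(𝕜, EZ) ψ (ψ.symm v),
    hψ.mfderiv_mfderiv_symm hn hv, fun u => ?_⟩
  have h := hψ.mfderiv_symm_mfderiv hn (ψ.map_target hv) u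
  rwa [ψ.right_inv hv] at h

theorem mfderiv_section_injective {πm : Z → Xm} {U : Set Xm} {b : Xm → Z}
    (hU : IsOpen U) (hb : ContMDiffOn 𝓘(𝕜, Em) 𝓘(𝕜, EZ) n b U)
    (hs : ∀ x ∈ U, πm (b x) = x) (hn : n ≠ 0)
    (hπm : ContMDiff 𝓘(𝕜, EZ) 𝓘(𝕜, Em) n πm) {x : Xm} (hx : x ∈ U) :
    Function.Injective (mfderiv 𝓘(𝕜, Em) 𝓘(𝕜, EZ) b x) := by
  have h1 := (((hb _ hx).contMDiffAt (hU.mem_nhds hx)).mdifferentiableAt hn).hasMFDerivAt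
  have h2 := (hπm.mdifferentiableAt hn (x := b x)).hasMFDerivAt
  have h3 := HasMFDerivAt.comp x h2 h1
  have h4 : HasMFDerivAt 𝓘(𝕜, Em) 𝓘(𝕜, Em) (πm ∘ b) x (ContinuousLinearMap.id 𝕜 _) :=
    (hasMFDerivAt_id x).congr_of_eventuallyEq (by
      filter_upwards [hU.mem_nhds hx] with y hy using hs y hy)
  have h5 := hasMFDerivAt_unique h3 h4
  intro u u' huu
  have h6 : ∀ w : Em, mfderiv 𝓘(𝕜, EZ) 𝓘(𝕜, Em) πm (b x) (mfderiv 𝓘(𝕜, Em) 𝓘(𝕜, EZ) b x w) = w :=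
    fun w => congrArg (fun L : Em →L[𝕜] Em => L w) h5
  exact (h6 u).symm.trans ((congrArg _ huu).trans (h6 u'))

/-- The derivative of a section is injective, so its isotropic range has half dimension and is its
own orthogonal. -/
theorem IsIsotropicBisectionOn.mem_range [FiniteDimensional 𝕜 EZ]
    {G : Z → LinearMap.BilinForm 𝕜 EZ}
    {πp : Z → Xp} {πm : Z → Xm} {U : Set Xm} {b : Xm → Z}
    (hb : IsIsotropicBisectionOn 𝕜 n Ep Em G πp πm U b) (hn : n ≠ 0)
    (hπm : ContMDiff 𝓘(𝕜, EZ) 𝓘(𝕜, Em) n πm) (hnd : ∀ z, (G z).Nondegenerate)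
    (hdim : 2 * finrank 𝕜 Em = finrank 𝕜 EZ) {x : Xm} (hx : x ∈ U) {v : EZ}
    (hv : ∀ u : Em, G (b x) (mfderiv 𝓘(𝕜, Em) 𝓘(𝕜, EZ) b x u) v = 0) :
    v ∈ range (mfderiv 𝓘(𝕜, Em) 𝓘(𝕜, EZ) b x) := by
  let L : Em →L[𝕜] EZ := mfderiv 𝓘(𝕜, Em) 𝓘(𝕜, EZ) b x
  have h := mem_of_isotropic_of_finrank (hnd (b x)) (L := LinearMap.range (L : Em →ₗ[𝕜] EZ))
    (by
      rintro _ ⟨u, rfl⟩ _ ⟨w, rfl⟩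
      exact hb.isotropic x hx u w)
    (by rw [LinearMap.finrank_range_of_inj (f := (L : Em →ₗ[𝕜] EZ))
          (mfderiv_section_injective hb.isOpen hb.smooth hb.section_m hn hπm hx), hdim])
    (v := v) (by
      rintro _ ⟨u, rfl⟩
      exact hv u)
  exact h

end Lagrangian

/-! ### Brane and holomorphic Lagrangian bisections as isotropic bisections -/

namespace HolMoritaEquiv

open Module

variable {Ep Xp Em Xm EZ Z : Type*}
  [NormedAddCommGroup Ep] [NormedSpace ℂ Ep] [TopologicalSpace Xp] [ChartedSpace Ep Xp]
  [NormedAddCommGroup Em] [NormedSpace ℂ Em] [TopologicalSpace Xm] [ChartedSpace Em Xm]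
  [NormedAddCommGroup EZ] [NormedSpace ℂ EZ] [TopologicalSpace Z] [ChartedSpace EZ Z]
  {σp : HolPoisson Ep Xp} {σm : HolPoisson Em Xm} {M : HolMoritaEquiv σp σm EZ Z}
  {U : Set Xm} {b : Xm → Z}

theorem IsBraneBisectionOn.isIsotropic (hb : M.IsBraneBisectionOn U b) :
    IsIsotropicBisectionOn ℝ ∞ Ep Em (fun z => imBilin (M.Ω.bilin z)) M.πp M.πm U b where
  isOpen := hb.isOpen
  smooth := hb.smooth
  section_m := hb.section_m
  isOpen_image := hb.isOpen_image
  section_p := hb.section_p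
  isotropic x hx u w := (hb.lagrangian x hx _).2 ⟨w, rfl⟩ u

/-- Vanishing of `Ω` implies that of `Im Ω`, and the real and complex derivatives agree. So both
ends of the isotopy are objects of the same kind. -/
theorem IsHolLagrangianBisectionOn.isIsotropic_real (hb : M.IsHolLagrangianBisectionOn U b) :
    IsIsotropicBisectionOn ℝ ∞ Ep Em (fun z => imBilin (M.Ω.bilin z)) M.πp M.πm U b where
  isOpen := hb.isOpen
  smooth := hb.holomorphic.real_of_complex
  section_m := hb.section_m
  isOpen_image := hb.isOpen_image
  section_p := by
    obtain ⟨g, hg, hgb⟩ := hb.section_p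
    exact ⟨g, hg.real_of_complex, hgb⟩
  isotropic x hx u w := by
    have hd : MDifferentiableAt 𝓘(ℂ, Em) 𝓘(ℂ, EZ) b x :=
      ((hb.holomorphic x hx).contMDiffAt (hb.isOpen.mem_nhds hx)).mdifferentiableAt (by simp)
    rw [mfderiv_real_eq_complex hd, mfderiv_real_eq_complex hd]
    have h := (hb.lagrangian x hx _).2 ⟨w, rfl⟩ u
    exact (congrArg Complex.im h).trans Complex.zero_im

variable [FiniteDimensional ℂ EZ]

theorem isBraneBisectionOn_of_isIsotropic
    (hb : IsIsotropicBisectionOn ℝ ∞ Ep Em (fun z => imBilin (M.Ω.bilin z)) M.πp M.πm U b)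
    (hdim : 2 * finrank ℝ Em = finrank ℝ EZ) : M.IsBraneBisectionOn U b where
  isOpen := hb.isOpen
  smooth := hb.smooth
  section_m := hb.section_m
  isOpen_image := hb.isOpen_image
  section_p := hb.section_p
  lagrangian x hx v := by
    refine ⟨fun h => ?_, ?_⟩
    · exact hb.mem_range (by simp) M.submersion_m.holomorphic.real_of_complex
        (fun z => imBilin_nondegenerate (M.Ω.bilin_isAlt z) (M.Ω.bilin_nondegenerate z)) hdim hx h
    · rintro ⟨w, rfl⟩ u
      exact hb.isotropic x hx u w

theorem isHolLagrangianBisectionOn_of_isIsotropic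
    (hb : IsIsotropicBisectionOn ℂ ω Ep Em (fun z => M.Ω.bilin z) M.πp M.πm U b)
    (hdim : 2 * finrank ℂ Em = finrank ℂ EZ) : M.IsHolLagrangianBisectionOn U b where
  isOpen := hb.isOpen
  holomorphic := hb.smooth
  section_m := hb.section_m
  isOpen_image := hb.isOpen_image
  section_p := hb.section_p
  lagrangian x hx v := by
    refine ⟨fun h => ?_, ?_⟩
    · exact hb.mem_range (by simp) M.submersion_m.holomorphic
        (fun z => M.Ω.bilin_nondegenerate z) hdim hx h
    · rintro ⟨w, rfl⟩ u
      exact hb.isotropic x hx u w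

/-- The range of `db` has the real dimension of `Em` and equals its own orthogonal for the
nondegenerate form `Im Ω`; real dimensions are twice the complex ones. -/
theorem IsBraneBisectionOn.two_mul_finrank (hb : M.IsBraneBisectionOn U b) {x : Xm} (hx : x ∈ U) :
    2 * finrank ℂ Em = finrank ℂ EZ := by
  let L : Em →L[ℝ] EZ := mfderiv 𝓘(ℝ, Em) 𝓘(ℝ, EZ) b x
  let R := LinearMap.range (L : Em →ₗ[ℝ] EZ)
  have hR : finrank ℝ R = finrank ℝ Em :=
    LinearMap.finrank_range_of_inj (f := (L : Em →ₗ[ℝ] EZ)) (mfderiv_section_injective hb.isOpen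
      hb.smooth hb.section_m (by simp) M.submersion_m.holomorphic.real_of_complex hx)
  have hnd := imBilin_nondegenerate (M.Ω.bilin_isAlt (b x)) (M.Ω.bilin_nondegenerate (b x))
  have horth : (imBilin (M.Ω.bilin (b x))).orthogonal R = R := by
    ext v
    refine ⟨fun h => (hb.lagrangian x hx v).1 fun u => h _ ⟨u, rfl⟩, ?_⟩
    rintro ⟨w, rfl⟩ _ ⟨u, rfl⟩
    exact (hb.lagrangian x hx _).2 ⟨w, rfl⟩ u
  have h1 := LinearMap.BilinForm.finrank_orthogonal hnd R
  have h2 := Submodule.finrank_le R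
  rw [horth] at h1
  have h3 := finrank_real_of_complex Em
  have h4 := finrank_real_of_complex EZ
  omega

variable [IsManifold 𝓘(ℂ, EZ) ω Z] [IsManifold 𝓘(ℂ, Em) ω Xm] [IsManifold 𝓘(ℂ, Ep) ω Xp]

/-- Near any point, Darboux coordinates, together with the properties of the derivatives of the two
projections in coordinates. -/
theorem exists_darboux_coordinates (M : HolMoritaEquiv σp σm EZ Z) (z : Z) :
    ∃ (ψ : OpenPartialHomeomorph Z EZ) (η : LinearMap.BilinForm ℂ EZ) (pm' : EZ →L[ℂ] Em)
      (pp' : EZ →L[ℂ] Ep), IsSmoothChart ℂ ω ψ ∧ z ∈ ψ.source ∧ ψ z = 0 ∧ η.IsAlt ∧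
      η.Nondegenerate ∧ (∀ v ∈ ψ.target, ∀ u w : EZ,
        M.Ω.bilin (ψ.symm v) (mfderiv 𝓘(ℂ, EZ) 𝓘(ℂ, EZ) ψ.symm v u)
          (mfderiv 𝓘(ℂ, EZ) 𝓘(ℂ, EZ) ψ.symm v w) = η u w) ∧
      HasFDerivAt (fun v => chartAt Em (M.πm z) (M.πm (ψ.symm v))) pm' 0 ∧
      HasFDerivAt (fun v => chartAt Ep (M.πp z) (M.πp (ψ.symm v))) pp' 0 ∧
      Function.Surjective pm' ∧ Function.Surjective pp' ∧
      (∀ u, pp' u = 0 ↔ ∀ v, pm' v = 0 → η u v = 0) := by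
  have hn : (ω : WithTop ℕ∞) ≠ 0 := by simp
  obtain ⟨ψ, η, hψ, hz, hψz, halt, hnd, hG⟩ := M.Ω.exists_darboux_chart z
  have h0 : (0 : EZ) ∈ ψ.target := hψz ▸ ψ.map_source hz
  have hs0 : ψ.symm 0 = z := by rw [← hψz, ψ.left_inv hz]
  have hξm : IsSmoothChart ℂ ω (chartAt Em (M.πm z)) := isSmoothChart_chartAt _
  have hξp : IsSmoothChart ℂ ω (chartAt Ep (M.πp z)) := isSmoothChart_chartAt _
  have hm := hasFDerivAt_in_charts (p := M.πm) hψ hξm hn h0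
    (by rw [hs0]; exact mem_chart_source _ _) (M.submersion_m.holomorphic.mdifferentiableAt hn)
  have hp := hasFDerivAt_in_charts (p := M.πp) hψ hξp hn h0
    (by rw [hs0]; exact mem_chart_source _ _) (M.submersion_p.holomorphic.mdifferentiableAt hn)
  obtain ⟨hψi, hψs⟩ := hψ.mfderiv_symm_bijective hn h0
  obtain ⟨hmi, hms⟩ := hξm.mfderiv_bijective hn (x := M.πm (ψ.symm 0))
    (by rw [hs0]; exact mem_chart_source _ _)
  obtain ⟨hpi, hps⟩ := hξp.mfderiv_bijective hn (x := M.πp (ψ.symm 0))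
    (by rw [hs0]; exact mem_chart_source _ _)
  refine ⟨ψ, η, _, _, hψ, hz, hψz, halt, hnd, hG, hm, hp,
    hms.comp ((M.submersion_m.submersion _).comp hψs),
    hps.comp ((M.submersion_p.submersion _).comp hψs), fun u => ?_⟩
  have hm0 : ∀ v : EZ, mfderiv 𝓘(ℂ, Em) 𝓘(ℂ, Em) (chartAt Em (M.πm z)) (M.πm (ψ.symm 0))
      (mfderiv 𝓘(ℂ, EZ) 𝓘(ℂ, Em) M.πm (ψ.symm 0) (mfderiv 𝓘(ℂ, EZ) 𝓘(ℂ, EZ) ψ.symm 0 v)) = 0 ↔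
      mfderiv 𝓘(ℂ, EZ) 𝓘(ℂ, Em) M.πm (ψ.symm 0) (mfderiv 𝓘(ℂ, EZ) 𝓘(ℂ, EZ) ψ.symm 0 v) = 0 :=
    fun v => map_eq_zero_iff _ hmi
  have hp0 : mfderiv 𝓘(ℂ, Ep) 𝓘(ℂ, Ep) (chartAt Ep (M.πp z)) (M.πp (ψ.symm 0))
      (mfderiv 𝓘(ℂ, EZ) 𝓘(ℂ, Ep) M.πp (ψ.symm 0) (mfderiv 𝓘(ℂ, EZ) 𝓘(ℂ, EZ) ψ.symm 0 u)) = 0 ↔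
      mfderiv 𝓘(ℂ, EZ) 𝓘(ℂ, Ep) M.πp (ψ.symm 0) (mfderiv 𝓘(ℂ, EZ) 𝓘(ℂ, EZ) ψ.symm 0 u) = 0 :=
    map_eq_zero_iff _ hpi
  -- Chart derivatives are invertible and `ψ` carries `Ω` to `η`, so orthogonality of the kernels
  -- passes to coordinates.
  refine hp0.trans ((M.orthogonal _ _).trans ⟨fun h v hv => ?_, fun h w hw => ?_⟩)
  · rw [← hG 0 h0]
    exact h _ ((hm0 v).1 hv)
  · obtain ⟨v, rfl⟩ := hψs w
    exact (hG 0 h0 u v).trans (h v ((hm0 v).2 hw))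

end HolMoritaEquiv

/-! ### Dimension counts for the kernels -/

section LinearAlgebra

open Module

/-- `ker pp` is the orthogonal of `ker pm`, so its dimension is the rank of `pm`. -/
theorem finrank_add_finrank_of_orthogonal {V W W' : Type*} [AddCommGroup V] [Module ℂ V]
    [FiniteDimensional ℂ V] [AddCommGroup W] [Module ℂ W] [AddCommGroup W'] [Module ℂ W']
    {η : LinearMap.BilinForm ℂ V} (halt : η.IsAlt) (hnd : η.Nondegenerate)
    {pm : V →ₗ[ℂ] W} {pp : V →ₗ[ℂ] W'} (hm : Function.Surjective pm)
    (hp : Function.Surjective pp) (h : ∀ u, pp u = 0 ↔ ∀ v, pm v = 0 → η u v = 0) :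
    finrank ℂ W + finrank ℂ W' = finrank ℂ V := by
  have h1 : LinearMap.ker pp = η.orthogonal (LinearMap.ker pm) := by
    ext u
    refine (h u).trans ⟨fun hu v hv => halt.isRefl u v (hu v hv),
      fun hu v hv => halt.isRefl v u (hu v hv)⟩
  have h2 := LinearMap.BilinForm.finrank_orthogonal hnd (LinearMap.ker pm)
  have h3 := LinearMap.finrank_range_add_finrank_ker pm
  have h4 := LinearMap.finrank_range_add_finrank_ker pp
  rw [LinearMap.range_eq_top.2 hm, finrank_top] at h3
  rw [LinearMap.range_eq_top.2 hp, finrank_top, h1] at h4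
  omega

theorem finrank_ker_add_of_surjective {𝕜 V W : Type*} [Field 𝕜] [AddCommGroup V] [Module 𝕜 V]
    [FiniteDimensional 𝕜 V] [AddCommGroup W] [Module 𝕜 W] {p : V →ₗ[𝕜] W}
    (hp : Function.Surjective p) : finrank 𝕜 W + finrank 𝕜 (LinearMap.ker p) = finrank 𝕜 V := by
  have h := LinearMap.finrank_range_add_finrank_ker p
  rwa [LinearMap.range_eq_top.2 hp, finrank_top] at h

end LinearAlgebra

/-! ### Existence of Lagrangian bisections and of the local isotopy -/

namespace HolMoritaEquiv

open Module

variable {Ep Xp Em Xm EZ Z : Type*}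
  [NormedAddCommGroup Ep] [NormedSpace ℂ Ep] [TopologicalSpace Xp] [ChartedSpace Ep Xp]
  [NormedAddCommGroup Em] [NormedSpace ℂ Em] [TopologicalSpace Xm] [ChartedSpace Em Xm]
  [NormedAddCommGroup EZ] [NormedSpace ℂ EZ] [TopologicalSpace Z] [ChartedSpace EZ Z]
  {σp : HolPoisson Ep Xp} {σm : HolPoisson Em Xm} {M : HolMoritaEquiv σp σm EZ Z}

theorem isOpen_domain_in_charts (M : HolMoritaEquiv σp σm EZ Z) (ψ : OpenPartialHomeomorph Z EZ)
    (ξm : OpenPartialHomeomorph Xm Em) (ξp : OpenPartialHomeomorph Xp Ep) :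
    IsOpen {v | v ∈ ψ.target ∧ M.πm (ψ.symm v) ∈ ξm.source ∧ M.πp (ψ.symm v) ∈ ξp.source} :=
  ψ.symm.isOpen_inter_preimage
    ((ξm.open_source.preimage M.submersion_m.holomorphic.continuous).inter
      (ξp.open_source.preimage M.submersion_p.holomorphic.continuous))

variable [FiniteDimensional ℂ EZ] [FiniteDimensional ℂ Ep] [FiniteDimensional ℂ Em]
  [IsManifold 𝓘(ℂ, EZ) ω Z] [IsManifold 𝓘(ℂ, Em) ω Xm] [IsManifold 𝓘(ℂ, Ep) ω Xp]

/-- There are holomorphic Lagrangian bisections through any point. -/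
theorem exists_isHolLagrangianBisectionOn (M : HolMoritaEquiv σp σm EZ Z) (z : Z)
    (hdim : 2 * finrank ℂ Em = finrank ℂ EZ) :
    ∃ (U' : Set Xm) (Λ : Xm → Z), M.IsHolLagrangianBisectionOn U' Λ ∧ z ∈ Λ '' U' := by
  have hn : (ω : WithTop ℕ∞) ≠ 0 := by simp
  obtain ⟨ψ, η, pm', pp', hψ, hz, hψz, halt, hnd, hG, hm', hp', hms, hps, hK⟩ :=
    M.exists_darboux_coordinates z
  have hsum := finrank_add_finrank_of_orthogonal halt hnd (pm := (pm' : EZ →ₗ[ℂ] Em))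
    (pp := (pp' : EZ →ₗ[ℂ] Ep)) hms hps hK
  have hk1 := finrank_ker_add_of_surjective (p := (pp' : EZ →ₗ[ℂ] Ep)) hps
  have hk2 := finrank_ker_add_of_surjective (p := (pm' : EZ →ₗ[ℂ] Em)) hms
  -- In Darboux coordinates a complex linear Lagrangian plane transverse to both kernels already is
  -- the desired bisection.
  obtain ⟨N, hN⟩ := exists_isTransverseLagrangian halt hnd
    (K₁ := LinearMap.ker (pp' : EZ →ₗ[ℂ] Ep)) (K₂ := LinearMap.ker (pm' : EZ →ₗ[ℂ] Em))
    (fun u hu v hv => (hK u).1 hu v hv) (by omega) (by omega)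
  have hNdim := hN.finrank_eq
  have h0 : (0 : EZ) ∈ ψ.target := hψz ▸ ψ.map_source hz
  have hs0 : ψ.symm 0 = z := by rw [← hψz, ψ.left_inv hz]
  let ξm := chartAt Em (M.πm z)
  let ξp := chartAt Ep (M.πp z)
  have hξm : IsSmoothChart ℂ ω ξm := isSmoothChart_chartAt _
  have hξp : IsSmoothChart ℂ ω ξp := isSmoothChart_chartAt _
  have hzm : M.πm z ∈ ξm.source := mem_chart_source _ _
  have hzp : M.πp z ∈ ξp.source := mem_chart_source _ _
  have hm0 : ContDiffAt ℂ ω (fun v => ξm (M.πm (ψ.symm v))) 0 := by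
    have h1 := ContMDiffAt.comp (0 : EZ) (M.submersion_m.holomorphic (ψ.symm 0))
      (hψ.contMDiffAt_symm h0)
    exact (ContMDiffAt.comp (0 : EZ) (hξm.contMDiffAt (by simpa [hs0] using hzm)) h1).contDiffAt
  have hp0 : ContDiffAt ℂ ω (fun v => ξp (M.πp (ψ.symm v))) 0 := by
    have h1 := ContMDiffAt.comp (0 : EZ) (M.submersion_p.holomorphic (ψ.symm 0))
      (hψ.contMDiffAt_symm h0)
    exact (ContMDiffAt.comp (0 : EZ) (hξp.contMDiffAt (by simpa [hs0] using hzp)) h1).contDiffAt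
  obtain ⟨S, β, κ, hS, hmS, hβ0, hβ⟩ := exists_holomorphic_section
    (M.isOpen_domain_in_charts ψ ξm ξp) ⟨h0, by rwa [hs0], by rwa [hs0]⟩ hm0 hp0 (N := N)
    (fun u hu h => Submodule.disjoint_def.1 hN.disjoint₂ u hu (by rwa [hm'.fderiv] at h))
    (fun u hu h => Submodule.disjoint_def.1 hN.disjoint₁ u hu (by rwa [hp'.fderiv] at h))
    (by omega) (by omega)
  have hSt : S ⊆ ξm.target := fun y hy => by
    rw [← (hβ y hy).2.2.1]
    exact ξm.map_source (hβ y hy).2.1.2.1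
  have hb := isIsotropicBisectionOn_of_charts (G := fun z => M.Ω.bilin z) (πp := M.πp)
    (πm := M.πm) hn hψ hξm hξp hG hS hSt (β := β) (κ := κ)
    (fun y hy => (hβ y hy).1) (fun y hy => (hβ y hy).2.1) (fun y hy => (hβ y hy).2.2.1)
    (fun y hy u w => hN.isotropic _ ((hβ y hy).2.2.2.1 u) _ ((hβ y hy).2.2.2.1 w))
    (fun y hy => (hβ y hy).2.2.2.2.1) (fun y hy => (hβ y hy).2.2.2.2.2.1)
    (fun y hy => (hβ y hy).2.2.2.2.2.2)
  refine ⟨_, _, isHolLagrangianBisectionOn_of_isIsotropic hb hdim, M.πm z, ⟨hzm, ?_⟩, ?_⟩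
  · change ξm (M.πm z) ∈ S
    rwa [hs0] at hmS
  · change ψ.symm (β (ξm (M.πm z))) = z
    rw [hs0] at hβ0
    rw [hβ0, hs0]

/-- Two isotropic bisections through a point are locally joined by a smooth family of brane
bisections through this point. -/
theorem exists_isotopy_of_isIsotropic (M : HolMoritaEquiv σp σm EZ Z) {U₀ U₁ : Set Xm}
    {b₀ b₁ : Xm → Z}
    (hb₀ : IsIsotropicBisectionOn ℝ ∞ Ep Em (fun z => imBilin (M.Ω.bilin z)) M.πp M.πm U₀ b₀)
    (hb₁ : IsIsotropicBisectionOn ℝ ∞ Ep Em (fun z => imBilin (M.Ω.bilin z)) M.πp M.πm U₁ b₁)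
    (hdim : 2 * finrank ℂ Em = finrank ℂ EZ) {z : Z} (hz₀ : z ∈ b₀ '' U₀) (hz₁ : z ∈ b₁ '' U₁) :
    ∃ W : Set Xm, M.πm z ∈ W ∧ W ⊆ U₁ ∩ U₀ ∧ ∃ b : ℝ → Xm → Z,
      ContMDiffOn (𝓘(ℝ, ℝ).prod 𝓘(ℝ, Em)) 𝓘(ℝ, EZ) ∞ (fun p : ℝ × Xm => b p.1 p.2)
        (Icc (0 : ℝ) 1 ×ˢ W) ∧
      (∀ t ∈ Icc (0 : ℝ) 1, M.IsBraneBisectionOn W (b t) ∧ b t (M.πm z) = z) ∧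
      EqOn (b 0) b₀ W ∧ EqOn (b 1) b₁ W := by
  have hn : (∞ : WithTop ℕ∞) ≠ 0 := by simp
  have hn' : (ω : WithTop ℕ∞) ≠ 0 := by simp
  obtain ⟨ψ, η, pm', pp', hψ, hz, hψz, halt, hnd, hG, hm', hp', hms, hps, hK⟩ :=
    M.exists_darboux_coordinates z
  have hsum := finrank_add_finrank_of_orthogonal halt hnd (pm := (pm' : EZ →ₗ[ℂ] Em))
    (pp := (pp' : EZ →ₗ[ℂ] Ep)) hms hps hK
  have h0 : (0 : EZ) ∈ ψ.target := hψz ▸ ψ.map_source hz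
  have hs0 : ψ.symm 0 = z := by rw [← hψz, ψ.left_inv hz]
  let ξm := chartAt Em (M.πm z)
  let ξp := chartAt Ep (M.πp z)
  have hψr : IsSmoothChart ℝ ∞ ψ :=
    ⟨hψ.contMDiffOn.real_of_complex, hψ.contMDiffOn_symm.real_of_complex⟩
  have hξmc : IsSmoothChart ℂ ω ξm := isSmoothChart_chartAt _
  have hξpc : IsSmoothChart ℂ ω ξp := isSmoothChart_chartAt _
  have hξm : IsSmoothChart ℝ ∞ ξm :=
    ⟨hξmc.contMDiffOn.real_of_complex, hξmc.contMDiffOn_symm.real_of_complex⟩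
  have hξp : IsSmoothChart ℝ ∞ ξp :=
    ⟨hξpc.contMDiffOn.real_of_complex, hξpc.contMDiffOn_symm.real_of_complex⟩
  have hzm : M.πm z ∈ ξm.source := mem_chart_source _ _
  have hzp : M.πp z ∈ ξp.source := mem_chart_source _ _
  have hπm : ContMDiff 𝓘(ℝ, EZ) 𝓘(ℝ, Em) ∞ M.πm := M.submersion_m.holomorphic.real_of_complex
  have hπp : ContMDiff 𝓘(ℝ, EZ) 𝓘(ℝ, Ep) ∞ M.πp := M.submersion_p.holomorphic.real_of_complex
  have hGr : ∀ v ∈ ψ.target, ∀ u w : EZ,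
      imBilin (M.Ω.bilin (ψ.symm v)) (mfderiv 𝓘(ℝ, EZ) 𝓘(ℝ, EZ) ψ.symm v u)
        (mfderiv 𝓘(ℝ, EZ) 𝓘(ℝ, EZ) ψ.symm v w) = imBilin η u w := by
    intro v hv u w
    have hd := (hψ.contMDiffAt_symm hv).mdifferentiableAt hn'
    rw [mfderiv_real_eq_complex hd, mfderiv_real_eq_complex hd]
    exact congrArg Complex.im (hG v hv u w)
  let OV := {v | v ∈ ψ.target ∧ M.πm (ψ.symm v) ∈ ξm.source ∧ M.πp (ψ.symm v) ∈ ξp.source}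
  let pm : EZ → Em := fun v => ξm (M.πm (ψ.symm v))
  let pp : EZ → Ep := fun v => ξp (M.πp (ψ.symm v))
  have hpm0 : pm 0 = ξm (M.πm z) := by simp only [pm, hs0]
  have hm0 : ∀ v ∈ OV, ContDiffAt ℝ ∞ pm v := by
    intro v hv
    have h1 := ContMDiffAt.comp v (hπm (ψ.symm v)) (hψr.contMDiffAt_symm hv.1)
    exact (ContMDiffAt.comp v (hξm.contMDiffAt hv.2.1) h1).contDiffAt
  have hp0 : ∀ v ∈ OV, ContDiffAt ℝ ∞ pp v := by
    intro v hv
    have h1 := ContMDiffAt.comp v (hπp (ψ.symm v)) (hψr.contMDiffAt_symm hv.1)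
    exact (ContMDiffAt.comp v (hξp.contMDiffAt hv.2.2) h1).contDiffAt
  have hdm : fderiv ℝ pm 0 = pm'.restrictScalars ℝ := (hm'.restrictScalars ℝ).fderiv
  have hdp : fderiv ℝ pp 0 = pp'.restrictScalars ℝ := (hp'.restrictScalars ℝ).fderiv
  have hpsr : Function.Surjective (fderiv ℝ pp 0 : EZ →ₗ[ℝ] Ep) := by
    rw [hdp]
    exact hps
  have hk := finrank_ker_add_of_surjective hpsr
  have hf1 := finrank_real_of_complex Em
  have hf2 := finrank_real_of_complex EZ
  have hf3 := finrank_real_of_complex Ep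
  -- A section passes through `z` only over `πm z`.
  have hbz : ∀ {U : Set Xm} {b : Xm → Z}, (∀ x ∈ U, M.πm (b x) = x) → z ∈ b '' U →
      M.πm z ∈ U ∧ b (M.πm z) = z := by
    rintro U b hs ⟨x, hx, rfl⟩
    rw [hs x hx]
    exact ⟨hx, rfl⟩
  obtain ⟨hmU₀, hbz₀⟩ := hbz hb₀.section_m hz₀
  obtain ⟨hmU₁, hbz₁⟩ := hbz hb₁.section_m hz₁
  obtain ⟨O₀, hO₀, hmO₀, hOt, hf₀⟩ := hb₀.exists_isOpen_charts hn hπp hψr hξm hξp hGr hmU₀ hzm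
    (by rwa [hbz₀])
  obtain ⟨O₁, hO₁, hmO₁, -, hf₁⟩ := hb₁.exists_isOpen_charts hn hπp hψr hξm hξp hGr hmU₁ hzm
    (by rwa [hbz₁])
  have hfz₀ : ψ (b₀ (ξm.symm (pm 0))) = 0 := by rw [hpm0, ξm.left_inv hzm, hbz₀, hψz]
  have hfz₁ : ψ (b₁ (ξm.symm (pm 0))) = 0 := by rw [hpm0, ξm.left_inv hzm, hbz₁, hψz]
  have hpz₀ : M.πp (b₀ (ξm.symm (pm 0))) ∈ ξp.source := by rwa [hpm0, ξm.left_inv hzm, hbz₀]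
  have hpz₁ : M.πp (b₁ (ξm.symm (pm 0))) ∈ ξp.source := by rwa [hpm0, ξm.left_inv hzm, hbz₁]
  have hpO₀ : pm 0 ∈ O₀ := by rwa [hpm0]
  have hpO₁ : pm 0 ∈ O₁ := by rwa [hpm0]
  have ht₀ := (hf₀ _ hpO₀).2.2.2.2.2 hpz₀
  have ht₁ := (hf₁ _ hpO₁).2.2.2.2.2 hpz₁
  rw [hfz₀] at ht₀
  rw [hfz₁] at ht₁
  obtain ⟨S, β, κ, hS, hmS, hSO, hβ01, hβ⟩ := exists_section_family (imBilin_isAlt halt)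
    (imBilin_nondegenerate halt hnd) (M.isOpen_domain_in_charts ψ ξm ξp)
    (pm := pm) (pp := pp) ⟨h0, by rwa [hs0], by rwa [hs0]⟩ hm0 hp0
    (fun u v hu hv => by
      rw [hdp] at hu
      rw [hdm] at hv
      exact (congrArg Complex.im ((hK u).1 hu v hv)).trans Complex.zero_im)
    (by omega) (by omega) (by omega) (hO₀.inter hO₁) ⟨hpO₀, hpO₁⟩
    (fun y hy => (hf₀ y hy.1).2.2.1) (fun y hy => (hf₁ y hy.2).2.2.1) hfz₀ hfz₁
    (fun y hy => (hf₀ y hy.1).2.2.2.1) (fun y hy => (hf₁ y hy.2).2.2.2.1)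
    (fun y hy => (hf₀ y hy.1).2.2.2.2.1) (fun y hy => (hf₁ y hy.2).2.2.2.2.1) ht₀ ht₁
  have hSt : S ⊆ ξm.target := fun y hy => hOt (hSO hy).1
  -- The coordinate family is carried back to the manifold by the charts, over the same open set at
  -- all times.
  refine ⟨ξm.source ∩ ξm ⁻¹' S, ⟨hzm, ?_⟩, ?_, fun t x => ψ.symm (β (t, ξm x)), ?_, ?_, ?_, ?_⟩
  · change ξm (M.πm z) ∈ S
    rwa [← hpm0]
  · rintro x ⟨hx, hxS⟩
    have h1 := (hf₀ _ (hSO hxS).1).1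
    have h2 := (hf₁ _ (hSO hxS).2).1
    rw [ξm.left_inv hx] at h1 h2
    exact ⟨h2, h1⟩
  · rintro ⟨t, x⟩ ⟨ht, hx, hxS⟩
    have h1 := (hβ t ht).2 _ hxS
    have h2 : ContMDiffAt (𝓘(ℝ, ℝ).prod 𝓘(ℝ, Em)) 𝓘(ℝ, Em) ∞
        (fun p : ℝ × Xm => ξm p.2) (t, x) :=
      ContMDiffAt.comp (t, x) (hξm.contMDiffAt hx) contMDiffAt_snd
    have h3 : ContMDiffAt (𝓘(ℝ, ℝ).prod 𝓘(ℝ, Em)) 𝓘(ℝ, ℝ × Em) ∞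
        (fun p : ℝ × Xm => (p.1, ξm p.2)) (t, x) := contMDiffAt_fst.prodMk_space h2
    have h4 := ContMDiffAt.comp (t, x) h1.1.contMDiffAt h3
    exact (ContMDiffAt.comp (t, x) (hψr.contMDiffAt_symm h1.2.1.1) h4).contMDiffWithinAt
  · intro t ht
    have h1 := (hβ t ht).2
    refine ⟨isBraneBisectionOn_of_isIsotropic ?_ (by omega), ?_⟩
    · refine isIsotropicBisectionOn_of_charts hn hψr hξm hξp hGr hS hSt
        (β := fun y => β (t, y)) (κ := fun e => κ (t, e)) (fun y hy => ?_)
        (fun y hy => (h1 y hy).2.1) (fun y hy => (h1 y hy).2.2.1)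
        (fun y hy => (h1 y hy).2.2.2.1) (fun y hy => ?_)
        (fun y hy => (h1 y hy).2.2.2.2.2.1) (fun y hy => (h1 y hy).2.2.2.2.2.2)
      · exact ContDiffAt.comp (g := β) (f := fun y => (t, y)) y (h1 y hy).1
          (contDiffAt_const.prodMk contDiffAt_id)
      · exact ContDiffAt.comp (g := κ) (f := fun e => (t, e)) _ (h1 y hy).2.2.2.2.1
          (contDiffAt_const.prodMk contDiffAt_id)
    · change ψ.symm (β (t, ξm (M.πm z))) = z
      rw [← hpm0, (hβ t ht).1, hs0]
  · rintro x ⟨hx, hxS⟩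
    change ψ.symm (β (0, ξm x)) = b₀ x
    rw [(hβ01 _ hxS).1, (hf₀ _ (hSO hxS).1).2.1, ξm.left_inv hx]
  · rintro x ⟨hx, hxS⟩
    change ψ.symm (β (1, ξm x)) = b₁ x
    rw [(hβ01 _ hxS).2, (hf₁ _ (hSO hxS).2).2.1, ξm.left_inv hx]

end HolMoritaEquiv

end

theorem proposition7p1 {Ep Xp Em Xm EZ Z : Type*}
    [NormedAddCommGroup Ep] [NormedSpace ℂ Ep] [FiniteDimensional ℂ Ep]
    [TopologicalSpace Xp] [T2Space Xp] [SecondCountableTopology Xp]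
    [ChartedSpace Ep Xp] [IsManifold 𝓘(ℂ, Ep) ω Xp]
    [NormedAddCommGroup Em] [NormedSpace ℂ Em] [FiniteDimensional ℂ Em]
    [TopologicalSpace Xm] [T2Space Xm] [SecondCountableTopology Xm]
    [ChartedSpace Em Xm] [IsManifold 𝓘(ℂ, Em) ω Xm]
    [NormedAddCommGroup EZ] [NormedSpace ℂ EZ] [FiniteDimensional ℂ EZ]
    [TopologicalSpace Z] [T2Space Z] [SecondCountableTopology Z]
    [ChartedSpace EZ Z] [IsManifold 𝓘(ℂ, EZ) ω Z]
    {σp : HolPoisson Ep Xp} {σm : HolPoisson Em Xm} (M : HolMoritaEquiv σp σm EZ Z)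
    (U : Set Xm) (brane : Xm → Z) (hbrane : M.IsBraneBisectionOn U brane)
    (z : Z) (hz : z ∈ brane '' U) :
    (∃ (U' : Set Xm) (Λ : Xm → Z), M.IsHolLagrangianBisectionOn U' Λ ∧ z ∈ Λ '' U') ∧
    ∀ (U' : Set Xm) (Λ : Xm → Z), M.IsHolLagrangianBisectionOn U' Λ → z ∈ Λ '' U' →
      ∃ W : Set Xm, M.πm z ∈ W ∧ W ⊆ U ∩ U' ∧ ∃ b : ℝ → Xm → Z,
        ContMDiffOn (𝓘(ℝ, ℝ).prod 𝓘(ℝ, Em)) 𝓘(ℝ, EZ) ∞ (fun p : ℝ × Xm => b p.1 p.2)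
          (Set.Icc (0 : ℝ) 1 ×ˢ W) ∧
        (∀ t ∈ Set.Icc (0 : ℝ) 1, M.IsBraneBisectionOn W (b t) ∧ b t (M.πm z) = z) ∧
        Set.EqOn (b 0) Λ W ∧ Set.EqOn (b 1) brane W := by
  obtain ⟨x, hx, hxz⟩ := hz
  -- The relation between the dimensions is not part of the data of `M`; the brane supplies it, for
  -- existence as well as for the isotopy.
  have hdim := hbrane.two_mul_finrank hx
  refine ⟨M.exists_isHolLagrangianBisectionOn z hdim, fun U' Λ hΛ hzΛ => ?_⟩
  exact M.exists_isotopy_of_isIsotropic hΛ.isIsotropic_real hbrane.isIsotropic hdim hzΛ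
    ⟨x, hx, hxz⟩
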